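/- Let $g\ge 1$, let $\mathbf f=(f_1,\dots,f_g)$ be positive integers and put $n=\sum_{i=1}^g f_i$, $C_i=f_1+\dots+f_i$ ($C_0=0$). *Notation.* A tuple $\ell\in\mathbb N_0^n$ is called admissible if it is constant on each block of indices $C_{i-1}<j\le C_i$, $i=1,\dots,g$; let $\lambda(\ell)$ be the partition obtained by arranging its entries in non-ascending order. A weak ordering on $g$ is a pair $v=(\sigma,J)$ with $\sigma\in S_g$ and $\mathrm{Des}(\sigma)\subseteq J\subseteq\{1,\dots,g-1\}$, where $\mathrm{Des}(\sigma)=\{j:\sigma(j)>\sigma(j+1)\}$. To an admissible $\ell$ belongs the unique weak ordering $v_\ell=(\sigma,J)$ for which $\ell_{C_{\sigma(1)}}\ge\dots\ge\ell_{C_{\sigma(g)}}$ and $J=\{j:\ell_{C_{\sigma(j)}}>\ell_{C_{\sigma(j+1)}}\}$. Every Dyck word $w$ of length $2n$ in the letters $\mathbf 0,\mathbf 1$ (each occurring $n$ times, no initial segment having more ones than zeroes) is uniquely of the form $w=\prod_{i=1}^r \mathbf 0^{L_i-L_{i-1}}\mathbf 1^{M_i-M_{i-1}}$ with $0=L_0<L_1<\dots<L_r=n$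 and $0=M_0<M_1<\dots<M_r=n$. For partitions $\mu\le\lambda$ with $n$ non-negative parts ($\mu_i\le\lambda_i$ for all $i$) let $w(\mu,\lambda)$ be the Dyck word whose $L_i,M_i$ satisfy $$\lambda_1\ge\dots\ge\lambda_{L_1}\ge\mu_1\ge\dots\ge\mu_{M_1}>\lambda_{L_1+1}\ge\dots\ge\lambda_{L_2}\ge\mu_{M_1+1}\ge\dots\ge\mu_{M_2}>\cdots>\lambda_{L_{r-1}+1}\ge\dots\ge\lambda_n\ge\mu_{M_{r-1}+1}\ge\dots\ge\mu_n .$$ For a prime $p$ let $\alpha(\lambda,\mu;p)$ be the number of subgroups of type $\mu$ (isomorphic to $\prod_i\mathbb Z/p^{\mu_i}\mathbb Z$) in the abelian $p$-group $\prod_i\mathbb Z/p^{\lambda_i}\mathbb Z$ of type $\lambda$. An ordered partition $\mathcal A=(\mathcal A_1,\dots,\mathcal A_s)$ of $\{1,\dots,g\}$ into non-empty, pairwise disjoint subsets is compatible with $w$ if $s=r$ and $\sum_{j\in\mathcal A_i}f_j=L_i-L_{i-1}$ for all $i$. If $\mathcal A$ is compatible with $w$ and $v=(\sigma,J)$ is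 a weak ordering, write $\mathcal A(w,v)=\mathcal A$ if there are $0=t_0<t_1<\dots<t_r=g$ with $t_1,\dots,t_{r-1}\in J$ and $\mathcal A_k=\{\sigma(t_{k-1}+1),\dots,\sigma(t_k)\}$ for all $k$. For a prime $p$ put $$D^{\mathbf f}_{w,\mathcal A}(p,t)=\sum_{v:\ \mathcal A(w,v)=\mathcal A}\ \ \sum_{\substack{\ell\ \text{admissible}\\ v_\ell=v}}\ \ \sum_{\substack{\mu\le\lambda(\ell)\\ w(\mu,\lambda(\ell))=w}}\alpha(\lambda(\ell),\mu;p)\,(p^{2n}t)^{\sum_i\mu_i}\,t^{2\sum_i\ell_i}\ \in\ \mathbb Q[[t]].$$ *Statement.* For every Dyck word $w$ of length $2n$ and every set partition $\mathcal A$ of $\{1,\dots,g\}$ compatible with $w$, there is a rational function $W\in\mathbb Q(X,Y)$ such that, for all primes $p$, $D^{\mathbf f}_{w,\mathcal A}(p,t)$ is the power series expansion in $t$ of $W(p,t)$, and $$W(X^{-1},Y^{-1})=(-1)^{g+n}\,X^{\frac{5n^2-n}{2}}\,Y^{5n}\,W(X,Y).$$ In other words, $D^{\mathbf f}_{w,\mathcal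 A}(p^{-1},t^{-1})=(-1)^{g+n}p^{\frac{5n^2-n}{2}}t^{5n}D^{\mathbf f}_{w,\mathcal A}(p,t)$. The symmetry factor is therefore independent of $w$ and $\mathcal A$. -/

import Mathlib

open Finset PowerSeries

namespace HeisenbergDyck

/-! ### Rational functions in two variables -/

/-- The field `ℚ(X, Y)`. -/
abbrev RatXY : Type := FractionRing (MvPolynomial (Fin 2) ℚ)

/-- The element `X` of `ℚ(X, Y)`. -/
noncomputable def varX : RatXY := algebraMap (MvPolynomial (Fin 2) ℚ) RatXY (MvPolynomial.X 0)

/-- The element `Y` of `ℚ(X, Y)`. -/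
noncomputable def varY : RatXY := algebraMap (MvPolynomial (Fin 2) ℚ) RatXY (MvPolynomial.X 1)

/-- The substitution `N(X, Y) ↦ N(X⁻¹, Y⁻¹)` on polynomials. -/
noncomputable def invPoly : MvPolynomial (Fin 2) ℚ →+* RatXY :=
  (MvPolynomial.aeval (R := ℚ) ![varX⁻¹, varY⁻¹]).toRingHom

theorem invPoly_monomial_mul (m : Fin 2 →₀ ℕ) (c : ℚ) :
    invPoly (MvPolynomial.monomial m c) *
      algebraMap (MvPolynomial (Fin 2) ℚ) RatXY (MvPolynomial.monomial m 1) =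
      algebraMap (MvPolynomial (Fin 2) ℚ) RatXY (MvPolynomial.C c) := by
  have hX : varX ≠ 0 := by
    simp [varX]
  have hY : varY ≠ 0 := by
    simp [varY]
  have h1 : invPoly (MvPolynomial.monomial m c) =
      algebraMap ℚ RatXY c * (varX⁻¹ ^ m 0 * varY⁻¹ ^ m 1) := by
    simp [invPoly, MvPolynomial.aeval_monomial, Finsupp.prod_fintype]
  have h2 : algebraMap (MvPolynomial (Fin 2) ℚ) RatXY (MvPolynomial.monomial m 1) =
      varX ^ m 0 * varY ^ m 1 := by
    rw [MvPolynomial.monomial_eq]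
    simp [varX, varY, Finsupp.prod_fintype]
  have h3 : algebraMap (MvPolynomial (Fin 2) ℚ) RatXY (MvPolynomial.C c) =
      algebraMap ℚ RatXY c := by
    rw [IsScalarTower.algebraMap_apply ℚ (MvPolynomial (Fin 2) ℚ) RatXY,
      MvPolynomial.algebraMap_eq]
  have h4 : varX⁻¹ ^ m 0 * varX ^ m 0 = 1 := by
    rw [← mul_pow, inv_mul_cancel₀ hX, one_pow]
  have h5 : varY⁻¹ ^ m 1 * varY ^ m 1 = 1 := by
    rw [← mul_pow, inv_mul_cancel₀ hY, one_pow]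
  rw [h1, h2, h3]
  linear_combination (algebraMap ℚ RatXY c) * varY⁻¹ ^ m 1 * varY ^ m 1 * h4 +
    (algebraMap ℚ RatXY c) * h5

theorem invPoly_injective : Function.Injective invPoly := by
  rw [injective_iff_map_eq_zero]
  intro P hP
  by_contra hne
  set D : Fin 2 →₀ ℕ := P.support.sup id with hD
  have hle : ∀ m ∈ P.support, m ≤ D := fun m hm => Finset.le_sup (f := id) hm
  set R : MvPolynomial (Fin 2) ℚ :=
    ∑ m ∈ P.support, MvPolynomial.monomial (D - m) (P.coeff m) with hR
  have key : invPoly P *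
      algebraMap (MvPolynomial (Fin 2) ℚ) RatXY (MvPolynomial.monomial D 1) =
      algebraMap (MvPolynomial (Fin 2) ℚ) RatXY R := by
    conv_lhs => rw [P.as_sum]
    rw [map_sum, Finset.sum_mul, hR, map_sum]
    refine Finset.sum_congr rfl fun m hm => ?_
    have e1 : (MvPolynomial.monomial D (1 : ℚ)) =
        MvPolynomial.monomial m 1 * MvPolynomial.monomial (D - m) 1 := by
      rw [MvPolynomial.monomial_mul, add_tsub_cancel_of_le (hle m hm), one_mul]
    rw [e1, map_mul, ← mul_assoc, invPoly_monomial_mul, ← map_mul,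
      MvPolynomial.C_mul_monomial, mul_one]
  rw [hP, zero_mul] at key
  have hR0 : R = 0 := by
    have := key.symm
    rwa [map_eq_zero_iff _ (IsFractionRing.injective _ _)] at this
  obtain ⟨m, hm⟩ := MvPolynomial.ne_zero_iff.mp hne
  apply hm
  have hms : m ∈ P.support := MvPolynomial.mem_support_iff.mpr hm
  have hc : R.coeff (D - m) = P.coeff m := by
    rw [hR, MvPolynomial.coeff_sum, Finset.sum_eq_single m]
    · simp
    · intro b hb hbm
      rw [MvPolynomial.coeff_monomial, if_neg]
      intro h
      apply hbm
      have h1 := add_tsub_cancel_of_le (hle b hb)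
      have h2 := add_tsub_cancel_of_le (hle m hms)
      rw [h, ← h2] at h1
      simpa using h1
    · exact fun h => absurd hms h
  rw [← hc, hR0, MvPolynomial.coeff_zero]

/-- The substitution `W(X, Y) ↦ W(X⁻¹, Y⁻¹)` on `ℚ(X, Y)`. -/
noncomputable def invVars : RatXY →+* RatXY :=
  IsFractionRing.lift (A := MvPolynomial (Fin 2) ℚ) invPoly_injective

/-- The specialisation `N(X, Y) ↦ N(p, t)`, with values in power series in an indeterminate `t`. -/
noncomputable def specialise (p : ℕ) : MvPolynomial (Fin 2) ℚ →ₐ[ℚ] ℚ⟦X⟧ :=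
  MvPolynomial.aeval ![(p : ℚ⟦X⟧), (PowerSeries.X : ℚ⟦X⟧)]

/-- The rational function `W` represents the family of generating functions `F p`, for `p` prime:
one can write `W = N / Q` such that `F p` is the power series expansion in `t` of
`N(p, t) / Q(p, t)`, for all primes `p`. -/
def Represents (W : RatXY) (F : ℕ → ℚ⟦X⟧) : Prop :=
  ∃ N Q : MvPolynomial (Fin 2) ℚ,
    W = algebraMap _ RatXY N / algebraMap _ RatXY Q ∧
    ∀ p : ℕ, p.Prime → specialise p Q ≠ 0 ∧ specialise p Q * F p = specialise p N

/-! ### Partitions, Dyck words, subgroups of abelian `p`-groups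

Partitions with `n` non-negative parts are antitone functions `Fin n → ℕ`; indices are shifted
by one, so that the `j`-th part of `lam` is `lam ⟨j - 1, _⟩`. -/

/-- `α(λ, μ; p)`: the number of subgroups of type `μ` in an abelian `p`-group of type `λ`. -/
noncomputable def alpha {n : ℕ} (lam mu : Fin n → ℕ) (p : ℕ) : ℕ :=
  Nat.card {H : AddSubgroup (∀ i : Fin n, ZMod (p ^ lam i)) //
    Nonempty (H ≃+ ∀ i : Fin n, ZMod (p ^ mu i))}

/-- `w` is the word `∏ᵢ 0^(Lᵢ - Lᵢ₋₁) 1^(Mᵢ - Mᵢ₋₁)`, `i = 1, …, r`, with non-empty blocks. The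
letters `0`, `1` are the steps `U`, `D`. Every Dyck word has exactly one such form. -/
def IsBlockForm (w : DyckWord) {r : ℕ} (L M : Fin (r + 1) → ℕ) : Prop :=
  L 0 = 0 ∧ M 0 = 0 ∧ StrictMono L ∧ StrictMono M ∧
  w.toList = (List.ofFn fun i : Fin r =>
    List.replicate (L i.succ - L i.castSucc) DyckStep.U ++
      List.replicate (M i.succ - M i.castSucc) DyckStep.D).flatten

/-- `w(μ, λ) = w`: the numbers `Lᵢ`, `Mᵢ` of the word `w` are those for which
`λ₁ ≥ ⋯ ≥ λ_{L₁} ≥ μ₁ ≥ ⋯ ≥ μ_{M₁} > λ_{L₁+1} ≥ ⋯ ≥ λ_{L₂} ≥ μ_{M₁+1} ≥ ⋯ ≥ μ_{M₂} > ⋯`. -/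
def HasOverlap {n : ℕ} (mu lam : Fin n → ℕ) (w : DyckWord) : Prop :=
  ∃ (r : ℕ) (L M : Fin (r + 1) → ℕ), IsBlockForm w L M ∧ Antitone mu ∧ Antitone lam ∧
    (∀ i : Fin r, ∀ a b : Fin n, (a : ℕ) + 1 = L i.succ → (b : ℕ) = M i.castSucc →
      mu b ≤ lam a) ∧
    (∀ i : Fin (r + 1), 0 < i → i < Fin.last r → ∀ a b : Fin n, (a : ℕ) = L i →
      (b : ℕ) + 1 = M i → lam a < mu b)

/-! ### Admissible tuples and weak orderings -/

/-- `C_k = f_1 + ⋯ + f_k`. -/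
def partialSum {g : ℕ} (f : Fin g → ℕ) (k : ℕ) : ℕ :=
  ∑ j ∈ univ.filter (fun j : Fin g => (j : ℕ) < k), f j

/-- `ℓ` is admissible for `(𝟏, f)`: it is constant on each block of indices `]C_{i-1}, C_i]`. -/
def IsAdmissible {g : ℕ} (f : Fin g → ℕ) {n : ℕ} (l : Fin n → ℕ) : Prop :=
  ∀ i : Fin g, ∀ j k : Fin n,
    partialSum f i ≤ j → (j : ℕ) < partialSum f (i + 1) →
    partialSum f i ≤ k → (k : ℕ) < partialSum f (i + 1) → l j = l k

/-- `ψ(ℓ) = (ℓ_{C_1}, …, ℓ_{C_g})`. (The index is always in range when `f` is positive with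
sum `n`.) -/
def blockValues {g : ℕ} (f : Fin g → ℕ) {n : ℕ} (l : Fin n → ℕ) (i : Fin g) : ℕ :=
  if h : partialSum f (i + 1) - 1 < n then l ⟨partialSum f (i + 1) - 1, h⟩ else 0

/-- `λ(ℓ)`: the entries of `ℓ` in non-ascending order. -/
def sortDesc {n : ℕ} (l : Fin n → ℕ) : Fin n → ℕ :=
  fun i => l (Tuple.sort l i.rev)

/-- For `x : Fin g → ℕ`, the set of `j ∈ {1, …, g - 1}` such that the `j`-th entry of `x` is
greater than the `(j + 1)`-st one. -/
def dropSet {g : ℕ} (x : Fin g → ℕ) : Finset ℕ :=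
  (Icc 1 (g - 1)).filter fun j => ∃ a b : Fin g, (a : ℕ) + 1 = j ∧ (b : ℕ) = j ∧ x b < x a

/-- The set `WO_g` of weak orderings `(σ, J)`, `σ ∈ S_g`, `Des(σ) ⊆ J ⊆ {1, …, g - 1}`. -/
def weakOrderings (g : ℕ) : Finset (Equiv.Perm (Fin g) × Finset ℕ) :=
  (univ ×ˢ (Icc 1 (g - 1)).powerset).filter fun v => dropSet (fun i => (v.1 i : ℕ)) ⊆ v.2

/-- `v_ℓ = v`, for `x = ψ(ℓ)` and a weak ordering `v = (σ, J)`: the entries `x_{σ(1)}, x_{σ(2)}, …`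
are in non-ascending order, and `J` is the set of places where they drop. -/
def IsOrderOf {g : ℕ} (x : Fin g → ℕ) (v : Equiv.Perm (Fin g) × Finset ℕ) : Prop :=
  v ∈ weakOrderings g ∧ Antitone (x ∘ v.1) ∧ v.2 = dropSet (x ∘ v.1)

/-- `A` is an (ordered) set partition of `{1, …, g}` compatible with the Dyck word `w`. -/
def IsCompatible {g : ℕ} (f : Fin g → ℕ) (w : DyckWord) {s : ℕ} (A : Fin s → Finset (Fin g)) :
    Prop :=
  (∀ i, (A i).Nonempty) ∧ (∀ i j, i ≠ j → Disjoint (A i) (A j)) ∧ univ.biUnion A = univ ∧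
  ∃ L M : Fin (s + 1) → ℕ, IsBlockForm w L M ∧
    ∀ i : Fin s, ∑ j ∈ A i, f j = L i.succ - L i.castSucc

/-- `𝒜(w, v) = A`: there are `0 = t_0 < t_1 < ⋯ < t_s = g` with `t_1, …, t_{s-1} ∈ J_v` such that
`A_k = {σ_v(t_{k-1} + 1), …, σ_v(t_k)}`, and `A` is compatible with `w`. -/
def InducesPartition {g : ℕ} (f : Fin g → ℕ) (w : DyckWord)
    (v : Equiv.Perm (Fin g) × Finset ℕ) {s : ℕ} (A : Fin s → Finset (Fin g)) : Prop :=
  IsCompatible f w A ∧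
  ∃ t : Fin (s + 1) → ℕ, t 0 = 0 ∧ t (Fin.last s) = g ∧ StrictMono t ∧
    (∀ i : Fin (s + 1), 0 < i → i < Fin.last s → t i ∈ v.2) ∧
    ∀ k : Fin s, A k =
      (univ.filter fun j : Fin g => t k.castSucc ≤ j ∧ (j : ℕ) < t k.succ).image v.1

/-! ### The generating functions -/

open Classical in
/-- The generating function
`D_{w,v}(p, t) = ∑_ℓ ∑_μ α(λ(ℓ), μ; p) (p^{2n} t)^{∑ μ_i} t^{2 ∑ ℓ_i}`, as a power series in `t`,
where `ℓ` is admissible with `v_ℓ = v` and `μ ≤ λ(ℓ)` is a partition with `w(μ, λ(ℓ)) = w`.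
In a pair `(ℓ, μ)` that contributes to the coefficient of `t^m`, all entries are at most `m`. -/
noncomputable def genFunWV {g : ℕ} (f : Fin g → ℕ) (n : ℕ) (w : DyckWord)
    (v : Equiv.Perm (Fin g) × Finset ℕ) (p : ℕ) : ℚ⟦X⟧ :=
  PowerSeries.mk fun m =>
    ∑ q ∈ ((Fintype.piFinset fun _ : Fin n => range (m + 1)) ×ˢ
        (Fintype.piFinset fun _ : Fin n => range (m + 1))).filter (fun q =>
          IsAdmissible f q.1 ∧ IsOrderOf (blockValues f q.1) v ∧
          q.2 ≤ sortDesc q.1 ∧ HasOverlap q.2 (sortDesc q.1) w ∧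
          ∑ i, q.2 i + 2 * ∑ i, q.1 i = m),
      (alpha (sortDesc q.1) q.2 p : ℚ) * ((p : ℚ) ^ (2 * n)) ^ (∑ i, q.2 i)

open Classical in
/-- `D_{w,A}(p, t) = ∑_v D_{w,v}(p, t)`, the sum over the weak orderings `v` with
`𝒜(w, v) = A`. -/
noncomputable def genFun {g : ℕ} (f : Fin g → ℕ) (n : ℕ) (w : DyckWord) {s : ℕ}
    (A : Fin s → Finset (Fin g)) (p : ℕ) : ℚ⟦X⟧ :=
  ∑ v ∈ (weakOrderings g).filter (fun v => InducesPartition f w v A), genFunWV f n w v p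

end HeisenbergDyck

/-!
The value of an admissible tuple on its `g` blocks is a tuple `x`, so the summands of the generating
function are indexed by pairs `(x, μ)`, called configurations. Since every `x` has exactly one weak
ordering (`isOrderOf_iff`), the conditions on `v`, `ℓ` and `μ` together say that `x` and `μ`
interleave blockwise as the Dyck word prescribes: if `b a` is the index of the part of the set
partition that contains `a`, then `x a` is at least the entries `μ j` with `j ≥ M (b a)` and less
than those with `j < M (b a)` (`exists_cuts_iff`, `mem_validConfigs_iff`, `genFun_eq`).

The number of subgroups of type `μ` is given by Birkhoff's formula (`alpha_eq`), which is proved by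
counting injective homomorphisms, that is, bases of subgroups. On the configurations of a Dyck word
the numerators in this formula do not depend on `(x, μ)` (`alpha_mul_pow_eq`); they give the factor
`leadFactor`. What remains is a power of `p`, whose exponent changes by a fixed amount if all
entries in a given support are raised by one, times the factors `tieFactor` for the repeated entries
of `μ`.

Consider the configurations whose support consists of the first `m` entries of `μ` and of a set `S`
of blocks. Adding one to all the entries in the support multiplies the summands by a fixed monomial
`stateWeight`. Following the blocks of the Dyck word from the left, the possible supports grow
either by elements of one part of the set partition or by entries of `μ` in one block. This gives
linear recursions `R s = x s * ∑_{t ≤ s} ζ t s * R t` over a Boolean lattice with `ζ = 1`, and over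
a chain with `ζ k l = 1 / ((1 - p⁻¹) ⋯ (1 - p⁻⁽ˡ⁻ᵏ⁾))`, whose solutions are sums over chains
(`chainSum`). Hence the generating function is `leadFactor * blockProduct`
(`toFrac_configSeries_eq_blockProduct`), which is a rational function of `p` and `t`.

The functional equation comes from a reciprocity for such recursions (`chainSumLE_inv`): if
inverting the variables turns `ζ` into its inverse in the incidence algebra, up to a factor `ε`,
then it exchanges the sum over all chains with the sum over the chains that end in the top element,
up to `ε` of the top element; these two sums differ by the factor `x s` of the top element `s`. For
Boolean lattices this is Möbius inversion, for chains the inversion of the `q`-exponential series.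
The monomials that arise from the single blocks multiply up to one that depends only on `n`, `g`
(`leadFactor_mul_blockProduct_inv`).
-/

namespace HeisenbergDyck

/-! ### Linear recursions over a poset and their reciprocity -/

section Recursion

variable {P F : Type*} [PartialOrder P] [LocallyFiniteOrderBot P] [OrderBot P] [WellFoundedLT P]
  [DecidableEq P] [Field F]

/-- The solution `R` of the recursion `R ⊥ = 1`, `R s = x s * ∑_{t ≤ s} ζ t s * R t` for `s ≠ ⊥`,
in the case that `ζ s s = 1`. It is the sum over all chains `⊥ < s₁ < ⋯ < s_k = s` of the products
of the transition weights `ζ` and of the factors `x sᵢ / (1 - x sᵢ)`. -/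
def chainSum (ζ : P → P → F) (x : P → F) : P → F :=
  wellFounded_lt.fix fun s R =>
    if s = ⊥ then 1
    else x s / (1 - x s) * ∑ t ∈ (Iio s).attach, ζ t.1 s * R t.1 (mem_Iio.1 t.2)

/-- The sum `∑_{t ≤ s} ζ t s * R t` for `R = chainSum ζ x`. -/
def chainSumLE (ζ : P → P → F) (x : P → F) (s : P) : F :=
  ∑ t ∈ Iic s, ζ t s * chainSum ζ x t

omit [OrderBot P] [WellFoundedLT P] [DecidableEq P] in
theorem sum_Iic_eq_add_sum_Iio {A : Type*} [AddCommMonoid A] (h : P → A) (s : P) :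
    ∑ t ∈ Iic s, h t = h s + ∑ t ∈ Iio s, h t := by
  classical
  rw [← Iio_insert, sum_insert (by simp)]

theorem chainSum_bot (ζ : P → P → F) (x : P → F) : chainSum ζ x ⊥ = 1 := by
  rw [chainSum, WellFounded.fix_eq, if_pos rfl]

theorem chainSum_of_ne_bot (ζ : P → P → F) (x : P → F) {s : P} (hs : s ≠ ⊥) :
    chainSum ζ x s = x s / (1 - x s) * ∑ t ∈ Iio s, ζ t s * chainSum ζ x t := by
  rw [chainSum, WellFounded.fix_eq, if_neg hs, ← sum_attach (Iio s)]

theorem chainSumLE_bot {ζ : P → P → F} (hζ : ∀ s, ζ s s = 1) (x : P → F) :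
    chainSumLE ζ x ⊥ = 1 := by
  have : Iic (⊥ : P) = {⊥} := by ext; simp
  rw [chainSumLE, this, sum_singleton, chainSum_bot, hζ, mul_one]

theorem chainSum_eq_mul_chainSumLE {ζ : P → P → F} {x : P → F} (hζ : ∀ s, ζ s s = 1) {s : P}
    (hs : s ≠ ⊥) (hx : x s ≠ 1) : chainSum ζ x s = x s * chainSumLE ζ x s := by
  have h1 : 1 - x s ≠ 0 := sub_ne_zero.2 hx.symm
  have h2 := chainSum_of_ne_bot ζ x hs
  rw [chainSumLE, sum_Iic_eq_add_sum_Iio, hζ, one_mul]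
  field_simp at h2
  linear_combination h2

/-- The recursion determines its solution up to the initial value. -/
theorem eq_mul_chainSum {ζ : P → P → F} {x : P → F} (hζ : ∀ s, ζ s s = 1) (R : P → F) {s₀ : P}
    (hx : ∀ s ≤ s₀, s ≠ ⊥ → x s ≠ 1)
    (hR : ∀ s ≤ s₀, s ≠ ⊥ → R s = x s * ∑ t ∈ Iic s, ζ t s * R t) {s : P} (hs : s ≤ s₀) :
    R s = R ⊥ * chainSum ζ x s := by
  induction s using WellFoundedLT.induction with
  | _ s ih =>
    by_cases hb : s = ⊥
    · rw [hb, chainSum_bot, mul_one]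
    have h1 : 1 - x s ≠ 0 := sub_ne_zero.2 (hx s hs hb).symm
    have h2 := hR s hs hb
    rw [sum_Iic_eq_add_sum_Iio, hζ, one_mul,
      sum_congr rfl (g := fun t => R ⊥ * (ζ t s * chainSum ζ x t)) fun t ht => by
        rw [ih t (mem_Iio.1 ht) ((mem_Iio.1 ht).le.trans hs)]; ring, ← mul_sum] at h2
    rw [chainSum_of_ne_bot ζ x hb]
    field_simp
    linear_combination h2

theorem sum_Iic_eq_mul_chainSumLE {ζ : P → P → F} {x : P → F} (hζ : ∀ s, ζ s s = 1) (R : P → F)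
    {s₀ : P} (hx : ∀ s ≤ s₀, s ≠ ⊥ → x s ≠ 1)
    (hR : ∀ s ≤ s₀, s ≠ ⊥ → R s = x s * ∑ t ∈ Iic s, ζ t s * R t) :
    ∑ t ∈ Iic s₀, ζ t s₀ * R t = R ⊥ * chainSumLE ζ x s₀ := by
  rw [chainSumLE, mul_sum]
  refine sum_congr rfl fun t ht => ?_
  rw [eq_mul_chainSum hζ R hx hR (mem_Iic.1 ht)]
  ring

/-- Reciprocity: if `ε u * ζ' u s / ε s` is the inverse of `ζ` in the incidence algebra, then
inverting the variables `x s` and replacing `ζ` by `ζ'` exchanges the sums `chainSum` and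
`chainSumLE`, up to the factor `ε`. -/
theorem chainSumLE_inv [DecidableLE P] {ζ ζ' : P → P → F} {x x' : P → F} {ε : P → F}
    (hζ : ∀ s, ζ s s = 1) (hζ' : ∀ s, ζ' s s = 1) (hε : ε ⊥ = 1) {s₀ : P}
    (hx : ∀ s ≤ s₀, s ≠ ⊥ → x s ≠ 1)
    (hx0 : ∀ s ≤ s₀, s ≠ ⊥ → x s ≠ 0) (hx' : ∀ s ≤ s₀, s ≠ ⊥ → x' s = (x s)⁻¹)
    (hinv : ∀ t s, t < s →
      ∑ u ∈ (Iic s).filter (fun u => t ≤ u), ζ t u * (ε u * ζ' u s) = 0)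
    {s : P} (hs : s ≤ s₀) :
    chainSumLE ζ' x' s = ε s * chainSum ζ x s := by
  have key : ∀ s, ε s * chainSum ζ x s = ∑ u ∈ Iic s, ε u * ζ' u s * chainSumLE ζ x u := by
    intro s
    have e1 : ∀ u ∈ Iic s, ε u * ζ' u s * chainSumLE ζ x u =
        ∑ t ∈ Iic s, if t ≤ u then ζ t u * (ε u * ζ' u s) * chainSum ζ x t else 0 := by
      intro u hu
      rw [chainSumLE, mul_sum, ← sum_filter]
      have : (Iic s).filter (fun t => t ≤ u) = Iic u := by
        ext t
        simp only [mem_filter, mem_Iic, and_iff_right_iff_imp]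
        exact fun h => h.trans (mem_Iic.1 hu)
      rw [this]
      exact sum_congr rfl fun t _ => by ring
    rw [sum_congr rfl e1, sum_comm, sum_eq_single_of_mem s (mem_Iic.2 le_rfl)]
    · rw [← sum_filter, sum_eq_single_of_mem s (by simp)]
      · rw [hζ, hζ']; ring
      · intro u hu hne
        rw [mem_filter, mem_Iic] at hu
        exact absurd (le_antisymm hu.1 hu.2) hne
    · intro t ht hne
      rw [← sum_filter, ← sum_mul, hinv t s (lt_of_le_of_ne (mem_Iic.1 ht) hne), zero_mul]
  have hb : ∀ s, chainSumLE ζ' x' s - ε s * chainSum ζ x s =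
      ∑ u ∈ Iic s, ζ' u s * (chainSum ζ' x' u - ε u * chainSumLE ζ x u) := by
    intro s
    rw [key, chainSumLE, ← sum_sub_distrib]
    exact sum_congr rfl fun u _ => by ring
  have ha : ∀ s ≤ s₀, chainSum ζ' x' s - ε s * chainSumLE ζ x s = 0 := by
    intro s
    induction s using WellFoundedLT.induction with
    | _ s ih =>
      intro hs
      by_cases hbot : s = ⊥
      · rw [hbot, chainSum_bot, hε, chainSumLE_bot hζ]; ring
      have h1 := hb s
      rw [sum_Iic_eq_add_sum_Iio, hζ', one_mul, sum_eq_zero, add_zero] at h1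
      · have hxs := hx s hs hbot
        have hx0s := hx0 s hs hbot
        have h2 := chainSum_eq_mul_chainSumLE hζ hbot hxs
        have h3 := chainSum_eq_mul_chainSumLE (x := x') hζ' hbot (by
          rw [hx' s hs hbot]; exact fun h => hxs (inv_eq_one.1 h))
        rw [hx' s hs hbot] at h3
        rw [h2] at h1
        have h4 : (chainSum ζ' x' s - ε s * chainSumLE ζ x s) * (1 - x s) = 0 := by
          have h5 : x s * chainSum ζ' x' s = chainSumLE ζ' x' s := by
            rw [h3]; field_simp
          linear_combination -h1 - h5
        exact (mul_eq_zero.1 h4).resolve_right (sub_ne_zero.2 hxs.symm)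
      · intro t ht
        rw [ih t (mem_Iio.1 ht) ((mem_Iio.1 ht).le.trans hs), mul_zero]
  have h1 := hb s
  rw [sum_eq_zero] at h1
  · exact sub_eq_zero.1 h1
  · intro t ht
    rw [ha t ((mem_Iic.1 ht).trans hs), mul_zero]

theorem map_chainSum {G : Type*} [Field G] (φ : F →+* G) (ζ : P → P → F) (x : P → F) (s : P) :
    φ (chainSum ζ x s) = chainSum (fun t u => φ (ζ t u)) (fun t => φ (x t)) s := by
  induction s using WellFoundedLT.induction with
  | _ s ih =>
    by_cases hb : s = ⊥
    · rw [hb, chainSum_bot, chainSum_bot, map_one]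
    rw [chainSum_of_ne_bot _ _ hb, chainSum_of_ne_bot _ _ hb, map_mul, map_div₀, map_sub, map_one,
      map_sum]
    congr 1
    exact sum_congr rfl fun t ht => by rw [map_mul, ih t (mem_Iio.1 ht)]

theorem map_chainSumLE {G : Type*} [Field G] (φ : F →+* G) (ζ : P → P → F) (x : P → F) (s : P) :
    φ (chainSumLE ζ x s) = chainSumLE (fun t u => φ (ζ t u)) (fun t => φ (x t)) s := by
  rw [chainSumLE, chainSumLE, map_sum]
  exact sum_congr rfl fun t _ => by rw [map_mul, map_chainSum]

end Recursion

section Igusa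

variable {F : Type*} [Field F]

/-- `1 / ((1 - q) (1 - q ^ 2) ⋯ (1 - q ^ c))`. -/
def qFactInv (q : F) (c : ℕ) : F := ∏ i ∈ range c, (1 - q ^ (i + 1))⁻¹

theorem qFactInv_zero (q : F) : qFactInv q 0 = 1 := prod_range_zero _

theorem one_sub_mul_qFactInv_succ {q : F} (hq : ∀ i, q ^ (i + 1) ≠ 1) (c : ℕ) :
    (1 - q ^ (c + 1)) * qFactInv q (c + 1) = qFactInv q c := by
  have : 1 - q ^ (c + 1) ≠ 0 := sub_ne_zero.2 (hq c).symm
  rw [qFactInv, prod_range_succ, qFactInv]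
  field_simp

theorem qFactInv_inv {q : F} (hq0 : q ≠ 0) (c : ℕ) :
    qFactInv q⁻¹ c = (-1) ^ c * q ^ (c + c.choose 2) * qFactInv q c := by
  induction c with
  | zero => simp [qFactInv]
  | succ c ih =>
    rw [qFactInv, prod_range_succ, ← qFactInv, ih, qFactInv, qFactInv, prod_range_succ]
    have h : (1 - q⁻¹ ^ (c + 1))⁻¹ = - (q ^ (c + 1)) * (1 - q ^ (c + 1))⁻¹ := by
      have : (1 - q⁻¹ ^ (c + 1)) = - (q ^ (c + 1))⁻¹ * (1 - q ^ (c + 1)) := by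
        rw [inv_pow]
        field_simp
        ring
      rw [this, mul_inv, inv_neg, inv_inv]
    rw [h, Nat.choose_succ_succ' c 1, Nat.choose_one_right]
    ring

/-- The `q`-exponential series `∑ c, qFactInv q c * z ^ c` has the inverse
`∑ c, (-1) ^ c * q ^ (c choose 2) * qFactInv q c * z ^ c`. -/
theorem sum_qFactInv_mul_qFactInv {q : F} (hq : ∀ i, q ^ (i + 1) ≠ 1) {m : ℕ} (hm : m ≠ 0) :
    ∑ c ∈ antidiagonal m, (-1) ^ c.2 * q ^ (c.2.choose 2) * qFactInv q c.2 * qFactInv q c.1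
      = 0 := by
  obtain ⟨m, rfl⟩ := Nat.exists_eq_succ_of_ne_zero hm
  set T : ℕ → ℕ → F := fun c d =>
    (-1) ^ d * q ^ (d.choose 2) * qFactInv q d * qFactInv q c with hT
  have h1 : 1 - q ^ (m + 1) ≠ 0 := sub_ne_zero.2 (hq m).symm
  refine (mul_eq_zero.1 (?_ : (1 - q ^ (m + 1)) * _ = 0)).resolve_left h1
  -- Split `1 - q ^ (c + d)` as `(1 - q ^ d) + q ^ d * (1 - q ^ c)`; the two sums cancel.
  have e : ∀ c ∈ antidiagonal (m + 1), (1 - q ^ (m + 1)) * T c.1 c.2 =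
      (1 - q ^ c.2) * T c.1 c.2 + q ^ c.2 * (1 - q ^ c.1) * T c.1 c.2 := by
    intro c hc
    rw [← mem_antidiagonal.1 hc, pow_add]
    ring
  rw [mul_sum, sum_congr rfl e, sum_add_distrib, Nat.sum_antidiagonal_succ',
    Nat.sum_antidiagonal_succ]
  simp only [pow_zero, sub_self, zero_mul, mul_zero, zero_add]
  rw [← sum_add_distrib]
  refine sum_eq_zero fun c _ => ?_
  have h2 := one_sub_mul_qFactInv_succ hq c.2
  have h3 := one_sub_mul_qFactInv_succ hq c.1
  simp only [hT]
  rw [Nat.choose_succ_succ' c.2 1, Nat.choose_one_right]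
  linear_combination ((-1) ^ (c.2 + 1) * q ^ (c.2 + c.2.choose 2) * qFactInv q c.1) * h2 +
    ((-1) ^ c.2 * q ^ (c.2 + c.2.choose 2) * qFactInv q c.2) * h3

/-- The functional equation of the Igusa functions. -/
theorem chainSumLE_qFactInv_inv {q : F} (hq0 : q ≠ 0) (hq : ∀ i, q ^ (i + 1) ≠ 1) {x x' : ℕ → F}
    {d : ℕ} (hx : ∀ k ≤ d, k ≠ 0 → x k ≠ 1) (hx0 : ∀ k ≤ d, k ≠ 0 → x k ≠ 0)
    (hx' : ∀ k ≤ d, k ≠ 0 → x' k = (x k)⁻¹) :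
    chainSumLE (fun a b => qFactInv q⁻¹ (b - a)) x' d =
      q ^ d * chainSum (fun a b => qFactInv q (b - a)) x d := by
  refine chainSumLE_inv (s₀ := d) (ε := fun m => q ^ m) (by simp [qFactInv_zero])
    (by simp [qFactInv_zero]) (by simp) hx hx0 hx' ?_ le_rfl
  intro t s hts
  obtain ⟨m, rfl⟩ := Nat.exists_eq_add_of_lt hts
  have h := sum_qFactInv_mul_qFactInv hq (m := m + 1) (by omega)
  rw [← mul_zero (q ^ (t + m + 1)), ← h, mul_sum]
  symm
  refine sum_bij' (fun c _ => t + c.1) (fun u _ => (u - t, t + m + 1 - u)) ?_ ?_ ?_ ?_ ?_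
  · intro c hc
    have := mem_antidiagonal.1 hc
    simp only [mem_filter, mem_Iic]
    omega
  · intro u hu
    simp only [mem_filter, mem_Iic] at hu
    rw [HasAntidiagonal.mem_antidiagonal]
    omega
  · intro c hc
    have := mem_antidiagonal.1 hc
    ext <;> simp only <;> omega
  · intro u hu
    simp only [mem_filter, mem_Iic] at hu
    simp only
    omega
  · intro c hc
    have hc := mem_antidiagonal.1 hc
    have e1 : t + m + 1 - (t + c.1) = c.2 := by omega
    have e2 : t + c.1 - t = c.1 := by omega
    have e3 : t + m + 1 = t + c.1 + c.2 := by omega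
    simp only [e1, e2]
    rw [qFactInv_inv hq0, e3]
    ring

/-- The functional equation of the generating functions of weak orders. -/
theorem chainSumLE_powerset_inv {ι : Type*} [DecidableEq ι] {x x' : Finset ι → F}
    {S : Finset ι} (hx : ∀ T ⊆ S, T ≠ ∅ → x T ≠ 1) (hx0 : ∀ T ⊆ S, T ≠ ∅ → x T ≠ 0)
    (hx' : ∀ T ⊆ S, T ≠ ∅ → x' T = (x T)⁻¹) :
    chainSumLE (fun _ _ => 1) x' S = (-1) ^ #S * chainSum (fun _ _ => 1) x S := by
  refine chainSumLE_inv (s₀ := S) (ε := fun T => (-1) ^ #T) (by simp) (by simp) (by simp)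
    hx hx0 hx' ?_ le_rfl
  intro T U hTU
  have hne : (U \ T).Nonempty := sdiff_nonempty.2 hTU.not_ge
  have h := congrArg (Int.cast (R := F)) (sum_powerset_neg_one_pow_card_of_nonempty hne)
  push_cast at h
  rw [← mul_zero ((-1) ^ #T), ← h, mul_sum]
  symm
  refine sum_bij' (fun V _ => T ∪ V) (fun V _ => V \ T) ?_ ?_ ?_ ?_ ?_
  · intro V hV
    have hV := mem_powerset.1 hV
    simp only [mem_filter, mem_Iic]
    exact ⟨union_subset hTU.le (hV.trans sdiff_subset), subset_union_left⟩
  · intro V hV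
    simp only [mem_filter, mem_Iic] at hV
    exact mem_powerset.2 (sdiff_subset_sdiff hV.1 le_rfl)
  · intro V hV
    have hV := mem_powerset.1 hV
    have : Disjoint T V := (disjoint_of_subset_left hV sdiff_disjoint).symm
    rw [union_sdiff_cancel_left this]
  · intro V hV
    simp only [mem_filter, mem_Iic] at hV
    exact union_sdiff_of_subset hV.2
  · intro V hV
    have hV := mem_powerset.1 hV
    have : Disjoint T V := (disjoint_of_subset_left hV sdiff_disjoint).symm
    rw [card_union_of_disjoint this, pow_add]
    ring

end Igusa

/-! ### Counting subgroups of finite abelian `p`-groups -/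

section Counting

variable {A : Type*} [AddCommGroup A] {p : ℕ}

/-- The tuple `y` is a basis of type `(p ^ m₁, …, p ^ m_k)` of a subgroup of `A`. -/
def IsIndep (p : ℕ) {k : ℕ} (m : Fin k → ℕ) (y : Fin k → A) : Prop :=
  (∀ i, p ^ m i • y i = 0) ∧
    ∀ c : Fin k → ℤ, ∑ i, c i • y i = 0 → ∀ i, ((p ^ m i : ℕ) : ℤ) ∣ c i

/-- The number of elements of `A` that are killed by `p ^ e`. -/
noncomputable def torsionCard (A : Type*) [AddCommGroup A] (p e : ℕ) : ℕ :=
  Nat.card {a : A // p ^ e • a = 0}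

theorem zsmul_eq_zero_of_dvd {N : ℕ} {a : A} (ha : N • a = 0) {c : ℤ} (hc : (N : ℤ) ∣ c) :
    c • a = 0 := by
  obtain ⟨d, rfl⟩ := hc
  rw [mul_comm, mul_zsmul, natCast_zsmul, ha, zsmul_zero]

theorem isIndep_snoc_iff (hp : p.Prime) {k e : ℕ} (he : 0 < e) (m : Fin k → ℕ) (y : Fin k → A)
    (z : A) :
    IsIndep p (Fin.snoc m e : Fin (k + 1) → ℕ) (Fin.snoc y z : Fin (k + 1) → A) ↔
      IsIndep p m y ∧ p ^ e • z = 0 ∧ ¬ ∃ c : Fin k → ℤ, ∑ i, c i • y i = p ^ (e - 1) • z := by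
  constructor
  · rintro ⟨h1, h2⟩
    refine ⟨⟨fun i => by simpa using h1 i.castSucc, fun c hc i => ?_⟩,
      by simpa using h1 (Fin.last k), ?_⟩
    · have := h2 (Fin.snoc c 0) (by simpa [Fin.sum_univ_castSucc] using hc) i.castSucc
      simpa using this
    · rintro ⟨c, hc⟩
      have := h2 (Fin.snoc c (-(p ^ (e - 1) : ℕ))) (by
        simp only [Fin.sum_univ_castSucc, Fin.snoc_castSucc, Fin.snoc_last, hc, neg_smul,
          natCast_zsmul]
        exact add_neg_cancel _) (Fin.last k)
      simp only [Fin.snoc_last, dvd_neg] at this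
      have := (Nat.pow_dvd_pow_iff_le_right hp.one_lt).1 (Int.natCast_dvd_natCast.1 this)
      omega
  · rintro ⟨⟨h1, h2⟩, h3, h4⟩
    refine ⟨fun i => ?_, fun c hc => ?_⟩
    · induction i using Fin.lastCases with
      | last => simpa using h3
      | cast i => simpa using h1 i
    · simp only [Fin.sum_univ_castSucc, Fin.snoc_castSucc, Fin.snoc_last] at hc
      have hlast : ((p ^ e : ℕ) : ℤ) ∣ c (Fin.last k) := by
        by_contra hnd
        apply h4
        -- By Bézout, `p ^ (e - 1) • z` is a multiple of `c (Fin.last k) • z`.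
        obtain ⟨s, hs, hs'⟩ := (Nat.dvd_prime_pow hp).1
          (Int.natCast_dvd_natCast.1 (by
            simpa using Int.gcd_dvd_right (c (Fin.last k)) ((p ^ e : ℕ) : ℤ)) :
            Int.gcd (c (Fin.last k)) ((p ^ e : ℕ) : ℤ) ∣ p ^ e)
        have hse : s < e := by
          refine lt_of_le_of_ne hs fun h => hnd ?_
          have := Int.gcd_dvd_left (c (Fin.last k)) ((p ^ e : ℕ) : ℤ)
          rwa [hs', h] at this
        have hb := Int.gcd_eq_gcd_ab (c (Fin.last k)) ((p ^ e : ℕ) : ℤ)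
        rw [hs'] at hb
        set u := Int.gcdA (c (Fin.last k)) ((p ^ e : ℕ) : ℤ)
        set v := Int.gcdB (c (Fin.last k)) ((p ^ e : ℕ) : ℤ)
        refine ⟨fun i => -((p ^ (e - 1 - s) : ℕ) * u) * c i.castSucc, ?_⟩
        have e1 : ((p ^ (e - 1) : ℕ) : ℤ) = ((p ^ (e - 1 - s) : ℕ) : ℤ) * u * c (Fin.last k) +
            ((p ^ (e - 1 - s) : ℕ) : ℤ) * v * ((p ^ e : ℕ) : ℤ) := by
          have : p ^ (e - 1) = p ^ (e - 1 - s) * p ^ s := by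
            rw [← pow_add]; congr 1; omega
          rw [this, Nat.cast_mul, hb]
          ring
        rw [← natCast_zsmul z (p ^ (e - 1)), e1, add_zsmul,
          mul_zsmul _ (((p ^ (e - 1 - s) : ℕ) : ℤ) * v) ((p ^ e : ℕ) : ℤ), natCast_zsmul z (p ^ e),
          h3, zsmul_zero, add_zero, mul_zsmul, ← neg_eq_of_add_eq_zero_right hc, zsmul_neg,
          smul_sum, ← sum_neg_distrib]
        refine sum_congr rfl fun i _ => ?_
        simp only [neg_mul, neg_zsmul, mul_zsmul]
      have hz : c (Fin.last k) • z = 0 := zsmul_eq_zero_of_dvd h3 hlast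
      rw [hz, add_zero] at hc
      intro i
      induction i using Fin.lastCases with
      | last => simpa using hlast
      | cast i => simpa using h2 _ hc i

theorem isIndep_snoc_zero_iff {k : ℕ} (m : Fin k → ℕ) (y : Fin k → A) (z : A) :
    IsIndep p (Fin.snoc m 0 : Fin (k + 1) → ℕ) (Fin.snoc y z : Fin (k + 1) → A) ↔
      IsIndep p m y ∧ z = 0 := by
  constructor
  · rintro ⟨h1, h2⟩
    refine ⟨⟨fun i => by simpa using h1 i.castSucc, fun c hc i => ?_⟩,
      by simpa using h1 (Fin.last k)⟩
    have := h2 (Fin.snoc c 0) (by simpa [Fin.sum_univ_castSucc] using hc) i.castSucc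
    simpa using this
  · rintro ⟨⟨h1, h2⟩, rfl⟩
    refine ⟨fun i => ?_, fun c hc i => ?_⟩
    · induction i using Fin.lastCases with
      | last => simp
      | cast i => simpa using h1 i
    · induction i using Fin.lastCases with
      | last => simp
      | cast i =>
        simpa using h2 (fun i => c i.castSucc) (by simpa [Fin.sum_univ_castSucc] using hc) i

theorem isIndep_succ_iff (hp : p.Prime) {k : ℕ} {m : Fin (k + 1) → ℕ} (he : 0 < m (Fin.last k))
    (y : Fin (k + 1) → A) :
    IsIndep p m y ↔ IsIndep p (Fin.init m) (Fin.init y) ∧ p ^ m (Fin.last k) • y (Fin.last k) = 0 ∧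
      ¬ ∃ c : Fin k → ℤ,
        ∑ i, c i • (Fin.init y : Fin k → A) i = p ^ (m (Fin.last k) - 1) • y (Fin.last k) := by
  rw [← isIndep_snoc_iff hp he, Fin.snoc_init_self, Fin.snoc_init_self]

theorem isIndep_succ_iff_of_eq_zero {k : ℕ} {m : Fin (k + 1) → ℕ} (he : m (Fin.last k) = 0)
    (y : Fin (k + 1) → A) :
    IsIndep p m y ↔ IsIndep p (Fin.init m) (Fin.init y) ∧ y (Fin.last k) = 0 := by
  rw [← isIndep_snoc_zero_iff, ← he, Fin.snoc_init_self, Fin.snoc_init_self]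

/-- The elements `z` killed by `p ^ e` with `p ^ (e - 1) • z` in the span of `y` are the sums of an
element of the span that is killed by `p ^ e` and an element killed by `p ^ (e - 1)`. -/
theorem card_pow_smul_mem_span (hp : p.Prime) {k e : ℕ} (he : 0 < e) {m : Fin k → ℕ}
    (hm : ∀ i, e ≤ m i) {y : Fin k → A} (hy : IsIndep p m y) :
    Nat.card {z : A // p ^ e • z = 0 ∧ ∃ c : Fin k → ℤ, ∑ i, c i • y i = p ^ (e - 1) • z} =
      p ^ k * torsionCard A p (e - 1) := by
  have hcard : Nat.card ((Fin k → Fin p) × {a : A // p ^ (e - 1) • a = 0}) =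
      p ^ k * torsionCard A p (e - 1) := by
    simp [Nat.card_prod, torsionCard, Nat.card_eq_fintype_card]
  rw [← hcard]
  symm
  let lin : (Fin k → Fin p) → A := fun c => ∑ i, ((c i : ℕ) * p ^ (m i - e)) • y i
  have hpow : ∀ i, p ^ (m i - e) * p ^ (e - 1) = p ^ (m i - 1) := fun i => by
    rw [← pow_add]; congr 1; have := hm i; omega
  have hlin : ∀ c, p ^ (e - 1) • lin c = ∑ i, ((c i : ℕ) * p ^ (m i - 1)) • y i := by
    intro c
    simp only [lin, smul_sum, ← mul_nsmul]
    exact sum_congr rfl fun i _ => by rw [mul_assoc, hpow]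
  have hpp : p ^ e = p ^ (e - 1) * p := by rw [← pow_succ]; congr 1; omega
  have hlin' : ∀ c, p ^ e • lin c = 0 := by
    intro c
    rw [hpp, mul_nsmul, hlin, smul_sum]
    refine sum_eq_zero fun i _ => ?_
    have : (c i : ℕ) * p ^ (m i - 1) * p = p ^ m i * c i := by
      rw [mul_assoc, ← pow_succ, mul_comm]; congr 2; have := hm i; omega
    rw [← mul_nsmul, this, mul_nsmul, hy.1, nsmul_zero]
  refine Nat.card_congr (Equiv.ofBijective (fun q => ⟨lin q.1 + q.2.1, ?_, ?_⟩) ⟨?_, ?_⟩)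
  · rw [smul_add, hlin', zero_add, hpp, mul_nsmul, q.2.2, nsmul_zero]
  · refine ⟨fun i => ((q.1 i : ℕ) * p ^ (m i - 1) : ℕ), ?_⟩
    rw [smul_add, q.2.2, add_zero, hlin]
    exact sum_congr rfl fun i _ => natCast_zsmul _ _
  · rintro ⟨c, a, ha⟩ ⟨c', a', ha'⟩ h
    have h : lin c + a = lin c' + a' := congrArg Subtype.val h
    have h1 : p ^ (e - 1) • lin c = p ^ (e - 1) • lin c' := by
      have := congrArg (p ^ (e - 1) • ·) h
      simpa [smul_add, ha, ha'] using this
    rw [hlin, hlin, ← sub_eq_zero, ← sum_sub_distrib] at h1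
    have h2 := hy.2 (fun i => (((c i : ℕ) : ℤ) - ((c' i : ℕ) : ℤ)) * (p ^ (m i - 1) : ℕ)) (by
      rw [← h1]
      refine sum_congr rfl fun i _ => ?_
      rw [← natCast_zsmul, ← natCast_zsmul, ← sub_smul]
      congr 1
      push_cast
      ring)
    have hc : c = c' := by
      funext i
      have h3 := h2 i
      have h4 : p ^ m i = p * p ^ (m i - 1) := by
        rw [← pow_succ']; congr 1; have := hm i; omega
      rw [h4, Nat.cast_mul] at h3
      have h5 : (p : ℤ) ∣ ((c i : ℕ) : ℤ) - ((c' i : ℕ) : ℤ) :=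
        Int.dvd_of_mul_dvd_mul_right (by exact_mod_cast (pow_pos hp.pos _).ne') h3
      have h6 := Int.eq_zero_of_abs_lt_dvd h5 (by
        have := (c i).2; have := (c' i).2; rw [abs_lt]; constructor <;> omega)
      exact Fin.ext (by omega)
    subst hc
    simpa using h
  · rintro ⟨z, hz, d, hd⟩
    have h1 : ∀ i, ∃ d' : ℤ, d i = (p ^ (m i - 1) : ℕ) * d' := by
      intro i
      have h2 := hy.2 (fun i => p * d i) (by
        have : p • (p ^ (e - 1) • z) = 0 := by rw [← mul_nsmul, ← hpp, hz]
        rw [← hd, smul_sum] at this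
        rw [← this]
        refine sum_congr rfl fun i _ => ?_
        rw [mul_comm, mul_zsmul, natCast_zsmul]
        exact smul_comm _ _ _) i
      have h4 : p ^ m i = p * p ^ (m i - 1) := by
        rw [← pow_succ']; congr 1; have := hm i; omega
      rw [h4, Nat.cast_mul] at h2
      exact Int.dvd_of_mul_dvd_mul_left (by exact_mod_cast hp.ne_zero) h2
    choose d' hd' using h1
    have hpz : (p : ℤ) ≠ 0 := by exact_mod_cast hp.ne_zero
    have hmod : ∀ i, 0 ≤ d' i % p ∧ d' i % p < p := fun i =>
      ⟨Int.emod_nonneg _ hpz, Int.emod_lt_of_pos _ (by exact_mod_cast hp.pos)⟩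
    let c : Fin k → Fin p := fun i => ⟨(d' i % p).toNat, by have := hmod i; omega⟩
    refine ⟨⟨c, z - lin c, ?_⟩, ?_⟩
    · rw [smul_sub, hlin, ← hd, ← sum_sub_distrib]
      refine sum_eq_zero fun i _ => ?_
      rw [← natCast_zsmul, ← sub_smul]
      refine zsmul_eq_zero_of_dvd (hy.1 i) ?_
      have h4 : p ^ m i = p ^ (m i - 1) * p := by
        rw [← pow_succ]; congr 1; have := hm i; omega
      have h5 : ((c i : ℕ) : ℤ) = d' i % p := Int.toNat_of_nonneg (hmod i).1
      rw [hd', h4, Nat.cast_mul, Nat.cast_mul, h5, mul_comm (d' i % p), ← mul_sub]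
      exact mul_dvd_mul_left _ (Int.dvd_self_sub_emod)
    · simp

theorem card_and_not {B : Type*} [Finite B] (P Q : B → Prop) :
    Nat.card {z // P z ∧ ¬ Q z} + Nat.card {z // P z ∧ Q z} = Nat.card {z // P z} := by
  classical
  have := Fintype.ofFinite B
  simp only [Nat.card_eq_fintype_card, Fintype.card_subtype]
  rw [add_comm, ← filter_filter, ← filter_filter, card_filter_add_card_filter_not]

/-- The bases of type `(p ^ m₁, …, p ^ m_k)` are chosen one element after the other. -/
theorem card_isIndep (hp : p.Prime) [Finite A] {k : ℕ} {m : Fin k → ℕ} (hm : Antitone m) :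
    (Nat.card {y : Fin k → A // IsIndep p m y} : ℚ) =
      ∏ i, if m i = 0 then 1 else
        (torsionCard A p (m i) : ℚ) - (p : ℚ) ^ (i : ℕ) * torsionCard A p (m i - 1) := by
  induction k with
  | zero =>
    have : IsIndep p m (Fin.elim0 : Fin 0 → A) := ⟨fun i => i.elim0, fun _ _ i => i.elim0⟩
    have : Unique {y : Fin 0 → A // IsIndep p m y} :=
      ⟨⟨⟨_, this⟩⟩, fun y => Subtype.ext (Subsingleton.elim _ _)⟩
    simp
  | succ k ih =>
    rw [Fin.prod_univ_castSucc]
    have hinit : Antitone (Fin.init m) := fun i j h => hm (Fin.castSucc_le_castSucc_iff.2 h)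
    have ih : (Nat.card {y : Fin k → A // IsIndep p (Fin.init m) y} : ℚ) =
        ∏ i : Fin k, if m i.castSucc = 0 then 1 else
          (torsionCard A p (m i.castSucc) : ℚ) -
            (p : ℚ) ^ (i : ℕ) * torsionCard A p (m i.castSucc - 1) := ih hinit
    simp only [Fin.val_castSucc, Fin.val_last]
    rw [← ih]
    by_cases h0 : m (Fin.last k) = 0
    · rw [if_pos h0, mul_one]
      norm_cast
      refine Nat.card_congr (Equiv.ofBijective
        (fun y => ⟨Fin.init y.1, ((isIndep_succ_iff_of_eq_zero h0 y.1).1 y.2).1⟩) ⟨?_, ?_⟩)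
      · rintro ⟨y, hy⟩ ⟨y', hy'⟩ h
        have h : Fin.init y = Fin.init y' := congrArg Subtype.val h
        rw [isIndep_succ_iff_of_eq_zero h0] at hy hy'
        refine Subtype.ext ?_
        change y = y'
        rw [← Fin.snoc_init_self y, ← Fin.snoc_init_self y', h, hy.2, hy'.2]
      · rintro ⟨y, hy⟩
        refine ⟨⟨Fin.snoc y 0, ?_⟩, Subtype.ext (Fin.init_snoc (α := fun _ => A) _ _)⟩
        rw [isIndep_succ_iff_of_eq_zero h0, Fin.init_snoc]
        exact ⟨hy, Fin.snoc_last (α := fun _ => A) _ _⟩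
    · rw [if_neg h0]
      have hpos : 0 < m (Fin.last k) := Nat.pos_of_ne_zero h0
      have hiff := isIndep_succ_iff (A := A) hp hpos
      set e := m (Fin.last k) with he
      have hle : ∀ i, e ≤ Fin.init m i := fun i => hm (Fin.le_last _)
      have e1 : {y : Fin (k + 1) → A // IsIndep p m y} ≃
          Σ y : {y : Fin k → A // IsIndep p (Fin.init m) y}, {z : A // p ^ e • z = 0 ∧
            ¬ ∃ c : Fin k → ℤ, ∑ i, c i • y.1 i = p ^ (e - 1) • z} := by
        refine Equiv.ofBijective (fun y => ⟨⟨Fin.init y.1, ((hiff y.1).1 y.2).1⟩,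
          ⟨y.1 (Fin.last k), ((hiff y.1).1 y.2).2⟩⟩) ⟨?_, ?_⟩
        · rintro ⟨y, hy⟩ ⟨y', hy'⟩ h
          simp only [Sigma.mk.injEq, Subtype.mk.injEq] at h
          refine Subtype.ext ?_
          change y = y'
          have h2 : y (Fin.last k) = y' (Fin.last k) := by
            obtain ⟨h, h'⟩ := h
            rw [Subtype.heq_iff_coe_eq] at h'
            · exact h'
            · intro z; simp only [h]
          rw [← Fin.snoc_init_self y, ← Fin.snoc_init_self y', h.1, h2]
        · have aux : ∀ (y y' : {y : Fin k → A // IsIndep p (Fin.init m) y}) (z z' : A)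
              (hz : p ^ e • z = 0 ∧ ¬ ∃ c : Fin k → ℤ, ∑ i, c i • y.1 i = p ^ (e - 1) • z)
              (hz' : p ^ e • z' = 0 ∧ ¬ ∃ c : Fin k → ℤ, ∑ i, c i • y'.1 i = p ^ (e - 1) • z'),
              y = y' → z = z' →
              (⟨y, ⟨z, hz⟩⟩ : Σ y : {y : Fin k → A // IsIndep p (Fin.init m) y},
                {z : A // p ^ e • z = 0 ∧
                  ¬ ∃ c : Fin k → ℤ, ∑ i, c i • y.1 i = p ^ (e - 1) • z}) = ⟨y', ⟨z', hz'⟩⟩ := by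
            rintro _ _ _ _ _ _ rfl rfl
            rfl
          rintro ⟨⟨y, hy⟩, ⟨z, hz⟩⟩
          refine ⟨⟨Fin.snoc y z, (hiff _).2 ?_⟩, aux _ _ _ _ _ _
            (Subtype.ext (Fin.init_snoc (α := fun _ => A) _ _))
            (Fin.snoc_last (α := fun _ => A) _ _)⟩
          rw [Fin.init_snoc, Fin.snoc_last]
          exact ⟨hy, hz⟩
      have e2 : ∀ y : {y : Fin k → A // IsIndep p (Fin.init m) y},
          (Nat.card {z : A // p ^ e • z = 0 ∧
            ¬ ∃ c : Fin k → ℤ, ∑ i, c i • y.1 i = p ^ (e - 1) • z} : ℚ) =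
          (torsionCard A p e : ℚ) - (p : ℚ) ^ k * torsionCard A p (e - 1) := by
        intro y
        have h1 := card_and_not (fun z : A => p ^ e • z = 0)
          (fun z => ∃ c : Fin k → ℤ, ∑ i, c i • y.1 i = p ^ (e - 1) • z)
        rw [card_pow_smul_mem_span hp hpos hle y.2] at h1
        have h2 := congrArg (Nat.cast (R := ℚ)) h1
        push_cast at h2
        rw [torsionCard, ← h2]
        ring
      have := Fintype.ofFinite {y : Fin k → A // IsIndep p (Fin.init m) y}
      rw [Nat.card_congr e1, Nat.card_sigma]
      rw [Nat.cast_sum, sum_congr rfl fun y _ => e2 y, sum_const, nsmul_eq_mul, card_univ,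
        Nat.card_eq_fintype_card]

/-- Injective homomorphisms from a group of type `m` are given by bases of subgroups. -/
theorem card_injective_hom {k : ℕ} (m : Fin k → ℕ) :
    Nat.card {φ : (∀ i, ZMod (p ^ m i)) →+ A // Function.Injective φ} =
      Nat.card {y : Fin k → A // IsIndep p m y} := by
  have hval : ∀ (φ : (∀ i, ZMod (p ^ m i)) →+ A) (c : Fin k → ℤ),
      φ (fun i => (c i : ZMod (p ^ m i))) = ∑ i, c i • φ (Pi.single i 1) := by
    intro φ c
    have : (fun i => (c i : ZMod (p ^ m i))) = ∑ i, c i • Pi.single i 1 := by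
      funext j
      rw [Finset.sum_apply, sum_eq_single j]
      · simp
      · intro b _ hb
        simp [hb.symm]
      · simp
    rw [this, map_sum]
    exact sum_congr rfl fun i _ => map_zsmul φ _ _
  have hsurj : ∀ x : ∀ i, ZMod (p ^ m i), ∃ c : Fin k → ℤ, x = fun i => (c i : ZMod (p ^ m i)) := by
    intro x
    choose c hc using fun i => ZMod.intCast_surjective (x i)
    exact ⟨c, funext fun i => (hc i).symm⟩
  have hzero : ∀ c : Fin k → ℤ, (fun i => (c i : ZMod (p ^ m i))) = 0 ↔
      ∀ i, ((p ^ m i : ℕ) : ℤ) ∣ c i := by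
    intro c
    rw [funext_iff]
    exact forall_congr' fun i => ZMod.intCast_zmod_eq_zero_iff_dvd (c i) _
  refine Nat.card_congr (Equiv.ofBijective
    (fun φ => ⟨fun i => φ.1 (Pi.single i 1), ?_, ?_⟩) ⟨?_, ?_⟩)
  · intro i
    rw [← map_nsmul]
    convert map_zero φ.1
    funext j
    by_cases hj : j = i
    · subst hj
      simp
    · simp [hj]
  · intro c hc
    rw [← hval] at hc
    exact (hzero c).1 ((injective_iff_map_eq_zero φ.1).1 φ.2 _ hc)
  · rintro ⟨φ, hφ⟩ ⟨ψ, hψ⟩ h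
    have h := congrArg Subtype.val h
    simp only at h
    refine Subtype.ext (AddMonoidHom.ext fun x => ?_)
    obtain ⟨c, rfl⟩ := hsurj x
    rw [hval, hval]
    exact sum_congr rfl fun i _ => by rw [congrFun h i]
  · rintro ⟨y, hy⟩
    let φ : (∀ i, ZMod (p ^ m i)) →+ A := ∑ i, (ZMod.lift (p ^ m i)
      ⟨zmultiplesHom A (y i), by
        rw [zmultiplesHom_apply, natCast_zsmul, hy.1]⟩).comp (Pi.evalAddMonoidHom _ i)
    have hφ : ∀ c : Fin k → ℤ, φ (fun i => (c i : ZMod (p ^ m i))) = ∑ i, c i • y i := by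
      intro c
      simp only [φ, AddMonoidHom.finsetSum_apply]
      refine sum_congr rfl fun i _ => ?_
      simp
    refine ⟨⟨φ, ?_⟩, Subtype.ext (funext fun i => ?_)⟩
    · rw [injective_iff_map_eq_zero]
      intro x hx
      obtain ⟨c, rfl⟩ := hsurj x
      rw [hφ] at hx
      exact (hzero c).2 (hy.2 c hx)
    · have := hφ (Pi.single i 1)
      rw [sum_eq_single i] at this
      · have e : (fun j => ((Pi.single i 1 : Fin k → ℤ) j : ZMod (p ^ m j))) = Pi.single i 1 := by
          funext j
          by_cases hj : j = i
          · subst hj; simp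
          · simp [hj]
        rw [e] at this
        simpa using this
      · intro b _ hb
        simp [hb]
      · simp

/-- The subgroups of `A` isomorphic to `G`, multiplied by the automorphisms of `G`, give the
injective homomorphisms from `G` to `A`. -/
theorem card_subgroup_mul_card_injective {G : Type*} [AddCommGroup G] [Finite G] [Finite A] :
    Nat.card {H : AddSubgroup A // Nonempty (H ≃+ G)} *
        Nat.card {φ : G →+ G // Function.Injective φ} =
      Nat.card {φ : G →+ A // Function.Injective φ} := by
  have e1 : (Σ H : {H : AddSubgroup A // Nonempty (H ≃+ G)}, G ≃+ H.1) ≃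
      {φ : G →+ A // Function.Injective φ} := by
    refine Equiv.ofBijective (fun q => ⟨q.1.1.subtype.comp q.2.toAddMonoidHom,
      Subtype.val_injective.comp q.2.injective⟩) ⟨?_, ?_⟩
    · rintro ⟨⟨H, hH⟩, e⟩ ⟨⟨H', hH'⟩, e'⟩ h
      have h : H.subtype.comp e.toAddMonoidHom = H'.subtype.comp e'.toAddMonoidHom :=
        congrArg Subtype.val h
      have hr : ∀ (K : AddSubgroup A) (e : G ≃+ K),
          (K.subtype.comp e.toAddMonoidHom).range = K := by
        intro K e
        ext a
        simp only [AddMonoidHom.mem_range]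
        constructor
        · rintro ⟨x, rfl⟩
          exact (e x).2
        · intro ha
          exact ⟨e.symm ⟨a, ha⟩, by simp⟩
      have hHH : H = H' := by rw [← hr H e, h, hr H' e']
      subst hHH
      congr 1
      ext x
      exact DFunLike.congr_fun h x
    · rintro ⟨φ, hφ⟩
      exact ⟨⟨⟨φ.range, ⟨(AddMonoidHom.ofInjective hφ).symm⟩⟩, AddMonoidHom.ofInjective hφ⟩,
        Subtype.ext (AddMonoidHom.ext fun x => rfl)⟩
  have e2 : ∀ H : {H : AddSubgroup A // Nonempty (H ≃+ G)}, Nat.card (G ≃+ H.1) =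
      Nat.card {φ : G →+ G // Function.Injective φ} := by
    rintro ⟨H, ⟨e⟩⟩
    refine Nat.card_congr (Equiv.ofBijective (fun φ => ⟨(φ.trans e).toAddMonoidHom,
      (φ.trans e).injective⟩) ⟨?_, ?_⟩)
    · intro φ ψ h
      have h := congrArg Subtype.val h
      ext x
      exact congrArg Subtype.val (e.injective (DFunLike.congr_fun h x))
    · rintro ⟨φ, hφ⟩
      refine ⟨(AddEquiv.ofBijective φ (Finite.injective_iff_bijective.1 hφ)).trans e.symm,
        Subtype.ext (AddMonoidHom.ext fun x => ?_)⟩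
      simp
  have := Fintype.ofFinite {H : AddSubgroup A // Nonempty (H ≃+ G)}
  rw [← Nat.card_congr e1, Nat.card_sigma]
  rw [sum_congr rfl fun H _ => e2 H, sum_const, smul_eq_mul, card_univ, Nat.card_eq_fintype_card]

theorem torsionCard_pi_zmod (hp : p.Prime) {k : ℕ} (m : Fin k → ℕ) (e : ℕ) :
    torsionCard (∀ i, ZMod (p ^ m i)) p e = p ^ ∑ i, min (m i) e := by
  have hne : ∀ i, NeZero (p ^ m i) := fun i => ⟨(pow_pos hp.pos _).ne'⟩
  have h1 : ∀ i, Nat.card {a : ZMod (p ^ m i) // p ^ e • a = 0} = p ^ min (m i) e := by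
    intro i
    have h := IsAddCyclic.card_nsmulAddMonoidHom_ker (ZMod (p ^ m i)) (p ^ e)
    rw [Nat.card_zmod] at h
    have h2 : (p ^ m i).gcd (p ^ e) = p ^ min (m i) e := by
      rcases le_total (m i) e with h | h
      · rw [min_eq_left h, Nat.gcd_eq_left (pow_dvd_pow p h)]
      · rw [min_eq_right h, Nat.gcd_eq_right (pow_dvd_pow p h)]
    rw [← h2, ← h]
    rfl
  rw [torsionCard, ← prod_pow_eq_pow_sum, ← prod_congr rfl fun i _ => h1 i, ← Nat.card_pi]
  refine Nat.card_congr ⟨fun a i => ⟨a.1 i, congrFun a.2 i⟩,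
    fun a => ⟨fun i => (a i).1, funext fun i => (a i).2⟩, fun _ => rfl, fun _ => rfl⟩

/-- The number of injective homomorphisms from a group of type `mu` to a group of type `lam`. -/
noncomputable def injCount {n : ℕ} (p : ℕ) (lam mu : Fin n → ℕ) : ℚ :=
  ∏ j, if mu j = 0 then 1 else
    (p : ℚ) ^ (∑ i, min (lam i) (mu j)) -
      (p : ℚ) ^ ((j : ℕ) + ∑ i, min (lam i) (mu j - 1))

theorem alpha_mul_injCount (hp : p.Prime) {n : ℕ} (lam : Fin n → ℕ) {mu : Fin n → ℕ}
    (hmu : Antitone mu) : (alpha lam mu p : ℚ) * injCount p mu mu = injCount p lam mu := by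
  have hne : ∀ m : ℕ, NeZero (p ^ m) := fun m => ⟨(pow_pos hp.pos _).ne'⟩
  have hcount : ∀ l : Fin n → ℕ, (Nat.card {φ : (∀ i, ZMod (p ^ mu i)) →+
      (∀ i, ZMod (p ^ l i)) // Function.Injective φ} : ℚ) = injCount p l mu := by
    intro l
    have : ∀ i, Finite (ZMod (p ^ l i)) := fun i => inferInstance
    rw [card_injective_hom, card_isIndep hp hmu, injCount]
    refine prod_congr rfl fun i _ => ?_
    simp only [torsionCard_pi_zmod hp, Nat.cast_pow, pow_add]
  have : ∀ i, Finite (ZMod (p ^ mu i)) := fun i => inferInstance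
  have : ∀ i, Finite (ZMod (p ^ lam i)) := fun i => inferInstance
  have h := card_subgroup_mul_card_injective (G := ∀ i, ZMod (p ^ mu i))
    (A := ∀ i, ZMod (p ^ lam i))
  rw [← hcount mu, ← hcount lam, ← h, alpha, Nat.cast_mul]

end Counting

/-! ### Families of Laurent series represented by rational functions -/

/-- The field of fractions of `ℚ⟦X⟧`. -/
abbrev FracSeries : Type := FractionRing ℚ⟦X⟧

/-- The embedding of `ℚ⟦X⟧` into its field of fractions. -/
noncomputable abbrev toFrac : ℚ⟦X⟧ →+* FracSeries := algebraMap ℚ⟦X⟧ FracSeries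

theorem toFrac_injective : Function.Injective toFrac := IsFractionRing.injective _ _

/-- The variant of `Represents` for families in the field of fractions of `ℚ⟦X⟧`. Unlike the
former, it is compatible with division. -/
def FracRep (W : RatXY) (F : ℕ → FracSeries) : Prop :=
  ∃ N Q : MvPolynomial (Fin 2) ℚ,
    W = algebraMap _ RatXY N / algebraMap _ RatXY Q ∧
    ∀ p : ℕ, p.Prime → specialise p Q ≠ 0 ∧
      toFrac (specialise p Q) * F p = toFrac (specialise p N)

namespace FracRep

theorem represents {W : RatXY} {F : ℕ → ℚ⟦X⟧} (h : FracRep W fun p => toFrac (F p)) :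
    Represents W F := by
  obtain ⟨N, Q, hW, h⟩ := h
  refine ⟨N, Q, hW, fun p hp => ⟨(h p hp).1, toFrac_injective ?_⟩⟩
  rw [map_mul, (h p hp).2]

theorem congr {W : RatXY} {F G : ℕ → FracSeries} (h : FracRep W F)
    (hFG : ∀ p, p.Prime → F p = G p) : FracRep W G := by
  obtain ⟨N, Q, hW, h⟩ := h
  exact ⟨N, Q, hW, fun p hp => ⟨(h p hp).1, by rw [← hFG p hp, (h p hp).2]⟩⟩

theorem ne_zero_of_specialise {Q : MvPolynomial (Fin 2) ℚ}
    (h : ∀ p : ℕ, p.Prime → specialise p Q ≠ 0) : algebraMap _ RatXY Q ≠ 0 := by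
  intro h0
  rw [map_eq_zero_iff _ (IsFractionRing.injective _ _)] at h0
  exact h 2 Nat.prime_two (by rw [h0, map_zero])

theorem ofPoly (N : MvPolynomial (Fin 2) ℚ) :
    FracRep (algebraMap _ RatXY N) fun p => toFrac (specialise p N) :=
  ⟨N, 1, by simp, fun p _ => by simp⟩

theorem one : FracRep 1 fun _ => 1 := by
  simpa using ofPoly 1

theorem zero : FracRep 0 fun _ => 0 := by
  simpa using ofPoly 0

theorem varX : FracRep varX fun p => (p : FracSeries) := by
  refine (ofPoly (MvPolynomial.X 0)).congr fun p _ => ?_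
  simp [specialise]

theorem varY : FracRep varY fun _ => toFrac PowerSeries.X := by
  refine (ofPoly (MvPolynomial.X 1)).congr fun p _ => ?_
  simp [specialise]

variable {W W' : RatXY} {F F' : ℕ → FracSeries}

theorem neg (h : FracRep W F) : FracRep (-W) fun p => -F p := by
  obtain ⟨N, Q, hW, h⟩ := h
  refine ⟨-N, Q, by rw [hW, map_neg, neg_div], fun p hp => ⟨(h p hp).1, ?_⟩⟩
  rw [mul_neg, (h p hp).2, map_neg, map_neg]

theorem add (h : FracRep W F) (h' : FracRep W' F') : FracRep (W + W') fun p => F p + F' p := by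
  obtain ⟨N, Q, hW, h⟩ := h
  obtain ⟨N', Q', hW', h'⟩ := h'
  have h1 := ne_zero_of_specialise fun p hp => (h p hp).1
  have h2 := ne_zero_of_specialise fun p hp => (h' p hp).1
  refine ⟨N * Q' + Q * N', Q * Q', ?_, fun p hp => ⟨?_, ?_⟩⟩
  · rw [hW, hW', div_add_div _ _ h1 h2]
    simp only [map_add, map_mul]
  · rw [map_mul]
    exact mul_ne_zero (h p hp).1 (h' p hp).1
  · simp only [map_add, map_mul, ← (h p hp).2, ← (h' p hp).2]
    ring

theorem sub (h : FracRep W F) (h' : FracRep W' F') : FracRep (W - W') fun p => F p - F' p := by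
  simpa only [sub_eq_add_neg] using h.add h'.neg

theorem mul (h : FracRep W F) (h' : FracRep W' F') : FracRep (W * W') fun p => F p * F' p := by
  obtain ⟨N, Q, hW, h⟩ := h
  obtain ⟨N', Q', hW', h'⟩ := h'
  refine ⟨N * N', Q * Q', ?_, fun p hp => ⟨?_, ?_⟩⟩
  · rw [hW, hW', div_mul_div_comm, map_mul, map_mul]
  · rw [map_mul]
    exact mul_ne_zero (h p hp).1 (h' p hp).1
  · simp only [map_mul, ← (h p hp).2, ← (h' p hp).2]
    ring

theorem inv (h : FracRep W F) (hF : ∀ p, p.Prime → F p ≠ 0) : FracRep W⁻¹ fun p => (F p)⁻¹ := by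
  obtain ⟨N, Q, hW, h⟩ := h
  refine ⟨Q, N, by rw [hW, inv_div], fun p hp => ⟨?_, ?_⟩⟩
  · intro h0
    have h1 := (h p hp).2
    rw [h0, map_zero] at h1
    rcases mul_eq_zero.1 h1 with h2 | h2
    · exact (h p hp).1 (toFrac_injective (by rw [h2, map_zero]))
    · exact hF p hp h2
  · rw [← (h p hp).2, mul_assoc, mul_inv_cancel₀ (hF p hp), mul_one]

theorem div (h : FracRep W F) (h' : FracRep W' F') (hF : ∀ p, p.Prime → F' p ≠ 0) :
    FracRep (W / W') fun p => F p / F' p := by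
  simpa only [div_eq_mul_inv] using h.mul (h'.inv hF)

theorem pow (h : FracRep W F) (k : ℕ) : FracRep (W ^ k) fun p => F p ^ k := by
  induction k with
  | zero => simpa using one
  | succ k ih => simpa only [pow_succ] using ih.mul h

theorem zpow (h : FracRep W F) (hF : ∀ p, p.Prime → F p ≠ 0) (k : ℤ) :
    FracRep (W ^ k) fun p => F p ^ k := by
  obtain ⟨m, rfl | rfl⟩ := Int.eq_nat_or_neg k
  · simpa using h.pow m
  · simpa using (h.pow m).inv fun p hp => pow_ne_zero _ (hF p hp)

theorem sum {ι : Type*} (s : Finset ι) {W : ι → RatXY} {F : ι → ℕ → FracSeries}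
    (h : ∀ i ∈ s, FracRep (W i) (F i)) : FracRep (∑ i ∈ s, W i) fun p => ∑ i ∈ s, F i p := by
  classical
  induction s using Finset.induction_on with
  | empty => simpa using zero
  | insert a s ha ih =>
    simp only [sum_insert ha]
    exact (h a (mem_insert_self _ _)).add (ih fun i hi => h i (mem_insert_of_mem hi))

theorem prod {ι : Type*} (s : Finset ι) {W : ι → RatXY} {F : ι → ℕ → FracSeries}
    (h : ∀ i ∈ s, FracRep (W i) (F i)) : FracRep (∏ i ∈ s, W i) fun p => ∏ i ∈ s, F i p := by
  classical
  induction s using Finset.induction_on with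
  | empty => simpa using one
  | insert a s ha ih =>
    simp only [prod_insert ha]
    exact (h a (mem_insert_self _ _)).mul (ih fun i hi => h i (mem_insert_of_mem hi))

section Recursion

variable {P : Type*} [PartialOrder P] [LocallyFiniteOrderBot P] [OrderBot P] [WellFoundedLT P]
  [DecidableEq P] {ζ : P → P → RatXY} {ζp : ℕ → P → P → FracSeries} {x : P → RatXY}
  {xp : ℕ → P → FracSeries}

theorem chainSum {s₀ : P} (hζ : ∀ t s, FracRep (ζ t s) fun p => ζp p t s)
    (hx : ∀ s ≤ s₀, s ≠ ⊥ → FracRep (x s) fun p => xp p s)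
    (h1 : ∀ s ≤ s₀, s ≠ ⊥ → ∀ p : ℕ, p.Prime → xp p s ≠ 1) {s : P} (hs : s ≤ s₀) :
    FracRep (HeisenbergDyck.chainSum ζ x s) fun p =>
      HeisenbergDyck.chainSum (ζp p) (xp p) s := by
  induction s using WellFoundedLT.induction with
  | _ s ih =>
    by_cases hb : s = ⊥
    · simpa only [hb, chainSum_bot] using one
    simp only [chainSum_of_ne_bot _ _ hb]
    refine ((hx s hs hb).div (one.sub (hx s hs hb))
      fun p hp => sub_ne_zero.2 (h1 s hs hb p hp).symm).mul (sum _ fun t ht => (hζ t s).mul ?_)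
    exact ih t (mem_Iio.1 ht) ((mem_Iio.1 ht).le.trans hs)

theorem chainSumLE {s : P} (hζ : ∀ t s, FracRep (ζ t s) fun p => ζp p t s)
    (hx : ∀ t ≤ s, t ≠ ⊥ → FracRep (x t) fun p => xp p t)
    (h1 : ∀ t ≤ s, t ≠ ⊥ → ∀ p : ℕ, p.Prime → xp p t ≠ 1) :
    FracRep (HeisenbergDyck.chainSumLE ζ x s) fun p =>
      HeisenbergDyck.chainSumLE (ζp p) (xp p) s :=
  sum _ fun t ht => (hζ t s).mul (chainSum hζ hx h1 (mem_Iic.1 ht))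

end Recursion

end FracRep

/-! ### Weighted generating functions of configurations -/

/-- A configuration consists of the values `x` of an admissible tuple on its `g` blocks and a tuple
`μ` of length `n`. -/
abbrev Config (g n : ℕ) : Type := (Fin g → ℕ) × (Fin n → ℕ)

variable {g n : ℕ}

/-- The exponent of `t` in the summand that belongs to a configuration. -/
def configDeg (f : Fin g → ℕ) (q : Config g n) : ℕ := ∑ j, q.2 j + 2 * ∑ a, f a * q.1 a

/-- The configurations of degree `d`, if all `f a` are positive. -/
def configsOfDeg (f : Fin g → ℕ) (n d : ℕ) : Finset (Config g n) :=
  ((Fintype.piFinset fun _ => range (d + 1)) ×ˢ (Fintype.piFinset fun _ => range (d + 1))).filter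
    fun q => configDeg f q = d

theorem mem_configsOfDeg {f : Fin g → ℕ} (hf : ∀ a, 0 < f a) {d : ℕ} {q : Config g n} :
    q ∈ configsOfDeg f n d ↔ configDeg f q = d := by
  rw [configsOfDeg, mem_filter, and_iff_right_iff_imp]
  intro h
  rw [configDeg] at h
  simp only [mem_product, Fintype.mem_piFinset, mem_range, Order.lt_add_one_iff]
  constructor
  · intro a
    have h1 : f a * q.1 a ≤ ∑ a, f a * q.1 a :=
      single_le_sum (f := fun a => f a * q.1 a) (fun _ _ => Nat.zero_le _) (mem_univ a)
    have h2 : q.1 a ≤ f a * q.1 a := Nat.le_mul_of_pos_left _ (hf a)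
    omega
  · intro j
    have h1 : q.2 j ≤ ∑ j, q.2 j := single_le_sum (fun _ _ => Nat.zero_le _) (mem_univ j)
    omega

open Classical in
/-- The generating function of the configurations in `V`, weighted by `c`. -/
noncomputable def configSeries (f : Fin g → ℕ) (c : Config g n → ℚ) (V : Set (Config g n)) :
    ℚ⟦X⟧ :=
  PowerSeries.mk fun d => ∑ q ∈ (configsOfDeg f n d).filter (fun q => q ∈ V), c q

theorem configSeries_congr (f : Fin g → ℕ) {c c' : Config g n → ℚ} {V V' : Set (Config g n)}
    (hV : V = V') (k : ℚ) (h : ∀ q ∈ V, c q = k * c' q) :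
    configSeries f c V = C k * configSeries f c' V' := by
  classical
  subst hV
  ext d
  rw [coeff_C_mul, configSeries, configSeries, coeff_mk, coeff_mk, mul_sum]
  exact sum_congr rfl fun q hq => h q (mem_filter.1 hq).2

theorem configSeries_fiberwise (f : Fin g → ℕ) (c : Config g n → ℚ) {V : Set (Config g n)}
    {κ : Type*} [DecidableEq κ] (key : Config g n → κ) (I : Finset κ) (h : ∀ q ∈ V, key q ∈ I) :
    configSeries f c V = ∑ k ∈ I, configSeries f c {q | q ∈ V ∧ key q = k} := by
  classical
  ext d
  rw [map_sum]
  simp only [configSeries, coeff_mk]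
  rw [← sum_fiberwise_of_maps_to (g := key) (t := I) fun q hq => h q (mem_filter.1 hq).2]
  refine sum_congr rfl fun k _ => sum_congr ?_ fun _ _ => rfl
  ext q
  simp only [mem_filter, Set.mem_ofPred_eq, and_assoc]

theorem configSeries_shift {f : Fin g → ℕ} (hf : ∀ a, 0 < f a) {c : Config g n → ℚ}
    {V V' : Set (Config g n)} (δ : Config g n) (k : ℚ) (hV : ∀ q ∈ V, q + δ ∈ V')
    (hV' : ∀ q ∈ V', ∃ q₀ ∈ V, q₀ + δ = q) (hc : ∀ q ∈ V, c (q + δ) = k * c q) :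
    configSeries f c V' = C k * PowerSeries.X ^ configDeg f δ * configSeries f c V := by
  classical
  have hdeg : ∀ q, configDeg f (q + δ) = configDeg f q + configDeg f δ := by
    intro q
    simp only [configDeg, Prod.fst_add, Prod.snd_add, Pi.add_apply, mul_add, sum_add_distrib]
    ring
  ext d
  rw [mul_assoc, coeff_C_mul, coeff_X_pow_mul']
  simp only [configSeries, coeff_mk]
  split_ifs with hd
  · rw [mul_sum]
    symm
    refine sum_nbij (fun q => q + δ) ?_ ?_ ?_ ?_
    · intro q hq
      rw [mem_filter, mem_configsOfDeg hf] at hq ⊢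
      exact ⟨by rw [hdeg]; omega, hV q hq.2⟩
    · intro q _ q' _ h
      exact add_right_cancel h
    · intro q hq
      rw [mem_coe, mem_filter, mem_configsOfDeg hf] at hq
      obtain ⟨q₀, h0, rfl⟩ := hV' q hq.2
      refine ⟨q₀, ?_, rfl⟩
      rw [mem_coe, mem_filter, mem_configsOfDeg hf]
      have := hdeg q₀
      exact ⟨by omega, h0⟩
    · intro q hq
      exact (hc q (mem_filter.1 hq).2).symm
  · rw [mul_zero]
    refine sum_eq_zero fun q hq => ?_
    rw [mem_filter, mem_configsOfDeg hf] at hq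
    obtain ⟨q₀, -, rfl⟩ := hV' q hq.2
    have := hdeg q₀
    omega

/-! ### The weight of a configuration -/

/-- The exponent of the main power of `p` in the summand that belongs to a configuration. -/
def configExp (f : Fin g → ℕ) (q : Config g n) : ℤ :=
  ∑ j, ∑ a, (f a : ℤ) * min (q.1 a) (q.2 j : ℕ) - ∑ j, ∑ j', ((min (q.2 j') (q.2 j) : ℕ) : ℤ) +
    2 * n * ∑ j, (q.2 j : ℤ)

/-- The number of indices `j' < m` from `j` on at which `μ` has the value `μ j`. -/
def tieCount (m : ℕ) (μ : Fin n → ℕ) (j : Fin n) : ℕ :=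
  #{j' : Fin n | j ≤ j' ∧ (j' : ℕ) < m ∧ μ j' = μ j}

/-- The product of the factors `qFactInv p⁻¹ c`, for the sizes `c` of the classes of equal entries
among the first `m` entries of the antitone tuple `μ`. -/
noncomputable def tieFactor (p m : ℕ) (μ : Fin n → ℕ) : ℚ :=
  ∏ j : Fin n with j.1 < m, (1 - ((p : ℚ)⁻¹) ^ tieCount m μ j)⁻¹

/-- The weight of a configuration in which only the first `m` entries of `μ` may be positive. -/
noncomputable def configWeight (f : Fin g → ℕ) (p m : ℕ) (q : Config g n) : ℚ :=
  (p : ℚ) ^ configExp f q * tieFactor p m q.2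

/-- The configuration that is one on `S` and on the first `m` indices, and zero elsewhere. -/
def stepConfig (n : ℕ) (S : Finset (Fin g)) (m : ℕ) : Config g n :=
  (fun a => if a ∈ S then 1 else 0, fun j => if j.1 < m then 1 else 0)

/-- The configuration `q` vanishes outside of `S` and of the first `m` indices. -/
def SuppIn (S : Finset (Fin g)) (m : ℕ) (q : Config g n) : Prop :=
  (∀ a, a ∉ S → q.1 a = 0) ∧ ∀ j : Fin n, m ≤ j → q.2 j = 0

/-- An initial segment of `Fin n` is determined by its size. -/
theorem iff_lt_card_of_isInitial (P : Fin n → Prop) [DecidablePred P]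
    (hP : ∀ i j, i ≤ j → P j → P i) (j : Fin n) : P j ↔ (j : ℕ) < #{i | P i} := by
  constructor
  · intro hj
    have h1 : #(Iic j) ≤ #{i | P i} := card_le_card fun i hi => by
      rw [mem_filter]
      exact ⟨mem_univ _, hP i j (mem_Iic.1 hi) hj⟩
    rw [Fin.card_Iic] at h1
    omega
  · intro hj
    by_contra h0
    have h1 : #{i | P i} ≤ #(Iio j) := card_le_card fun i hi => by
      rw [mem_Iio]
      by_contra h2
      exact h0 (hP j i (not_lt.1 h2) (mem_filter.1 hi).2)
    rw [Fin.card_Iio] at h1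
    omega

theorem card_filter_lt {m : ℕ} (hm : m ≤ n) : #{j : Fin n | (j : ℕ) < m} = m := by
  simpa using Fin.card_filter_val_lt (n := n) (m := m) |>.trans (min_eq_right hm)

theorem configDeg_stepConfig (f : Fin g → ℕ) (S : Finset (Fin g)) {m : ℕ} (hm : m ≤ n) :
    configDeg f (stepConfig n S m) = m + 2 * ∑ a ∈ S, f a := by
  simp only [configDeg, stepConfig, sum_boole, Nat.cast_id, card_filter_lt hm, mul_ite, mul_one,
    mul_zero, sum_ite_mem, univ_inter]

theorem configExp_add_stepConfig (f : Fin g → ℕ) {S : Finset (Fin g)} {m : ℕ} (hm : m ≤ n)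
    {q : Config g n} (hq : SuppIn S m q) :
    configExp f (q + stepConfig n S m) =
      (m * (∑ a ∈ S, (f a : ℤ) - m) + 2 * n * m) + configExp f q := by
  have h1 : ∀ j a, (f a : ℤ) * min ((q + stepConfig n S m).1 a) ((q + stepConfig n S m).2 j : ℕ) =
      (f a : ℤ) * min (q.1 a) (q.2 j : ℕ) +
        (if a ∈ S then (f a : ℤ) else 0) * (if j.1 < m then 1 else 0) := by
    intro j a
    simp only [stepConfig, Prod.fst_add, Prod.snd_add, Pi.add_apply]
    by_cases ha : a ∈ S <;> by_cases hj : j.1 < m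
    · simp only [ha, hj, if_true]; push_cast; rw [min_add_add_right]; ring
    · simp [hj, hq.2 j (not_lt.1 hj)]
    · simp [ha, hq.1 a ha]
    · simp [ha, hj]
  have h2 : ∀ j j', ((min ((q + stepConfig n S m).2 j') ((q + stepConfig n S m).2 j) : ℕ) : ℤ) =
      ((min (q.2 j') (q.2 j) : ℕ) : ℤ) +
        (if j'.1 < m then 1 else 0) * (if j.1 < m then 1 else 0) := by
    intro j j'
    simp only [stepConfig, Prod.snd_add, Pi.add_apply]
    by_cases ha : j'.1 < m <;> by_cases hj : j.1 < m
    · simp only [ha, hj, if_true]; rw [min_add_add_right]; push_cast; ring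
    · simp [hj, hq.2 j (not_lt.1 hj)]
    · simp [ha, hq.2 j' (not_lt.1 ha)]
    · simp [ha, hj]
  have h3 : ∀ j, (((q + stepConfig n S m).2 j : ℕ) : ℤ) = q.2 j + if j.1 < m then 1 else 0 := by
    intro j
    simp only [stepConfig, Prod.snd_add, Pi.add_apply]
    push_cast
    rfl
  have h4 : ∑ j : Fin n, (if j.1 < m then (1 : ℤ) else 0) = m := by
    rw [sum_boole, card_filter_lt hm]
  have h5 : ∑ a, (if a ∈ S then (f a : ℤ) else 0) = ∑ a ∈ S, (f a : ℤ) := by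
    rw [sum_ite_mem, univ_inter]
  simp only [configExp, h1, h2, h3, sum_add_distrib, ← sum_mul, ← mul_sum, h4, h5]
  ring

theorem tieFactor_add_stepConfig (p m : ℕ) (S : Finset (Fin g)) (q : Config g n) :
    tieFactor p m (q + stepConfig n S m).2 = tieFactor p m q.2 := by
  refine prod_congr rfl fun j hj => ?_
  have hj := (mem_filter.1 hj).2
  have : tieCount m (q + stepConfig n S m).2 j = tieCount m q.2 j := by
    rw [tieCount, tieCount]
    congr 1
    ext j'
    simp only [mem_filter, mem_univ, true_and, stepConfig, Prod.snd_add, Pi.add_apply, hj, if_true]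
    refine and_congr_right fun _ => and_congr_right fun h => ?_
    rw [if_pos h, Nat.add_right_cancel_iff]
  rw [this]

theorem configWeight_add_stepConfig (f : Fin g → ℕ) {p : ℕ} (hp : p.Prime) {S : Finset (Fin g)}
    {m : ℕ} (hm : m ≤ n) {q : Config g n} (hq : SuppIn S m q) :
    configWeight f p m (q + stepConfig n S m) =
      (p : ℚ) ^ (m * (∑ a ∈ S, (f a : ℤ) - m) + 2 * n * m) * configWeight f p m q := by
  rw [configWeight, configWeight, tieFactor_add_stepConfig, configExp_add_stepConfig f hm hq,
    zpow_add₀ (Nat.cast_ne_zero.2 hp.ne_zero), mul_assoc]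

/-- The zeros of `μ` among the first `m` entries form one class. -/
theorem tieFactor_eq_qFactInv_mul (p : ℕ) {m' m : ℕ} (hm' : m' ≤ m) (hm : m ≤ n) {μ : Fin n → ℕ}
    (h1 : ∀ j : Fin n, (j : ℕ) < m' → 0 < μ j) (h2 : ∀ j : Fin n, m' ≤ j → μ j = 0) :
    tieFactor p m μ = qFactInv (p : ℚ)⁻¹ (m - m') * tieFactor p m' μ := by
  rw [tieFactor, ← prod_filter_mul_prod_filter_not _ (fun j : Fin n => j.1 < m'), mul_comm]
  congr 1
  · rw [filter_filter, qFactInv]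
    symm
    refine prod_bij (fun i hi => ⟨m - 1 - i, by have := mem_range.1 hi; omega⟩) ?_ ?_ ?_ ?_
    · intro i hi
      have := mem_range.1 hi
      simp only [mem_filter, mem_univ, true_and]
      omega
    · intro i hi i' hi' h
      have := mem_range.1 hi
      have := mem_range.1 hi'
      simp only [Fin.mk.injEq] at h
      omega
    · intro j hj
      simp only [mem_filter, mem_univ, true_and] at hj
      refine ⟨m - 1 - j, mem_range.2 (by omega), Fin.ext ?_⟩
      simp only
      omega
    · intro i hi
      have hi := mem_range.1 hi
      have : tieCount m μ ⟨m - 1 - i, by omega⟩ = i + 1 := by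
        rw [tieCount]
        have e : ({j' : Fin n | ⟨m - 1 - i, by omega⟩ ≤ j' ∧ (j' : ℕ) < m ∧
            μ j' = μ ⟨m - 1 - i, by omega⟩} : Finset (Fin n)) =
            (({j : Fin n | (j : ℕ) < m} : Finset (Fin n)) \
              ({j : Fin n | (j : ℕ) < m - 1 - i} : Finset (Fin n))) := by
          ext j'
          simp only [mem_filter, mem_univ, true_and, mem_sdiff, Fin.le_def, not_lt]
          constructor
          · rintro ⟨h3, h4, -⟩
            exact ⟨h4, h3⟩
          · rintro ⟨h4, h3⟩
            refine ⟨h3, h4, ?_⟩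
            rw [h2 j' (by omega), h2 _ (by simp only; omega)]
        rw [e, card_sdiff_of_subset, card_filter_lt hm, card_filter_lt (by omega)]
        · omega
        · intro j
          simp only [mem_filter, mem_univ, true_and]
          omega
      rw [this]
  · rw [filter_filter, tieFactor]
    refine prod_congr ?_ fun j hj => ?_
    · ext j
      simp only [mem_filter, mem_univ, true_and]
      omega
    · have hj := (mem_filter.1 hj).2
      have : tieCount m μ j = tieCount m' μ j := by
        rw [tieCount, tieCount]
        congr 1
        ext j'
        simp only [mem_filter, mem_univ, true_and]
        refine and_congr_right fun _ => ⟨fun h => ⟨?_, h.2⟩, fun h => ⟨by omega, h.2⟩⟩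
        by_contra h3
        have h4 := h2 j' (not_lt.1 h3)
        have h5 := h1 j hj
        omega
      rw [this]

/-! ### The recursion along the blocks of the Dyck word -/

/-- The configurations supported on `S` and on the first `m` indices that satisfy the
interleaving inequalities of the blocks: `x a` is at least the entries of `μ` from the place
`M (b a)` on, where `b a` is the number of the block of `a`, and, if `b a < i`, it is less than the
entries before. -/
def validConfigs (n : ℕ) (b : Fin g → ℕ) (M : ℕ → ℕ) (i : ℕ) (S : Finset (Fin g)) (m : ℕ) :
    Set (Config g n) :=
  {q | SuppIn S m q ∧ Antitone q.2 ∧ (∀ a, ∀ j : Fin n, M (b a) ≤ j → q.2 j ≤ q.1 a) ∧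
    ∀ a, ∀ j : Fin n, b a < i → (j : ℕ) < M (b a) → q.1 a < q.2 j}

/-- All entries of `q` on `S` and on the first `m` indices are positive. -/
def FullOn (S : Finset (Fin g)) (m : ℕ) (q : Config g n) : Prop :=
  (∀ a ∈ S, 0 < q.1 a) ∧ ∀ j : Fin n, (j : ℕ) < m → 0 < q.2 j

/-- Subtracting one from all positive entries. -/
theorem configSeries_fullOn {f : Fin g → ℕ} (hf : ∀ a, 0 < f a) {p : ℕ} (hp : p.Prime)
    {b : Fin g → ℕ} {M : ℕ → ℕ} {i i' m : ℕ} {S : Finset (Fin g)} (hm : m ≤ n) (hi : i ≤ i')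
    (hS : ∀ a, M (b a) < m → a ∈ S) (hM : ∀ a, b a < i' → M (b a) ≤ m)
    (hup : ∀ a, b a < i' → b a < i ∨ a ∉ S)
    (hdown : ∀ q ∈ validConfigs n b M i' S m, FullOn S m q →
      ∀ a, a ∉ S → b a < i → ∀ j : Fin n, (j : ℕ) < M (b a) → 1 < q.2 j) :
    configSeries f (configWeight f p m) {q | q ∈ validConfigs n b M i' S m ∧ FullOn S m q} =
      C ((p : ℚ) ^ (m * (∑ a ∈ S, (f a : ℤ) - m) + 2 * n * m)) *
        PowerSeries.X ^ (m + 2 * ∑ a ∈ S, f a) *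
        configSeries f (configWeight f p m) (validConfigs n b M i S m) := by
  rw [← configDeg_stepConfig f S hm]
  refine configSeries_shift hf _ _ ?_ ?_ fun q hq => configWeight_add_stepConfig f hp hm hq.1
  · rintro q ⟨⟨h1, h2⟩, h3, h4, h5⟩
    refine ⟨⟨⟨fun a ha => ?_, fun j hj => ?_⟩, fun j j' hj => ?_, fun a j hj => ?_,
      fun a j ha hj => ?_⟩, fun a ha => ?_, fun j hj => ?_⟩
    all_goals simp only [stepConfig, Prod.fst_add, Prod.snd_add, Pi.add_apply]
    · rw [if_neg ha, h1 a ha]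
    · rw [if_neg (not_lt.2 hj), h2 j hj]
    · have := h3 hj
      have : (j : ℕ) ≤ j' := hj
      split_ifs <;> omega
    · have := h4 a j hj
      by_cases hjm : (j : ℕ) < m
      · rw [if_pos hjm, if_pos (hS a (hj.trans_lt hjm))]
        omega
      · have := h2 j (not_lt.1 hjm)
        rw [if_neg hjm]
        omega
    · rw [if_pos (hj.trans_le (hM a ha))]
      by_cases haS : a ∈ S
      · have := h5 a j ((hup a ha).resolve_right (not_not.2 haS)) hj
        rw [if_pos haS]
        omega
      · rw [if_neg haS, h1 a haS]
        omega
    · rw [if_pos ha]; omega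
    · rw [if_pos hj]; omega
  · rintro q ⟨hq, hfull⟩
    have hdown := hdown q hq hfull
    obtain ⟨⟨h1, h2⟩, h3, h4, h5⟩ := hq
    obtain ⟨h6, h7⟩ := hfull
    refine ⟨(fun a => q.1 a - 1, fun j => q.2 j - 1), ⟨⟨fun a ha => ?_, fun j hj => ?_⟩,
      fun j j' hj => ?_, fun a j hj => ?_, fun a j ha hj => ?_⟩, ?_⟩
    · simp only [h1 a ha]
    · simp only [h2 j hj]
    · exact Nat.sub_le_sub_right (h3 hj) 1
    · exact Nat.sub_le_sub_right (h4 a j hj) 1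
    · have h8 := h5 a j (ha.trans_le hi) hj
      simp only
      by_cases haS : a ∈ S
      · have := h6 a haS
        omega
      · have := hdown a haS ha j hj
        have := h1 a haS
        omega
    · refine Prod.ext (funext fun a => ?_) (funext fun j => ?_)
      · simp only [stepConfig, Prod.fst_add, Pi.add_apply]
        by_cases haS : a ∈ S
        · have := h6 a haS
          rw [if_pos haS]; omega
        · rw [if_neg haS, h1 a haS]
      · simp only [stepConfig, Prod.snd_add, Pi.add_apply]
        by_cases hj : (j : ℕ) < m
        · have := h7 j hj
          rw [if_pos hj]; omega
        · rw [if_neg hj, h2 j (not_lt.1 hj)]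

theorem fullOn_of_forall_pos {b : Fin g → ℕ} {M : ℕ → ℕ} {i m : ℕ} {S : Finset (Fin g)}
    (hm : m ≤ n) {q : Config g n} (hq : q ∈ validConfigs n b M i S m)
    (hpos : ∀ j : Fin n, (j : ℕ) < m → 0 < q.2 j)
    (hS : ∀ a ∈ S, M (b a) < m ∨ 0 < q.1 a) : FullOn S m q := by
  refine ⟨fun a ha => ?_, hpos⟩
  rcases hS a ha with h | h
  · exact (hpos ⟨M (b a), h.trans_le hm⟩ h).trans_le (hq.2.2.1 a ⟨M (b a), _⟩ le_rfl)
  · exact h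

/-- The numerical data of a state: the monomial by which the summand of a configuration gets
multiplied when one is added to `m` entries of `μ` and to blocks of total size `k`. -/
def stateWeight {F : Type*} [Field F] (n : ℕ) (X Y : F) (k m : ℕ) : F :=
  X ^ (m * ((k : ℤ) - m) + 2 * n * m) * Y ^ (m + 2 * k)

theorem toFrac_stateWeight (p k m : ℕ) :
    toFrac (C ((p : ℚ) ^ (m * ((k : ℤ) - m) + 2 * n * m)) * PowerSeries.X ^ (m + 2 * k)) =
      stateWeight n (p : FracSeries) (toFrac PowerSeries.X) k m := by
  rw [stateWeight, map_mul, map_pow]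
  congr 1
  rw [← RingHom.comp_apply, map_zpow₀, map_natCast]

theorem stateWeight_ne_one (p k m : ℕ) (h : m + 2 * k ≠ 0) :
    stateWeight n (p : FracSeries) (toFrac PowerSeries.X) k m ≠ 1 := by
  rw [← toFrac_stateWeight, ← map_one toFrac]
  intro h1
  have h2 := congrArg (constantCoeff (R := ℚ)) (toFrac_injective h1)
  rw [map_mul, map_pow, constantCoeff_X, zero_pow h, mul_zero, map_one] at h2
  exact zero_ne_one h2

section Stages

variable {f : Fin g → ℕ} {p : ℕ} {b : Fin g → ℕ} {M : ℕ → ℕ}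

/-- The indices in the blocks before the `i`-th. -/
def blocksBelow (b : Fin g → ℕ) (i : ℕ) : Finset (Fin g) := {a | b a < i}

/-- The indices in the `i`-th block. -/
def blockAt (b : Fin g → ℕ) (i : ℕ) : Finset (Fin g) := {a | b a = i}

theorem disjoint_blocksBelow_blockAt (b : Fin g → ℕ) (i : ℕ) :
    Disjoint (blocksBelow b i) (blockAt b i) := by
  rw [disjoint_left]
  simp only [blocksBelow, blockAt, mem_filter, mem_univ, true_and]
  omega

theorem blocksBelow_union_blockAt (b : Fin g → ℕ) (i : ℕ) :
    blocksBelow b i ∪ blockAt b i = blocksBelow b (i + 1) := by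
  ext a
  simp only [blocksBelow, blockAt, mem_union, mem_filter, mem_univ, true_and]
  omega

theorem sum_blocksBelow_union (f : Fin g → ℕ) {i : ℕ} {T : Finset (Fin g)} (hT : T ⊆ blockAt b i) :
    ∑ a ∈ blocksBelow b i ∪ T, f a = ∑ a ∈ blocksBelow b i, f a + ∑ a ∈ T, f a :=
  sum_union (disjoint_of_subset_right hT (disjoint_blocksBelow_blockAt b i))

/-- Filling up the `i`-th block of the partition, while the first `M i` entries of `μ` may be
positive. -/
theorem toFrac_configSeries_powerset (hf : ∀ a, 0 < f a) (hp : p.Prime) (hM : StrictMono M) {i : ℕ}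
    (hb : ∃ a, b a = i) (hMn : M i ≤ n) :
    toFrac (configSeries f (configWeight f p (M i))
        (validConfigs n b M (i + 1) (blocksBelow b (i + 1)) (M i))) =
      stateWeight n (p : FracSeries) (toFrac PowerSeries.X) (∑ a ∈ blocksBelow b i, f a) (M i) *
        toFrac (configSeries f (configWeight f p (M i))
          (validConfigs n b M i (blocksBelow b i) (M i))) *
        chainSumLE (fun _ _ => 1) (fun T => stateWeight n (p : FracSeries) (toFrac PowerSeries.X)
          (∑ a ∈ blocksBelow b i, f a + ∑ a ∈ T, f a) (M i)) (blockAt b i) := by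
  classical
  obtain ⟨a₀, ha₀⟩ := hb
  set c := configWeight (n := n) f p (M i) with hc
  set V : Finset (Fin g) → Set (Config g n) := fun T =>
    validConfigs n b M (i + 1) (blocksBelow b i ∪ T) (M i) with hV
  set key : Config g n → Finset (Fin g) := fun q => {a | b a = i ∧ q.1 a ≠ 0} with hkey
  have hmemU : ∀ (T : Finset (Fin g)) a, a ∈ blocksBelow b i ∪ T ↔ b a < i ∨ a ∈ T := by
    intro T a
    simp [blocksBelow]
  have hkeyV : ∀ T q, q ∈ V T → key q ⊆ T := by
    intro T q hq a ha
    simp only [hkey, mem_filter, mem_univ, true_and] at ha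
    by_contra haT
    exact ha.2 (hq.1.1 a (by rw [hmemU, not_or]; exact ⟨by omega, haT⟩))
  -- a configuration in which the exact support on the `i`-th block is `T`
  have hexact : ∀ T ⊆ blockAt b i, {q | q ∈ V T ∧ key q = T} =
      {q | q ∈ V T ∧ FullOn (blocksBelow b i ∪ T) (M i) q} := by
    intro T hT
    ext q
    simp only [Set.mem_ofPred_eq]
    refine and_congr_right fun hq => ⟨fun h => ?_, fun h => ?_⟩
    · refine fullOn_of_forall_pos hMn hq (fun j hj => ?_) fun a ha => ?_
      · exact (Nat.zero_le _).trans_lt (hq.2.2.2 a₀ j (by omega) (by rwa [ha₀]))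
      · rcases (hmemU T a).1 ha with ha | ha
        · exact Or.inl (hM ha)
        · rw [← h] at ha
          simp only [hkey, mem_filter, mem_univ, true_and] at ha
          exact Or.inr (Nat.pos_of_ne_zero ha.2)
    · refine (hkeyV T q hq).antisymm fun a ha => ?_
      simp only [hkey, mem_filter, mem_univ, true_and]
      have h1 := hT ha
      simp only [blockAt, mem_filter, mem_univ, true_and] at h1
      exact ⟨h1, (h.1 a ((hmemU T a).2 (Or.inr ha))).ne'⟩
  have hfiber : ∀ T ⊆ blockAt b i, ∀ T' ⊆ T,
      {q | q ∈ V T ∧ key q = T'} = {q | q ∈ V T' ∧ key q = T'} := by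
    intro T hT T' hT'
    ext q
    simp only [Set.mem_ofPred_eq]
    refine and_congr_left fun h => ⟨fun hq => ⟨⟨fun a ha => ?_, hq.1.2⟩, hq.2⟩,
      fun hq => ⟨⟨fun a ha => hq.1.1 a fun h' => ha ?_, hq.1.2⟩, hq.2⟩⟩
    · rw [hmemU, not_or] at ha
      by_cases hba : b a = i
      · by_contra h0
        apply ha.2
        rw [← h]
        simp only [hkey, mem_filter, mem_univ, true_and]
        exact ⟨hba, h0⟩
      · refine hq.1.1 a ?_
        rw [hmemU, not_or]
        refine ⟨ha.1, fun h' => hba ?_⟩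
        have := hT h'
        simpa only [blockAt, mem_filter, mem_univ, true_and] using this
    · rw [hmemU] at h' ⊢
      exact h'.imp_right fun h => hT' h
  set R : Finset (Fin g) → FracSeries := fun T =>
    toFrac (configSeries f c {q | q ∈ V T ∧ key q = T})
    with hR
  have hsum : ∀ T ⊆ blockAt b i, toFrac (configSeries f c (V T)) = ∑ t ∈ Iic T, 1 * R t := by
    intro T hT
    rw [configSeries_fiberwise f c key (Iic T) fun q hq => mem_Iic.2 (hkeyV T q hq), map_sum]
    refine sum_congr rfl fun t ht => ?_
    rw [one_mul, hR, hfiber T hT t (mem_Iic.1 ht)]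
  have hmemS : ∀ (T : Finset (Fin g)) a, M (b a) < M i → a ∈ blocksBelow b i ∪ T := fun T a h =>
    (hmemU T a).2 (Or.inl (hM.lt_iff_lt.1 h))
  have hrec : ∀ T ≤ blockAt b i, T ≠ ⊥ → R T = stateWeight n (p : FracSeries)
      (toFrac PowerSeries.X) (∑ a ∈ blocksBelow b i, f a + ∑ a ∈ T, f a) (M i) *
        ∑ t ∈ Iic T, 1 * R t := by
    intro T hT hne
    obtain ⟨a₁, ha₁⟩ := nonempty_iff_ne_empty.2 hne
    have hba₁ : b a₁ = i := by simpa [blockAt] using hT ha₁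
    rw [← hsum T hT, ← toFrac_stateWeight, ← map_mul]
    simp only [hR]
    rw [hexact T hT]
    congr 1
    have := configSeries_fullOn hf hp (b := b) (M := M) (i := i + 1) (i' := i + 1)
      (S := blocksBelow b i ∪ T) hMn le_rfl (hmemS T)
      (fun a ha => hM.monotone (Nat.lt_succ_iff.1 ha)) (fun a ha => Or.inl ha) ?_
    · rw [← Nat.cast_sum, sum_blocksBelow_union f hT] at this
      exact this
    · intro q hq hfull a ha hai j hj
      have h1 := hq.2.2.2 a₁ j (by omega) (hj.trans_le (by
        rw [hba₁]; exact hM.monotone (Nat.lt_succ_iff.1 hai)))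
      have h2 := hfull.1 a₁ ((hmemU T a₁).2 (Or.inr ha₁))
      omega
  have hbot : R ⊥ = stateWeight n (p : FracSeries) (toFrac PowerSeries.X)
      (∑ a ∈ blocksBelow b i, f a) (M i) *
        toFrac (configSeries f c (validConfigs n b M i (blocksBelow b i) (M i))) := by
    rw [← toFrac_stateWeight, ← map_mul]
    simp only [hR]
    rw [hexact ⊥ (empty_subset _)]
    congr 1
    have := configSeries_fullOn hf hp (b := b) (M := M) (i := i) (i' := i + 1)
      (S := blocksBelow b i) hMn (Nat.le_succ i) (by simpa using hmemS ∅)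
      (fun a ha => hM.monotone (Nat.lt_succ_iff.1 ha)) (fun a ha => ?_) ?_
    · rw [← Nat.cast_sum] at this
      simpa only [hV, bot_eq_empty, union_empty] using this
    · simp only [blocksBelow, mem_filter, mem_univ, true_and]
      omega
    · intro q hq hfull a ha hai
      exact absurd (by simpa [blocksBelow] using hai) ha
  rw [← hbot, ← sum_Iic_eq_mul_chainSumLE (fun _ => rfl) R (fun T hT hne =>
    stateWeight_ne_one p _ _ ?_) hrec, ← hsum _ subset_rfl]
  · simp only [hV, blocksBelow_union_blockAt]
  · obtain ⟨a₁, ha₁⟩ := nonempty_iff_ne_empty.2 hne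
    have h1 : f a₁ ≤ ∑ a ∈ T, f a := single_le_sum (fun _ _ => Nat.zero_le _) ha₁
    have := hf a₁
    omega

/-- Filling up the `i`-th block of entries of `μ`. -/
theorem toFrac_configSeries_chain (hf : ∀ a, 0 < f a) (hp : p.Prime) (hM : StrictMono M) {i : ℕ}
    (hb : ∃ a, b a = i) (hMn : M (i + 1) ≤ n) :
    toFrac (configSeries f (configWeight f p (M (i + 1)))
        (validConfigs n b M (i + 1) (blocksBelow b (i + 1)) (M (i + 1)))) =
      toFrac (configSeries f (configWeight f p (M i))
        (validConfigs n b M (i + 1) (blocksBelow b (i + 1)) (M i))) *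
        chainSumLE (fun k l => qFactInv (p : FracSeries)⁻¹ (l - k))
          (fun k => stateWeight n (p : FracSeries) (toFrac PowerSeries.X)
            (∑ a ∈ blocksBelow b (i + 1), f a) (M i + k)) (M (i + 1) - M i) := by
  classical
  obtain ⟨a₀, ha₀⟩ := hb
  have hMi : M i < M (i + 1) := hM (Nat.lt_succ_self i)
  set d := M (i + 1) - M i with hd
  set S := blocksBelow b (i + 1) with hS
  have hmemS : ∀ a, a ∈ S ↔ b a ≤ i := by
    intro a
    simp [hS, blocksBelow]
  set V : ℕ → Set (Config g n) := fun k => validConfigs n b M (i + 1) S (M i + k) with hV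
  set c : ℕ → Config g n → ℚ := fun k => configWeight f p (M i + k) with hc
  set key : Config g n → ℕ := fun q => #{j : Fin n | 0 < q.2 j} - M i with hkey
  -- the positive entries of `μ` form an initial segment, of length at least `M i`
  have hpos : ∀ k ≤ d, ∀ q ∈ V k, M i ≤ #{j : Fin n | 0 < q.2 j} ∧
      #{j : Fin n | 0 < q.2 j} ≤ M i + k ∧
      ∀ j : Fin n, 0 < q.2 j ↔ (j : ℕ) < #{j : Fin n | 0 < q.2 j} := by
    intro k hk q hq
    refine ⟨?_, ?_, ?_⟩
    · rw [← card_filter_lt (n := n) (m := M i) (by omega)]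
      refine card_le_card fun j hj => ?_
      simp only [mem_filter, mem_univ, true_and] at hj ⊢
      exact (Nat.zero_le _).trans_lt (hq.2.2.2 a₀ j (by omega) (by rwa [ha₀]))
    · rw [← card_filter_lt (n := n) (m := M i + k) (by omega)]
      refine card_le_card fun j hj => ?_
      simp only [mem_filter, mem_univ, true_and] at hj ⊢
      by_contra h
      rw [hq.1.2 j (not_lt.1 h)] at hj
      exact lt_irrefl _ hj
    · exact iff_lt_card_of_isInitial (fun j => 0 < q.2 j) fun j j' h hj => hj.trans_le (hq.2.1 h)
  have hkeyV : ∀ k ≤ d, ∀ q ∈ V k, key q ≤ k ∧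
      ∀ j : Fin n, 0 < q.2 j ↔ (j : ℕ) < M i + key q := by
    intro k hk q hq
    obtain ⟨h1, h2, h3⟩ := hpos k hk q hq
    refine ⟨by simp only [hkey]; omega, fun j => ?_⟩
    rw [h3]
    simp only [hkey]
    omega
  have hkeyI : ∀ k ≤ d, ∀ q ∈ V k, ∀ k' ≤ k, (∀ j : Fin n, 0 < q.2 j ↔ (j : ℕ) < M i + k') →
      key q = k' := by
    intro k hk q hq k' hk' h
    have : (univ.filter fun j : Fin n => 0 < q.2 j) =
        univ.filter fun j : Fin n => (j : ℕ) < M i + k' := by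
      ext j
      simp only [mem_filter, mem_univ, true_and, h]
    simp only [hkey]
    rw [this, card_filter_lt (by omega)]
    omega
  have hfiber : ∀ k ≤ d, ∀ k' ≤ k,
      {q | q ∈ V k ∧ key q = k'} = {q | q ∈ V k' ∧ key q = k'} := by
    intro k hk k' hk'
    ext q
    simp only [Set.mem_ofPred_eq]
    refine and_congr_left fun h => ⟨fun hq => ⟨⟨hq.1.1, fun j hj => ?_⟩, hq.2⟩,
      fun hq => ⟨⟨hq.1.1, fun j hj => hq.1.2 j (by omega)⟩, hq.2⟩⟩
    by_contra h0
    have := ((hkeyV k hk q hq).2 j).1 (Nat.pos_of_ne_zero h0)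
    omega
  set R : ℕ → FracSeries := fun k => toFrac (configSeries f (c k) {q | q ∈ V k ∧ key q = k}) with hR
  have hsum : ∀ k ≤ d, toFrac (configSeries f (c k) (V k)) =
      ∑ l ∈ Iic k, qFactInv (p : FracSeries)⁻¹ (k - l) * R l := by
    intro k hk
    rw [configSeries_fiberwise f (c k) key (Iic k) fun q hq => mem_Iic.2 (hkeyV k hk q hq).1,
      map_sum]
    refine sum_congr rfl fun l hl => ?_
    have hl := mem_Iic.1 hl
    rw [configSeries_congr f (hfiber k hk l hl) (c' := c l) (qFactInv (p : ℚ)⁻¹ (k - l)), map_mul]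
    · congr 1
      rw [← RingHom.comp_apply, qFactInv, map_prod, qFactInv]
      refine prod_congr rfl fun i _ => ?_
      rw [map_inv₀, map_sub, map_one, map_pow, map_inv₀, map_natCast]
    · rintro q ⟨hq, hql⟩
      have h1 := (hkeyV k hk q hq).2
      rw [hql] at h1
      simp only [hc, configWeight]
      rw [tieFactor_eq_qFactInv_mul p (m' := M i + l) (by omega) (by omega)
        (fun j hj => (h1 j).2 hj) (fun j hj => by
          by_contra h0
          have := (h1 j).1 (Nat.pos_of_ne_zero h0)
          omega)]
      have : M i + k - (M i + l) = k - l := by omega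
      rw [this]
      ring
  have hrec : ∀ k ≤ d, k ≠ ⊥ → R k = stateWeight n (p : FracSeries) (toFrac PowerSeries.X)
      (∑ a ∈ S, f a) (M i + k) * ∑ l ∈ Iic k, qFactInv (p : FracSeries)⁻¹ (k - l) * R l := by
    intro k hk hk0
    rw [← hsum k hk, ← toFrac_stateWeight, ← map_mul]
    have hk0 : 0 < k := Nat.pos_of_ne_zero hk0
    have hkn : M i + k ≤ n := by omega
    have hexact : {q | q ∈ V k ∧ key q = k} = {q | q ∈ V k ∧ FullOn S (M i + k) q} := by
      ext q
      simp only [Set.mem_ofPred_eq]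
      refine and_congr_right fun hq => ⟨fun h => ?_, fun h => ?_⟩
      · refine fullOn_of_forall_pos hkn hq (fun j hj => ?_) fun a ha => Or.inl ?_
        · rwa [(hkeyV k hk q hq).2 j, h]
        · have := hM.monotone ((hmemS a).1 ha)
          omega
      · refine hkeyI k hk q hq k le_rfl fun j => ⟨fun hj => ?_, h.2 j⟩
        by_contra h0
        rw [hq.1.2 j (not_lt.1 h0)] at hj
        exact lt_irrefl _ hj
    simp only [hR]
    rw [hexact]
    congr 1
    have := configSeries_fullOn hf hp (b := b) (M := M) (i := i + 1) (i' := i + 1) (S := S)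
      hkn le_rfl (fun a ha => ?_) (fun a ha => ?_) (fun a ha => Or.inl ha) ?_
    · rw [← Nat.cast_sum] at this
      exact this
    · have h1 : M i + k ≤ M (i + 1) := by omega
      exact (hmemS a).2 (Nat.lt_succ_iff.1 (hM.lt_iff_lt.1 (ha.trans_le h1)))
    · have := hM.monotone (Nat.lt_succ_iff.1 ha)
      omega
    · intro q hq hfull a ha hai
      exact absurd ((hmemS a).2 (Nat.lt_succ_iff.1 hai)) ha
  have hbot : R ⊥ = toFrac (configSeries f (configWeight f p (M i))
      (validConfigs n b M (i + 1) S (M i))) := by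
    have : {q | q ∈ V 0 ∧ key q = 0} = V 0 := by
      ext q
      simp only [Set.mem_ofPred_eq, and_iff_left_iff_imp]
      exact fun hq => Nat.le_zero.1 (hkeyV 0 (Nat.zero_le _) q hq).1
    simp only [hR, Nat.bot_eq_zero]
    rw [this]
    rfl
  have hMd : M (i + 1) = M i + d := by omega
  rw [← hbot, ← sum_Iic_eq_mul_chainSumLE (fun k => by rw [Nat.sub_self, qFactInv_zero]) R
    (fun k hk hne => stateWeight_ne_one p _ _ (by
      have : k ≠ 0 := hne
      omega)) hrec, ← hsum d le_rfl, hMd]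

/-- The factor of the generating function that belongs to the first `r` blocks. -/
def blockProduct {F : Type*} [Field F] (f : Fin g → ℕ) (n : ℕ) (b : Fin g → ℕ) (M : ℕ → ℕ)
    (X Y : F) (r : ℕ) : F :=
  ∏ i ∈ range r, stateWeight n X Y (∑ a ∈ blocksBelow b i, f a) (M i) *
    chainSumLE (fun _ _ => 1) (fun T => stateWeight n X Y
      (∑ a ∈ blocksBelow b i, f a + ∑ a ∈ T, f a) (M i)) (blockAt b i) *
    chainSumLE (fun k l => qFactInv X⁻¹ (l - k)) (fun k => stateWeight n X Y
      (∑ a ∈ blocksBelow b (i + 1), f a) (M i + k)) (M (i + 1) - M i)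

/-- The generating function of all configurations that satisfy the interleaving inequalities of the
first `r` blocks. -/
theorem toFrac_configSeries_eq_blockProduct (hf : ∀ a, 0 < f a) (hp : p.Prime) (hM : StrictMono M)
    (hM0 : M 0 = 0) {r : ℕ} (hb : ∀ i < r, ∃ a, b a = i) (hMn : M r ≤ n) :
    toFrac (configSeries f (configWeight f p (M r))
        (validConfigs n b M r (blocksBelow b r) (M r))) =
      blockProduct f n b M (p : FracSeries) (toFrac PowerSeries.X) r := by
  induction r with
  | zero =>
    rw [blockProduct, prod_range_zero, ← map_one toFrac]
    congr 1
    classical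
    have hV : ∀ q : Config g n, q ∈ validConfigs n b M 0 (blocksBelow b 0) (M 0) ↔ q = 0 := by
      intro q
      constructor
      · rintro ⟨⟨h1, h2⟩, -⟩
        refine Prod.ext (funext fun a => h1 a (by simp [blocksBelow]))
          (funext fun j => h2 j (by rw [hM0]; exact Nat.zero_le _))
      · rintro rfl
        exact ⟨⟨fun _ _ => rfl, fun _ _ => rfl⟩, fun _ _ _ => le_rfl, fun _ _ _ => le_rfl,
          fun a j h => absurd h (Nat.not_lt_zero _)⟩
    ext d
    rw [configSeries, coeff_mk, coeff_one]
    have h0 : configDeg f (0 : Config g n) = 0 := by simp [configDeg]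
    split_ifs with hd
    · rw [hd, sum_eq_single 0]
      · simp [configWeight, configExp, tieFactor, hM0]
      · intro q hq hne
        exact absurd ((hV q).1 (mem_filter.1 hq).2) hne
      · intro h
        rw [mem_filter, mem_configsOfDeg hf] at h
        exact absurd ⟨h0, (hV 0).2 rfl⟩ h
    · refine sum_eq_zero fun q hq => ?_
      rw [mem_filter, mem_configsOfDeg hf, hV] at hq
      obtain ⟨h1, rfl⟩ := hq
      exact absurd (h1.symm.trans h0) hd
  | succ r ih =>
    have hMr : M r < M (r + 1) := hM (Nat.lt_succ_self r)
    rw [blockProduct, prod_range_succ, ← blockProduct,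
      ← ih (fun i hi => hb i (hi.trans (Nat.lt_succ_self r))) (by omega),
      toFrac_configSeries_chain hf hp hM (hb r (Nat.lt_succ_self r)) hMn,
      toFrac_configSeries_powerset hf hp hM (hb r (Nat.lt_succ_self r)) (by omega)]
    ring

end Stages

/-! ### The functional equation -/

/-- The product of the numerators in the formula for the numbers of subgroups. It depends only on
the Dyck word: if `j` lies in the `i`-th block of entries of `μ`, then the number of parts of `λ`
that are at least `μ j` is the total size of the blocks up to the `i`-th. -/
def leadFactor {F : Type*} [Field F] (f : Fin g → ℕ) (b : Fin g → ℕ) (M : ℕ → ℕ) (X : F)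
    (r : ℕ) : F :=
  ∏ i ∈ range r, ∏ j ∈ Ico (M i) (M (i + 1)),
    (1 - X ^ ((j : ℤ) - (∑ a ∈ blocksBelow b (i + 1), f a : ℕ)))

section Field

variable {F G : Type*} [Field F] [Field G] {f : Fin g → ℕ} {b : Fin g → ℕ} {M : ℕ → ℕ}

theorem map_stateWeight (φ : F →+* G) (X Y : F) (k m : ℕ) :
    φ (stateWeight n X Y k m) = stateWeight n (φ X) (φ Y) k m := by
  rw [stateWeight, stateWeight, map_mul, map_zpow₀, map_pow]

theorem map_leadFactor (φ : F →+* G) (X : F) (r : ℕ) :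
    φ (leadFactor f b M X r) = leadFactor f b M (φ X) r := by
  simp only [leadFactor, map_prod, map_sub, map_one, map_zpow₀]

theorem map_blockProduct (φ : F →+* G) (X Y : F) (r : ℕ) :
    φ (blockProduct f n b M X Y r) = blockProduct f n b M (φ X) (φ Y) r := by
  simp only [blockProduct, map_prod, map_mul, map_chainSumLE, map_stateWeight, map_one, qFactInv,
    map_inv₀, map_sub, map_pow]

theorem stateWeight_inv (X Y : F) (k m : ℕ) :
    stateWeight n X⁻¹ Y⁻¹ k m = (stateWeight n X Y k m)⁻¹ := by
  rw [stateWeight, stateWeight, mul_inv, inv_zpow, inv_pow]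

theorem stateWeight_ne_zero {X Y : F} (hX : X ≠ 0) (hY : Y ≠ 0) (k m : ℕ) :
    stateWeight n X Y k m ≠ 0 :=
  mul_ne_zero (zpow_ne_zero _ hX) (pow_ne_zero _ hY)

theorem stateWeight_add {X : F} (hX : X ≠ 0) (Y : F) (k e m : ℕ) :
    stateWeight n X Y (k + e) m = stateWeight n X Y k m * X ^ ((m : ℤ) * e) * Y ^ (2 * e) := by
  have : (m * (((k + e : ℕ) : ℤ) - m) + 2 * n * m) = (m * ((k : ℤ) - m) + 2 * n * m) + m * e := by
    push_cast
    ring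
  rw [stateWeight, this, zpow_add₀ hX, stateWeight]
  ring

theorem prod_one_sub_zpow_inv {X : F} (hX : X ≠ 0) (k : ℕ) (s : Finset ℕ) :
    ∏ j ∈ s, (1 - X⁻¹ ^ ((j : ℤ) - k)) = (-1) ^ #s * X ^ (#s * (k : ℤ) - ∑ j ∈ s, (j : ℤ)) *
      ∏ j ∈ s, (1 - X ^ ((j : ℤ) - k)) := by
  have h1 : X ^ (#s * (k : ℤ) - ∑ j ∈ s, (j : ℤ)) = ∏ j ∈ s, X ^ ((k : ℤ) - j) := by
    induction s using Finset.induction_on with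
    | empty => simp
    | insert a s ha ih =>
      rw [prod_insert ha, ← ih, ← zpow_add₀ hX, sum_insert ha, card_insert_of_notMem ha]
      congr 1
      push_cast
      ring
  rw [h1, ← prod_const, ← prod_mul_distrib, ← prod_mul_distrib]
  refine prod_congr rfl fun j _ => ?_
  have h2 : X ^ ((k : ℤ) - j) * X ^ ((j : ℤ) - k) = 1 := by
    rw [← zpow_add₀ hX]
    simp
  have h3 : X⁻¹ ^ ((j : ℤ) - k) = X ^ ((k : ℤ) - j) := by
    rw [inv_zpow', neg_sub]
  rw [h3]
  linear_combination -h2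

/-- Each block contributes a sign and a monomial; these multiply up to a monomial that depends only
on the end point of the blocks. -/
theorem leadFactor_mul_blockProduct_inv {X Y : F} (hX : X ≠ 0) (hY : Y ≠ 0)
    (hXp : ∀ i, X ^ (i + 1) ≠ 1) (h1 : ∀ k m, m + 2 * k ≠ 0 → stateWeight n X Y k m ≠ 1)
    (hf : ∀ a, 0 < f a) (hM : StrictMono M) (hM0 : M 0 = 0) {r : ℕ} (hb : ∀ i < r, ∃ a, b a = i) :
    leadFactor f b M X⁻¹ r * blockProduct f n b M X⁻¹ Y⁻¹ r =
      (-1) ^ (#(blocksBelow b r) + M r) *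
        stateWeight n X Y (∑ a ∈ blocksBelow b r, f a) (M r) *
        X ^ ((M r : ℤ) * (∑ a ∈ blocksBelow b r, f a : ℕ) - ∑ j ∈ range (M r), ((j : ℤ) + 1)) *
        Y ^ (2 * ∑ a ∈ blocksBelow b r, f a) *
        (leadFactor f b M X r * blockProduct f n b M X Y r) := by
  induction r with
  | zero =>
    have h0 : blocksBelow b 0 = ∅ := by simp [blocksBelow]
    simp [leadFactor, blockProduct, hM0, h0, stateWeight]
  | succ r ih =>
    have ih := ih fun i hi => hb i (hi.trans (Nat.lt_succ_self r))
    have hMr : M r < M (r + 1) := hM (Nat.lt_succ_self r)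
    obtain ⟨a₀, ha₀⟩ := hb r (Nat.lt_succ_self r)
    have hne : blockAt b r ≠ ∅ := nonempty_iff_ne_empty.1 ⟨a₀, by simp [blockAt, ha₀]⟩
    obtain ⟨d, hd⟩ := Nat.exists_eq_add_of_lt hMr
    set K := ∑ a ∈ blocksBelow b r, f a with hK
    set e := ∑ a ∈ blockAt b r, f a with he
    have hK' : ∑ a ∈ blocksBelow b (r + 1), f a = K + e := by
      rw [← blocksBelow_union_blockAt, sum_blocksBelow_union f subset_rfl]
    have hcard : #(blocksBelow b (r + 1)) = #(blocksBelow b r) + #(blockAt b r) := by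
      rw [← blocksBelow_union_blockAt,
        card_union_of_disjoint (disjoint_blocksBelow_blockAt b r)]
    have hpow := chainSumLE_powerset_inv (S := blockAt b r)
      (x := fun T => stateWeight n X Y (K + ∑ a ∈ T, f a) (M r))
      (x' := fun T => stateWeight n X⁻¹ Y⁻¹ (K + ∑ a ∈ T, f a) (M r))
      (fun T _ hT => h1 _ _ (by
        obtain ⟨a₁, ha₁⟩ := nonempty_iff_ne_empty.2 hT
        have h1 : f a₁ ≤ ∑ a ∈ T, f a := single_le_sum (fun _ _ => Nat.zero_le _) ha₁
        have := hf a₁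
        omega)) (fun T _ _ => stateWeight_ne_zero hX hY _ _) (fun T _ _ => stateWeight_inv X Y _ _)
    rw [chainSum_eq_mul_chainSumLE (fun _ => rfl) hne (h1 _ _ (by
        have h2 : f a₀ ≤ e := single_le_sum (fun _ _ => Nat.zero_le _) (by simp [blockAt, ha₀])
        have := hf a₀
        omega)), ← he] at hpow
    have hchain := chainSumLE_qFactInv_inv (q := X⁻¹) (inv_ne_zero hX)
      (fun i h => hXp i (inv_eq_one.1 (by rwa [inv_pow] at h)))
      (x := fun k => stateWeight n X Y (K + e) (M r + k))
      (x' := fun k => stateWeight n X⁻¹ Y⁻¹ (K + e) (M r + k)) (d := d + 1)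
      (fun k _ hk => h1 _ _ (by omega)) (fun k _ _ => stateWeight_ne_zero hX hY _ _)
      (fun k _ _ => stateWeight_inv X Y _ _)
    rw [chainSum_eq_mul_chainSumLE (ζ := fun k l => qFactInv X⁻¹ (l - k))
      (x := fun k => stateWeight n X Y (K + e) (M r + k))
      (fun k => by rw [Nat.sub_self, qFactInv_zero]) (Nat.succ_ne_zero d)
      (h1 _ _ (by omega))] at hchain
    have hS : ∑ j ∈ range (M (r + 1)), ((j : ℤ) + 1) = ∑ j ∈ range (M r), ((j : ℤ) + 1) +
        ∑ j ∈ Ico (M r) (M (r + 1)), (j : ℤ) + (d + 1 : ℕ) := by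
      rw [← sum_range_add_sum_Ico _ hMr.le, add_assoc, sum_add_distrib (s := Ico _ _), sum_const,
        Nat.card_Ico]
      congr 2
      simp
      omega
    have hlead := prod_one_sub_zpow_inv hX (K + e) (Ico (M r) (M (r + 1)))
    have hIco : #(Ico (M r) (M (r + 1))) = d + 1 := by rw [Nat.card_Ico]; omega
    have hMd : M (r + 1) - M r = d + 1 := by omega
    rw [hIco] at hlead
    simp only [leadFactor, blockProduct, prod_range_succ, ← hK, hK', hMd] at ih hpow hchain ⊢
    rw [hpow, hchain, hlead, stateWeight_inv, stateWeight_add hX Y K e (M r)]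
    have hMr' : M (r + 1) = M r + (d + 1) := by omega
    rw [← hMr', hcard, hS]
    have hw := stateWeight_ne_zero (n := n) hX hY K (M r)
    set w := stateWeight n X Y K (M r)
    set w' := stateWeight n X Y (K + e) (M (r + 1))
    set s := ∑ j ∈ range (M r), ((j : ℤ) + 1)
    set s' := ∑ j ∈ Ico (M r) (M (r + 1)), (j : ℤ)
    have hexp : X ^ ((M (r + 1) : ℤ) * ((K + e : ℕ) : ℤ) - (s + s' + (d + 1 : ℕ))) =
        X ^ ((M r : ℤ) * K - s) * X ^ ((M r : ℤ) * e) *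
          X ^ (((d + 1 : ℕ) : ℤ) * ((K + e : ℕ) : ℤ) - s') * X⁻¹ ^ (d + 1) := by
      rw [← zpow_natCast X⁻¹, inv_zpow', ← zpow_add₀ hX, ← zpow_add₀ hX, ← zpow_add₀ hX, hMr']
      congr 1
      push_cast
      ring
    have hsign : (-1 : F) ^ (#(blocksBelow b r) + #(blockAt b r) + M (r + 1)) =
        (-1) ^ (#(blocksBelow b r) + M r) * (-1) ^ #(blockAt b r) * (-1) ^ (d + 1) := by
      rw [hMr']
      ring
    rw [hexp, hsign, mul_add 2 K e, pow_add Y]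
    generalize X ^ ((M r : ℤ) * K - s) = x₁ at ih ⊢
    generalize X ^ ((M r : ℤ) * e) = x₂
    generalize X ^ (((d + 1 : ℕ) : ℤ) * ((K + e : ℕ) : ℤ) - s') = x₃
    generalize X⁻¹ ^ (d + 1) = x₄
    have hw1 : w⁻¹ * w = 1 := inv_mul_cancel₀ hw
    have aux : ∀ P' B' P B Q H₁ H₂ s₁ s₂ s₃ y₁ y₂ : F, P' * B' = s₁ * w * x₁ * y₁ * (P * B) →
        P' * (s₃ * x₃ * Q) * (B' * (w⁻¹ * (s₂ * (w * x₂ * y₂ * H₁)) * (x₄ * (w' * H₂)))) =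
          s₁ * s₂ * s₃ * w' * (x₁ * x₂ * x₃ * x₄) * (y₁ * y₂) * (P * Q * (B * (w * H₁ * H₂))) := by
      intro P' B' P B Q H₁ H₂ s₁ s₂ s₃ y₁ y₂ h
      linear_combination (s₃ * x₃ * Q * s₂ * x₂ * y₂ * H₁ * x₄ * w' * H₂) * h +
        (s₃ * x₃ * Q * s₂ * x₂ * y₂ * H₁ * x₄ * w' * H₂ * P' * B') * hw1
    exact aux _ _ _ _ _ _ _ _ _ _ _ _ ih

end Field

theorem varX_ne_zero : varX ≠ 0 := by simp [varX]

theorem varY_ne_zero : varY ≠ 0 := by simp [varY]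

theorem invVars_varX : invVars varX = varX⁻¹ := by
  rw [invVars, varX, IsFractionRing.lift_algebraMap]
  simp [invPoly, varX]

theorem invVars_varY : invVars varY = varY⁻¹ := by
  rw [invVars, varY, IsFractionRing.lift_algebraMap]
  simp [invPoly, varY]

namespace FracRep

theorem eq_one {F : ℕ → FracSeries} (h : FracRep 1 F) {p : ℕ} (hp : p.Prime) : F p = 1 := by
  obtain ⟨N, Q, hW, h⟩ := h
  have hQ := ne_zero_of_specialise fun p hp => (h p hp).1
  have hNQ : N = Q := by
    rw [eq_div_iff hQ, one_mul] at hW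
    exact (IsFractionRing.injective (MvPolynomial (Fin 2) ℚ) RatXY hW).symm
  have h1 := (h p hp).2
  rw [hNQ] at h1
  have h2 : toFrac (specialise p Q) ≠ 0 := fun h0 =>
    (h p hp).1 (toFrac_injective (by rw [h0, map_zero]))
  exact mul_left_cancel₀ h2 (by rw [h1, mul_one])

instance : CharZero FracSeries :=
  charZero_of_injective_ringHom (toFrac.comp (C (R := ℚ))).injective

theorem natCast_ne_zero {p : ℕ} (hp : p.Prime) : (p : FracSeries) ≠ 0 :=
  Nat.cast_ne_zero.2 hp.ne_zero

theorem pow_ne_one {p : ℕ} (hp : p.Prime) (i : ℕ) : (p : FracSeries) ^ (i + 1) ≠ 1 := by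
  have : p ^ (i + 1) ≠ 1 := (Nat.one_lt_pow (Nat.succ_ne_zero i) hp.one_lt).ne'
  exact_mod_cast this

theorem stateWeight (k m : ℕ) : FracRep (HeisenbergDyck.stateWeight n HeisenbergDyck.varX
    HeisenbergDyck.varY k m) fun p =>
      HeisenbergDyck.stateWeight n (p : FracSeries) (toFrac PowerSeries.X) k m :=
  (varX.zpow (fun _ hp => natCast_ne_zero hp) _).mul (varY.pow _)

theorem qFactInv (c : ℕ) : FracRep (HeisenbergDyck.qFactInv HeisenbergDyck.varX⁻¹ c) fun p =>
    HeisenbergDyck.qFactInv (p : FracSeries)⁻¹ c := by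
  refine prod _ fun i _ => FracRep.inv (one.sub ((varX.inv fun _ hp => natCast_ne_zero hp).pow _))
    fun p hp h => pow_ne_one hp i ?_
  rw [sub_eq_zero, inv_pow, eq_comm, inv_eq_one] at h
  exact h

theorem leadFactor (f b : Fin g → ℕ) (M : ℕ → ℕ) (r : ℕ) :
    FracRep (HeisenbergDyck.leadFactor f b M HeisenbergDyck.varX r) fun p =>
      HeisenbergDyck.leadFactor f b M (p : FracSeries) r :=
  prod _ fun _ _ => prod _ fun _ _ => one.sub (varX.zpow (fun _ hp => natCast_ne_zero hp) _)

theorem blockProduct {f b : Fin g → ℕ} (hf : ∀ a, 0 < f a) (M : ℕ → ℕ) (r : ℕ) :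
    FracRep (HeisenbergDyck.blockProduct f n b M HeisenbergDyck.varX HeisenbergDyck.varY r) fun p =>
      HeisenbergDyck.blockProduct f n b M (p : FracSeries) (toFrac PowerSeries.X) r := by
  refine prod _ fun i _ => ((stateWeight _ _).mul ?_).mul ?_
  · refine chainSumLE (fun _ _ => one) (fun _ _ _ => stateWeight _ _)
      fun T _ hT p _ => stateWeight_ne_one p _ _ ?_
    obtain ⟨a₁, ha₁⟩ := nonempty_iff_ne_empty.2 hT
    have h1 : f a₁ ≤ ∑ a ∈ T, f a := single_le_sum (fun _ _ => Nat.zero_le _) ha₁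
    have := hf a₁
    omega
  · refine chainSumLE (fun _ _ => qFactInv _) (fun _ _ _ => stateWeight _ _)
      fun k _ hk p _ => stateWeight_ne_one p _ _ ?_
    have : k ≠ 0 := hk
    omega

end FracRep

/-- The functional equation, for the data that belong to a Dyck word of length `2 * n` and a
compatible set partition. -/
theorem invVars_leadFactor_mul_blockProduct {f b : Fin g → ℕ} {M : ℕ → ℕ} (hf : ∀ a, 0 < f a)
    (hn : ∑ a, f a = n) (hM : StrictMono M) (hM0 : M 0 = 0) {r : ℕ}
    (hb : ∀ i < r, ∃ a, b a = i) (hbr : ∀ a, b a < r) (hMr : M r = n) :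
    invVars (leadFactor f b M varX r * blockProduct f n b M varX varY r) =
      (-1) ^ (g + n) * varX ^ ((5 * n ^ 2 - n) / 2) * varY ^ (5 * n) *
        (leadFactor f b M varX r * blockProduct f n b M varX varY r) := by
  have hall : blocksBelow b r = univ := by
    ext a
    simp [blocksBelow, hbr a]
  rw [map_mul, map_leadFactor, map_blockProduct, invVars_varX, invVars_varY,
    leadFactor_mul_blockProduct_inv varX_ne_zero varY_ne_zero ?_ ?_ hf hM hM0 hb, hall, hn, hMr,
    card_univ, Fintype.card_fin]
  · congr 1
    have hexp : (((5 * n ^ 2 - n) / 2 : ℕ) : ℤ) = (n * ((n : ℤ) - n) + 2 * n * n) +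
        (n * n - ∑ j ∈ range n, ((j : ℤ) + 1)) := by
      have h1 : ∀ k : ℕ, 2 * ∑ j ∈ range k, ((j : ℤ) + 1) = k * (k + 1) := by
        intro k
        induction k with
        | zero => simp
        | succ k ih => rw [sum_range_succ, mul_add, ih]; push_cast; ring
      have h2 := h1 n
      have h3 : n ≤ 5 * n ^ 2 := by nlinarith
      have h4 : ((5 * n ^ 2 - n : ℕ) : ℤ) = 2 * (3 * (n : ℤ) ^ 2 -
          ∑ j ∈ range n, ((j : ℤ) + 1)) := by
        push_cast [h3]
        linear_combination h2
      push_cast at h4 ⊢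
      rw [h4, Int.mul_ediv_cancel_left _ two_ne_zero]
      ring
    rw [← zpow_natCast varX, hexp, zpow_add₀ varX_ne_zero, stateWeight]
    ring
  · intro i h
    have h1 : FracRep 1 fun p => (p : FracSeries) ^ (i + 1) := by
      rw [← h]
      exact FracRep.varX.pow _
    exact FracRep.pow_ne_one Nat.prime_two i (h1.eq_one Nat.prime_two)
  · intro k m hkm h
    have h1 := FracRep.stateWeight (n := n) k m
    rw [h] at h1
    exact stateWeight_ne_one 2 k m hkm (h1.eq_one Nat.prime_two)

/-! ### The block form of a Dyck word -/

theorem replicate_append_inj {α : Type*} {u : α} {a a' : ℕ} {l l' : List α}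
    (hl : l.head? ≠ some u) (hl' : l'.head? ≠ some u)
    (h : List.replicate a u ++ l = List.replicate a' u ++ l') : a = a' ∧ l = l' := by
  induction a generalizing a' with
  | zero =>
    cases a' with
    | zero => exact ⟨rfl, by simpa using h⟩
    | succ a' =>
      rw [List.replicate_zero, List.nil_append] at h
      exact absurd (by rw [h]; rfl) hl
  | succ a ih =>
    cases a' with
    | zero =>
      rw [List.replicate_zero, List.nil_append] at h
      exact absurd (by rw [← h]; rfl) hl'
    | succ a' =>
      rw [List.replicate_succ, List.replicate_succ, List.cons_append, List.cons_append,
        List.cons.injEq] at h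
      obtain ⟨h1, h2⟩ := ih h.2
      exact ⟨by rw [h1], h2⟩

/-- The word with the given block lengths. -/
def blockWord (l : List (ℕ × ℕ)) : List DyckStep :=
  (l.map fun q => List.replicate q.1 DyckStep.U ++ List.replicate q.2 DyckStep.D).flatten

theorem blockWord_cons (q : ℕ × ℕ) (l : List (ℕ × ℕ)) : blockWord (q :: l) =
    List.replicate q.1 DyckStep.U ++ (List.replicate q.2 DyckStep.D ++ blockWord l) := by
  simp [blockWord]

theorem head_replicate_append {α : Type*} {u : α} {a : ℕ} (ha : 0 < a) (l : List α) :
    (List.replicate a u ++ l).head? = some u := by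
  obtain ⟨a, rfl⟩ := Nat.exists_eq_succ_of_ne_zero ha.ne'
  rfl

theorem head_blockWord_ne {l : List (ℕ × ℕ)} (hl : ∀ q ∈ l, 0 < q.1 ∧ 0 < q.2) :
    (blockWord l).head? ≠ some DyckStep.D := by
  cases l with
  | nil => simp [blockWord]
  | cons q l =>
    rw [blockWord_cons, head_replicate_append (hl q List.mem_cons_self).1]
    simp

theorem blockWord_injOn {l l' : List (ℕ × ℕ)} (hl : ∀ q ∈ l, 0 < q.1 ∧ 0 < q.2)
    (hl' : ∀ q ∈ l', 0 < q.1 ∧ 0 < q.2) (h : blockWord l = blockWord l') : l = l' := by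
  induction l generalizing l' with
  | nil =>
    cases l' with
    | nil => rfl
    | cons q l' =>
      have h1 := congrArg List.head? h
      rw [blockWord_cons, head_replicate_append (hl' q List.mem_cons_self).1] at h1
      simp [blockWord] at h1
  | cons q l ih =>
    cases l' with
    | nil =>
      have h1 := congrArg List.head? h
      rw [blockWord_cons, head_replicate_append (hl q List.mem_cons_self).1] at h1
      simp [blockWord] at h1
    | cons q' l' =>
      have hq := hl q List.mem_cons_self
      have hq' := hl' q' List.mem_cons_self
      have hl := fun q hq => hl q (List.mem_cons_of_mem _ hq)
      have hl' := fun q hq => hl' q (List.mem_cons_of_mem _ hq)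
      rw [blockWord_cons, blockWord_cons] at h
      obtain ⟨h1, h2⟩ := replicate_append_inj (by rw [head_replicate_append hq.2]; simp)
        (by rw [head_replicate_append hq'.2]; simp) h
      obtain ⟨h3, h4⟩ := replicate_append_inj (head_blockWord_ne hl) (head_blockWord_ne hl') h2
      rw [ih hl hl' h4, Prod.ext h1 h3]

theorem IsBlockForm.toList_eq {w : DyckWord} {r : ℕ} {L M : Fin (r + 1) → ℕ}
    (h : IsBlockForm w L M) : w.toList = blockWord (List.ofFn fun i : Fin r =>
      (L i.succ - L i.castSucc, M i.succ - M i.castSucc)) := by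
  rw [h.2.2.2.2, blockWord, List.map_ofFn]
  rfl

theorem IsBlockForm.pos {w : DyckWord} {r : ℕ} {L M : Fin (r + 1) → ℕ} (h : IsBlockForm w L M) :
    ∀ q ∈ List.ofFn fun i : Fin r => (L i.succ - L i.castSucc, M i.succ - M i.castSucc),
      0 < q.1 ∧ 0 < q.2 := by
  intro q hq
  obtain ⟨i, rfl⟩ := (List.mem_ofFn' _ _).1 hq
  exact ⟨Nat.sub_pos_of_lt (h.2.2.1 i.castSucc_lt_succ),
    Nat.sub_pos_of_lt (h.2.2.2.1 i.castSucc_lt_succ)⟩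

theorem eq_of_sub_eq_sub {r : ℕ} {L L' : Fin (r + 1) → ℕ} (h0 : L 0 = 0) (h0' : L' 0 = 0)
    (hL : StrictMono L) (hL' : StrictMono L')
    (h : ∀ i : Fin r, L i.succ - L i.castSucc = L' i.succ - L' i.castSucc) : L = L' := by
  funext i
  induction i using Fin.induction with
  | zero => rw [h0, h0']
  | succ i ih =>
    have h1 := hL i.castSucc_lt_succ
    have h2 := hL' i.castSucc_lt_succ
    have := h i
    omega

/-- The block form of a Dyck word is unique. -/
theorem IsBlockForm.unique {w : DyckWord} {r r' : ℕ} {L M : Fin (r + 1) → ℕ}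
    {L' M' : Fin (r' + 1) → ℕ} (h : IsBlockForm w L M) (h' : IsBlockForm w L' M') :
    ∃ e : r' = r, (∀ i, L i = L' (i.cast (by rw [e]))) ∧ ∀ i, M i = M' (i.cast (by rw [e])) := by
  have h1 := blockWord_injOn h.pos h'.pos (h.toList_eq.symm.trans h'.toList_eq)
  have h2 := congrArg List.length h1
  rw [List.length_ofFn, List.length_ofFn] at h2
  subst h2
  have h3 := fun i => congrFun (List.ofFn_injective h1) i
  simp only [Prod.mk.injEq] at h3
  refine ⟨rfl, fun i => ?_, fun i => ?_⟩
  · rw [eq_of_sub_eq_sub h.1 h'.1 h.2.2.1 h'.2.2.1 fun i => (h3 i).1]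
    rfl
  · rw [eq_of_sub_eq_sub h.2.1 h'.2.1 h.2.2.2.1 h'.2.2.2.1 fun i => (h3 i).2]
    rfl

/-- A strictly monotone extension of `L` to all natural numbers. -/
def natExtend {r : ℕ} (L : Fin (r + 1) → ℕ) (k : ℕ) : ℕ :=
  if h : k < r + 1 then L ⟨k, h⟩ else L (Fin.last r) + k

theorem natExtend_val {r : ℕ} (L : Fin (r + 1) → ℕ) (i : Fin (r + 1)) : natExtend L i = L i := by
  rw [natExtend, dif_pos i.2]

theorem strictMono_natExtend {r : ℕ} {L : Fin (r + 1) → ℕ} (hL : StrictMono L) :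
    StrictMono (natExtend L) := by
  refine strictMono_nat_of_lt_succ fun k => ?_
  rw [natExtend, natExtend]
  split_ifs with h1 h2 h2
  · exact hL (Nat.lt_succ_self k)
  · exact Nat.lt_add_right_iff_pos.2 (Nat.succ_pos k) |>.trans_le'
      (hL.monotone (Fin.le_last _))
  · omega
  · omega

theorem count_blockWord_range (L M : ℕ → ℕ) (hL : Monotone L) (hM : Monotone M) (hL0 : L 0 = 0)
    (hM0 : M 0 = 0) (k : ℕ) :
    (blockWord ((List.range k).map fun i => (L (i + 1) - L i, M (i + 1) - M i))).count .U = L k ∧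
      (blockWord ((List.range k).map fun i => (L (i + 1) - L i, M (i + 1) - M i))).count .D =
        M k := by
  induction k with
  | zero => simp [blockWord, hL0, hM0]
  | succ k ih =>
    have h1 : L k ≤ L (k + 1) := hL (Nat.le_succ k)
    have h2 : M k ≤ M (k + 1) := hM (Nat.le_succ k)
    simp only [blockWord, List.range_succ, List.map_append, List.flatten_append, List.count_append,
      List.map_cons, List.map_nil, List.flatten_cons, List.flatten_nil, List.append_nil,
      List.count_replicate] at ih ⊢
    rw [ih.1, ih.2]
    simp
    omega

theorem blockWord_range_prefix (F : ℕ → ℕ × ℕ) {k r : ℕ} (h : k ≤ r) :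
    blockWord ((List.range k).map F) <+: blockWord ((List.range r).map F) := by
  induction r, h using Nat.le_induction with
  | base => exact List.prefix_rfl
  | succ r _ ih =>
    refine ih.trans ?_
    simp only [blockWord, List.range_succ, List.map_append, List.flatten_append]
    exact List.prefix_append _ _

theorem IsBlockForm.natExtend_spec {w : DyckWord} {r : ℕ} {L M : Fin (r + 1) → ℕ}
    (h : IsBlockForm w L M) : natExtend L r = w.semilength ∧ natExtend M r = w.semilength ∧
      ∀ k ≤ r, natExtend M k ≤ natExtend L k := by
  have hL0 : natExtend L 0 = 0 := (natExtend_val L 0).trans h.1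
  have hM0 : natExtend M 0 = 0 := (natExtend_val M 0).trans h.2.1
  have hc := count_blockWord_range _ _ (strictMono_natExtend h.2.2.1).monotone
    (strictMono_natExtend h.2.2.2.1).monotone hL0 hM0
  set F : ℕ → ℕ × ℕ := fun i =>
    (natExtend L (i + 1) - natExtend L i, natExtend M (i + 1) - natExtend M i) with hF
  have hw : w.toList = blockWord ((List.range r).map F) := by
    rw [h.toList_eq, ← List.map_coe_finRange_eq_range, List.map_map, ← List.ofFn_eq_map]
    congr 2
    funext i
    have e1 := natExtend_val L i.succ
    have e2 := natExtend_val L i.castSucc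
    have e3 := natExtend_val M i.succ
    have e4 := natExtend_val M i.castSucc
    simp only [Fin.val_succ, Fin.val_castSucc] at e1 e2 e3 e4
    simp only [hF, Function.comp, e1, e2, e3, e4]
  refine ⟨?_, ?_, fun k hk => ?_⟩
  · rw [DyckWord.semilength, hw, (hc r).1]
  · rw [DyckWord.semilength, w.count_U_eq_count_D, hw, (hc r).2]
  · rw [← (hc k).1, ← (hc k).2]
    have hp := blockWord_range_prefix F hk
    rw [← hw, List.prefix_iff_eq_take] at hp
    rw [hp]
    exact w.count_D_le_count_U _

/-! ### The number of subgroups for a configuration -/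

theorem sum_min_succ {n : ℕ} (l : Fin n → ℕ) (c : ℕ) :
    ∑ i, min (l i) (c + 1) = ∑ i, min (l i) c + #{i | c + 1 ≤ l i} := by
  rw [card_filter, ← sum_add_distrib]
  refine sum_congr rfl fun i _ => ?_
  split_ifs with h
  · rw [min_eq_right h, min_eq_right (by omega)]
  · rw [min_eq_left (by omega), min_eq_left (by omega), add_zero]

/-- The entries equal to zero are included on the right hand side, at the price of a factor that
does not depend on `l`. -/
theorem injCount_mul {n p : ℕ} (hp : p.Prime) (l μ : Fin n → ℕ) :
    injCount p l μ * ∏ j : Fin n with μ j = 0, (1 - (p : ℚ) ^ ((j : ℤ) - n)) =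
      ∏ j, (p : ℚ) ^ (∑ i, min (l i) (μ j)) *
        (1 - (p : ℚ) ^ ((j : ℤ) - (#{i | μ j ≤ l i} : ℕ))) := by
  have hp0 : (p : ℚ) ≠ 0 := Nat.cast_ne_zero.2 hp.ne_zero
  rw [injCount, prod_filter, ← prod_mul_distrib]
  refine prod_congr rfl fun j _ => ?_
  by_cases h0 : μ j = 0
  · simp [h0]
  · obtain ⟨c, hc⟩ := Nat.exists_eq_succ_of_ne_zero h0
    rw [if_neg h0, if_neg h0, hc, Nat.succ_sub_one, Nat.succ_eq_add_one, sum_min_succ, mul_one,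
      mul_sub, mul_one, ← zpow_natCast (p : ℚ), ← zpow_natCast (p : ℚ), ← zpow_add₀ hp0]
    congr 2
    push_cast
    ring

theorem one_sub_zpow_ne_zero {p : ℕ} (hp : p.Prime) {k : ℤ} (hk : k < 0) :
    1 - (p : ℚ) ^ k ≠ 0 :=
  sub_ne_zero.2 (zpow_lt_one_of_neg₀ (by exact_mod_cast hp.one_lt) hk).ne'

theorem card_le_eq_add_tieCount {μ : Fin n → ℕ} (hμ : Antitone μ) (j : Fin n) :
    #{i | μ j ≤ μ i} = j + tieCount n μ j := by
  rw [tieCount, ← Fin.card_Iio j, ← card_union_of_disjoint]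
  · congr 1
    ext i
    simp only [mem_filter, mem_univ, true_and, mem_union, mem_Iio, i.2]
    constructor
    · intro h
      rcases lt_or_ge i j with h1 | h1
      · exact Or.inl h1
      · exact Or.inr ⟨h1, le_antisymm (hμ h1) h⟩
    · rintro (h | h)
      · exact hμ h.le
      · exact h.2.ge
  · rw [disjoint_left]
    intro i hi hi'
    exact absurd (mem_filter.1 hi').2.1 (not_le.2 (mem_Iio.1 hi))

/-- Birkhoff's formula for the number of subgroups of type `μ` in a group of type `l`. -/
theorem alpha_eq {p : ℕ} (hp : p.Prime) (l : Fin n → ℕ) {μ : Fin n → ℕ} (hμ : Antitone μ) :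
    (alpha l μ p : ℚ) = (∏ j : Fin n, (1 - (p : ℚ) ^ ((j : ℤ) - (#{i | μ j ≤ l i} : ℕ)))) *
      (p : ℚ) ^ ((∑ j, ∑ i, (min (l i) (μ j) : ℕ) : ℤ) - ∑ j, ∑ i, (min (μ i) (μ j) : ℕ)) *
        tieFactor p n μ := by
  have hp0 : (p : ℚ) ≠ 0 := Nat.cast_ne_zero.2 hp.ne_zero
  set Z := ∏ j : Fin n with μ j = 0, (1 - (p : ℚ) ^ ((j : ℤ) - n)) with hZ
  have hZ0 : Z ≠ 0 := prod_ne_zero_iff.2 fun j _ =>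
    one_sub_zpow_ne_zero hp (by have := j.2; omega)
  have hT : tieFactor p n μ * ∏ j : Fin n, (1 - (p : ℚ) ^ ((j : ℤ) - (#{i | μ j ≤ μ i} : ℕ))) =
      1 := by
    rw [tieFactor, filter_true_of_mem (fun j _ => j.2), ← prod_mul_distrib]
    refine prod_eq_one fun j _ => ?_
    have hpos : 0 < tieCount n μ j := card_pos.2 ⟨j, by simp⟩
    rw [card_le_eq_add_tieCount hμ, Nat.cast_add, sub_add_cancel_left, zpow_neg, zpow_natCast,
      ← inv_pow]
    refine inv_mul_cancel₀ ?_
    have := one_sub_zpow_ne_zero hp (k := -(tieCount n μ j : ℤ)) (by omega)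
    rwa [zpow_neg, zpow_natCast, ← inv_pow] at this
  have h1 := injCount_mul hp l μ
  have h2 := injCount_mul hp μ μ
  have h3 := alpha_mul_injCount hp l hμ
  rw [prod_mul_distrib, prod_pow_eq_pow_sum, ← hZ] at h1 h2
  have hQ0 := right_ne_zero_of_mul (hT ▸ one_ne_zero : _ ≠ (0 : ℚ))
  set Q := ∏ j : Fin n, (1 - (p : ℚ) ^ ((j : ℤ) - (#{i | μ j ≤ μ i} : ℕ)))
  set N := ∏ j : Fin n, (1 - (p : ℚ) ^ ((j : ℤ) - (#{i | μ j ≤ l i} : ℕ)))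
  have e : (p : ℚ) ^ ((∑ j, ∑ i, (min (l i) (μ j) : ℕ) : ℤ) - ∑ j, ∑ i, (min (μ i) (μ j) : ℕ)) *
      (p : ℚ) ^ (∑ j, ∑ i, min (μ i) (μ j)) = (p : ℚ) ^ (∑ j, ∑ i, min (l i) (μ j)) := by
    rw [← zpow_natCast (p : ℚ), ← zpow_natCast (p : ℚ), ← zpow_add₀ hp0]
    congr 1
    push_cast
    ring
  have hne : (p : ℚ) ^ (∑ j, ∑ i, min (μ i) (μ j)) * Q ≠ 0 := mul_ne_zero (pow_ne_zero _ hp0) hQ0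
  refine mul_right_cancel₀ hne ?_
  generalize (p : ℚ) ^ ((∑ j, ∑ i, (min (l i) (μ j) : ℕ) : ℤ) -
    ∑ j, ∑ i, (min (μ i) (μ j) : ℕ)) = E at e ⊢
  linear_combination -(alpha l μ p : ℚ) * h2 + Z * h3 + h1 - N * e -
    N * E * (p : ℚ) ^ (∑ j, ∑ i, min (μ i) (μ j)) * hT

/-! ### Admissible tuples and their block values -/

/-- The block `a` with `C_a ≤ k < C_{a+1}`. -/
def blockOf (f : Fin g → ℕ) (hn : ∑ a, f a = n) (k : Fin n) : Fin g :=
  (finSigmaFinEquiv.symm (Fin.cast hn.symm k)).1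

theorem sum_blockOf {A : Type*} [AddCommMonoid A] (f : Fin g → ℕ) (hn : ∑ a, f a = n)
    (h : Fin g → A) : ∑ k, h (blockOf f hn k) = ∑ a, f a • h a := by
  subst hn
  have h1 := Equiv.sum_comp (finSigmaFinEquiv (n := f)).symm fun q => h q.1
  refine Eq.trans h1 ?_
  rw [Fintype.sum_sigma]
  simp

theorem partialSum_succ (f : Fin g → ℕ) (a : Fin g) :
    partialSum f (a + 1) = partialSum f a + f a := by
  have : (univ.filter fun j : Fin g => (j : ℕ) < a + 1) =
      insert a (univ.filter fun j : Fin g => (j : ℕ) < a) := by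
    ext j
    simp only [mem_filter, mem_univ, true_and, mem_insert, Fin.ext_iff]
    omega
  rw [partialSum, this, sum_insert (by simp), add_comm, partialSum]

theorem partialSum_mono (f : Fin g → ℕ) : Monotone (partialSum f) := by
  intro k l h
  refine sum_le_sum_of_subset fun j hj => ?_
  simp only [mem_filter, mem_univ, true_and] at hj ⊢
  omega

theorem partialSum_eq_sum_castLE (f : Fin g → ℕ) (a : Fin g) :
    partialSum f a = ∑ i : Fin a, f (Fin.castLE a.2.le i) := by
  symm
  refine sum_bij (fun i _ => Fin.castLE a.2.le i) ?_ ?_ ?_ ?_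
  · intro i _
    exact mem_filter.2 ⟨mem_univ _, i.2⟩
  · intro i _ j _ h
    exact Fin.castLE_injective _ h
  · intro j hj
    exact ⟨⟨j, (mem_filter.1 hj).2⟩, mem_univ _, rfl⟩
  · intro i _
    rfl

theorem partialSum_blockOf (f : Fin g → ℕ) (hn : ∑ a, f a = n) (k : Fin n) :
    partialSum f (blockOf f hn k) ≤ k ∧ (k : ℕ) < partialSum f (blockOf f hn k + 1) := by
  have h := finSigmaFinEquiv_apply (finSigmaFinEquiv.symm (Fin.cast hn.symm k))
  rw [Equiv.apply_symm_apply, Fin.val_cast, ← partialSum_eq_sum_castLE] at h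
  rw [partialSum_succ, blockOf, h]
  have := (finSigmaFinEquiv.symm (Fin.cast hn.symm k)).2.2
  omega

theorem blockOf_eq {f : Fin g → ℕ} (hn : ∑ a, f a = n) {k : Fin n} {a : Fin g}
    (h1 : partialSum f a ≤ k) (h2 : (k : ℕ) < partialSum f (a + 1)) : blockOf f hn k = a := by
  obtain ⟨h3, h4⟩ := partialSum_blockOf f hn k
  rcases lt_trichotomy (blockOf f hn k) a with h | h | h
  · have := partialSum_mono f (show (blockOf f hn k : ℕ) + 1 ≤ a from h)
    omega
  · exact h
  · have := partialSum_mono f (show (a : ℕ) + 1 ≤ blockOf f hn k from h)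
    omega

theorem isAdmissible_comp_blockOf (f : Fin g → ℕ) (hn : ∑ a, f a = n) (x : Fin g → ℕ) :
    IsAdmissible f (x ∘ blockOf f hn) := by
  intro i j k h1 h2 h3 h4
  rw [Function.comp, Function.comp, blockOf_eq hn h1 h2, blockOf_eq hn h3 h4]

/-- The last index of a block. -/
theorem partialSum_sub_one {f : Fin g → ℕ} (hf : ∀ a, 0 < f a) (hn : ∑ a, f a = n) (a : Fin g) :
    partialSum f a ≤ partialSum f (a + 1) - 1 ∧ partialSum f (a + 1) - 1 < partialSum f (a + 1) ∧
      partialSum f (a + 1) - 1 < n := by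
  have h1 := partialSum_succ f a
  have h2 := hf a
  have h3 : partialSum f (a + 1) ≤ n := by
    rw [← hn]
    exact sum_le_sum_of_subset (filter_subset _ _)
  omega

theorem blockValues_comp_blockOf {f : Fin g → ℕ} (hf : ∀ a, 0 < f a) (hn : ∑ a, f a = n)
    (x : Fin g → ℕ) : blockValues f (x ∘ blockOf f hn) = x := by
  funext a
  obtain ⟨h1, h2, h3⟩ := partialSum_sub_one hf hn a
  rw [blockValues, dif_pos h3, Function.comp, blockOf_eq hn h1 h2]

theorem IsAdmissible.eq_comp_blockOf {f : Fin g → ℕ} (hf : ∀ a, 0 < f a) (hn : ∑ a, f a = n)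
    {l : Fin n → ℕ} (hl : IsAdmissible f l) : l = blockValues f l ∘ blockOf f hn := by
  funext k
  obtain ⟨h1, h2⟩ := partialSum_blockOf f hn k
  obtain ⟨h3, h4, h5⟩ := partialSum_sub_one hf hn (blockOf f hn k)
  rw [Function.comp, blockValues, dif_pos h5]
  exact hl _ k _ h1 h2 h3 h4

theorem antitone_sortDesc (l : Fin n → ℕ) : Antitone (sortDesc l) := by
  intro i j h
  exact Tuple.monotone_sort l (Fin.rev_le_rev.2 h)

theorem sum_sortDesc {A : Type*} [AddCommMonoid A] (l : Fin n → ℕ) (h : ℕ → A) :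
    ∑ i, h (sortDesc l i) = ∑ i, h (l i) :=
  Equiv.sum_comp (Fin.revPerm.trans (Tuple.sort l)) fun i => h (l i)

theorem card_le_sortDesc (f : Fin g → ℕ) (hn : ∑ a, f a = n) (x : Fin g → ℕ) (c : ℕ) :
    #{i | c ≤ sortDesc (x ∘ blockOf f hn) i} = ∑ a with c ≤ x a, f a := by
  rw [card_filter, sum_sortDesc (x ∘ blockOf f hn) fun v => if c ≤ v then 1 else 0, sum_filter]
  refine (sum_blockOf f hn fun a => if c ≤ x a then 1 else 0).trans ?_
  simp

theorem le_sortDesc_iff (f : Fin g → ℕ) (hn : ∑ a, f a = n) (x : Fin g → ℕ) (c : ℕ) (k : Fin n) :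
    c ≤ sortDesc (x ∘ blockOf f hn) k ↔ (k : ℕ) < ∑ a with c ≤ x a, f a := by
  rw [← card_le_sortDesc f hn]
  exact iff_lt_card_of_isInitial (fun i => c ≤ sortDesc (x ∘ blockOf f hn) i)
    (fun i j h hj => hj.trans (antitone_sortDesc _ h)) k

/-! ### The interleaving inequalities -/

section Valid

variable {f : Fin g → ℕ} {b : Fin g → ℕ} {L M : ℕ → ℕ} {s : ℕ}

theorem le_sum_of_mem_validConfigs (hM : StrictMono M)
    {q : Config g n} (hq : q ∈ validConfigs n b M s univ n) {i : ℕ} {j : Fin n}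
    (hij : M i ≤ j) :
    ∑ a ∈ blocksBelow b (i + 1), f a ≤ ∑ a with q.2 j ≤ q.1 a, f a := by
  refine sum_le_sum_of_subset fun a ha => ?_
  simp only [blocksBelow, mem_filter, mem_univ, true_and] at ha ⊢
  exact hq.2.2.1 a j ((hM.monotone (Nat.lt_succ_iff.1 ha)).trans hij)

theorem sum_le_of_mem_validConfigs (hM : StrictMono M) (hb : ∀ a, b a < s)
    {q : Config g n} (hq : q ∈ validConfigs n b M s univ n) {i : ℕ} {j : Fin n}
    (hij : (j : ℕ) < M i) :
    ∑ a with q.2 j ≤ q.1 a, f a ≤ ∑ a ∈ blocksBelow b i, f a := by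
  refine sum_le_sum_of_subset fun a ha => ?_
  simp only [blocksBelow, mem_filter, mem_univ, true_and] at ha ⊢
  by_contra h
  exact absurd (hq.2.2.2 a j (hb a) (hij.trans_le (hM.monotone (not_lt.1 h)))) (not_lt.2 ha)

theorem exists_block (hM0 : M 0 = 0) (hMs : M s = n) (j : Fin n) :
    ∃ i < s, M i ≤ j ∧ (j : ℕ) < M (i + 1) := by
  classical
  have h : ∃ i, (j : ℕ) < M i := ⟨s, by rw [hMs]; exact j.2⟩
  have h1 := Nat.find_spec h
  have h2 : Nat.find h ≤ s := Nat.find_min' h (by rw [hMs]; exact j.2)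
  obtain ⟨i, hi⟩ : ∃ i, Nat.find h = i + 1 := Nat.exists_eq_succ_of_ne_zero fun h0 => by
    rw [h0, hM0] at h1
    exact Nat.not_lt_zero _ h1
  refine ⟨i, by omega, not_lt.1 (Nat.find_min h (by omega)), hi ▸ h1⟩

theorem separated_of_mem_validConfigs (hM : StrictMono M) (hb : ∀ a, b a < s) (hMs : M s = n)
    {q : Config g n} (hq : q ∈ validConfigs n b M s univ n) {a a' : Fin g} (h : b a < b a') :
    q.1 a' < q.1 a := by
  have h1 : M (b a) < n := hMs ▸ hM (hb a)
  exact (hq.2.2.2 a' ⟨_, h1⟩ (hb a') (hM h)).trans_le (hq.2.2.1 a ⟨_, h1⟩ le_rfl)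

/-- The inequalities between the entries of `μ` and of the sorted tuple `λ` at the ends of the
blocks of the Dyck word compare `μ` with every single `x a`, if the values of `x` are separated by
`b`: the blocks with `b a < k` then account for exactly the first `L k` entries of `λ`. -/
theorem mem_validConfigs_iff (hf : ∀ a, 0 < f a) (hn : ∑ a, f a = n) (hM : StrictMono M)
    (hM0 : M 0 = 0) (hL : StrictMono L) (hL0 : L 0 = 0) (hMs : M s = n) (hLs : L s = n)
    (hb : ∀ a, b a < s) (hK : ∀ k ≤ s, ∑ a ∈ blocksBelow b k, f a = L k) (q : Config g n) :
    q ∈ validConfigs n b M s univ n ↔ Antitone q.2 ∧ (∀ a a', b a < b a' → q.1 a' < q.1 a) ∧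
      (∀ i < s, ∀ α β : Fin n, (α : ℕ) + 1 = L (i + 1) → (β : ℕ) = M i →
        q.2 β ≤ sortDesc (q.1 ∘ blockOf f hn) α) ∧
      ∀ i, 0 < i → i < s → ∀ α β : Fin n, (α : ℕ) = L i → (β : ℕ) + 1 = M i →
        sortDesc (q.1 ∘ blockOf f hn) α < q.2 β := by
  constructor
  · intro hq
    refine ⟨hq.2.1, fun a a' h => separated_of_mem_validConfigs hM hb hMs hq h,
      fun i hi α β hα hβ => ?_, fun i hi0 hi α β hα hβ => ?_⟩
    · rw [le_sortDesc_iff]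
      have := le_sum_of_mem_validConfigs (f := f) hM hq (hβ.ge : M i ≤ β)
      rw [hK (i + 1) hi] at this
      omega
    · rw [← not_le, le_sortDesc_iff]
      have := sum_le_of_mem_validConfigs (f := f) hM hb hq (show (β : ℕ) < M i by omega)
      rw [hK i hi.le] at this
      omega
  · rintro ⟨hanti, hsep, h1, h2⟩
    refine ⟨⟨fun a ha => absurd (mem_univ a) ha, fun j hj => absurd j.2 (not_lt.2 hj)⟩, hanti,
      fun a j hj => ?_, fun a j ha hj => ?_⟩
    · have hβ : M (b a) < n := hMs ▸ hM (hb a)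
      have hα : 0 < L (b a + 1) := hL0 ▸ hL (Nat.succ_pos _)
      have hα' : L (b a + 1) ≤ n := hLs ▸ hL.monotone (hb a)
      have h3 := h1 (b a) (hb a) ⟨L (b a + 1) - 1, by omega⟩ ⟨M (b a), hβ⟩
        (Nat.sub_add_cancel hα) rfl
      refine (hanti (show (⟨M (b a), hβ⟩ : Fin n) ≤ j from hj)).trans ?_
      rw [le_sortDesc_iff] at h3
      by_contra h4
      have h5 : (univ.filter fun a' => q.2 ⟨M (b a), hβ⟩ ≤ q.1 a') ⊆
          (blocksBelow b (b a + 1)).erase a := by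
        intro a' ha'
        simp only [blocksBelow, mem_erase, mem_filter, mem_univ, true_and] at ha' ⊢
        refine ⟨fun h => h4 (h ▸ ha'), ?_⟩
        by_contra h6
        exact h4 (ha'.trans (hsep a a' (by omega)).le)
      have h6 := sum_le_sum_of_subset (f := f) h5
      have h7 := add_sum_erase (blocksBelow b (b a + 1)) f (show a ∈ _ by simp [blocksBelow])
      have := hf a
      rw [hK (b a + 1) (hb a)] at h7
      simp only at h3
      omega
    · have hMn : M (b a) < n := hMs ▸ hM ha
      have hLn : L (b a) < n := hLs ▸ hL ha
      have hba : 0 < b a := Nat.pos_of_ne_zero fun h0 => by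
        rw [h0, hM0] at hj
        exact Nat.not_lt_zero _ hj
      have hMpos : 0 < M (b a) := hM0 ▸ hM hba
      set β : Fin n := ⟨M (b a) - 1, by omega⟩ with hβ
      have h3 := h2 (b a) hba ha ⟨L (b a), hLn⟩ β rfl (Nat.sub_add_cancel hMpos)
      rw [← not_le, le_sortDesc_iff, not_lt] at h3
      have hjβ : j ≤ β := by
        rw [Fin.le_def]
        exact Nat.le_sub_one_of_lt hj
      refine lt_of_lt_of_le ?_ (hanti hjβ)
      by_contra h4
      have h4 := not_lt.1 h4
      have ha' : a ∉ blocksBelow b (b a) := by simp [blocksBelow]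
      have h5 : insert a (blocksBelow b (b a)) ⊆ univ.filter fun a' => q.2 β ≤ q.1 a' := by
        intro a' ha'
        simp only [blocksBelow, mem_insert, mem_filter, mem_univ, true_and] at ha' ⊢
        rcases ha' with rfl | h
        · exact h4
        · exact h4.trans (hsep a' a h).le
      have h6 := sum_le_sum_of_subset (f := f) h5
      rw [sum_insert ha', hK _ ha.le] at h6
      have := hf a
      simp only at h3
      omega

theorem le_sortDesc_of_mem_validConfigs (hn : ∑ a, f a = n) (hM : StrictMono M) (hM0 : M 0 = 0)
    (hMs : M s = n) (hK : ∀ k ≤ s, ∑ a ∈ blocksBelow b k, f a = L k) (hML : ∀ k ≤ s, M k ≤ L k)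
    {q : Config g n} (hq : q ∈ validConfigs n b M s univ n) :
    q.2 ≤ sortDesc (q.1 ∘ blockOf f hn) := by
  intro j
  obtain ⟨i, hi, h1, h2⟩ := exists_block hM0 hMs j
  rw [le_sortDesc_iff]
  have h3 := le_sum_of_mem_validConfigs (f := f) hM hq h1
  rw [hK (i + 1) hi] at h3
  have := hML (i + 1) hi
  omega

theorem prod_Ico_blocks {A : Type*} [CommMonoid A] (hM : Monotone M) (hM0 : M 0 = 0) (h : ℕ → A)
    (s : ℕ) : ∏ i ∈ range s, ∏ j ∈ Ico (M i) (M (i + 1)), h j = ∏ j ∈ range (M s), h j := by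
  induction s with
  | zero => simp [hM0]
  | succ s ih => rw [prod_range_succ, ih, prod_range_mul_prod_Ico _ (hM (Nat.le_succ s))]

/-- On the configurations that belong to a Dyck word, the exponents in Birkhoff's formula depend
only on the block in which an entry of `μ` lies, apart from the weight of the configuration. -/
theorem alpha_mul_pow_eq {p : ℕ} (hp : p.Prime) (hn : ∑ a, f a = n)
    (hM : StrictMono M) (hM0 : M 0 = 0) (hMs : M s = n) (hb : ∀ a, b a < s)
    {q : Config g n} (hq : q ∈ validConfigs n b M s univ n) :
    (alpha (sortDesc (q.1 ∘ blockOf f hn)) q.2 p : ℚ) * ((p : ℚ) ^ (2 * n)) ^ (∑ i, q.2 i) =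
      leadFactor f b M (p : ℚ) s * configWeight f p n q := by
  have hp0 : (p : ℚ) ≠ 0 := Nat.cast_ne_zero.2 hp.ne_zero
  have hlead : leadFactor f b M (p : ℚ) s =
      ∏ j : Fin n, (1 - (p : ℚ) ^ ((j : ℤ) -
        (#{i | q.2 j ≤ sortDesc (q.1 ∘ blockOf f hn) i} : ℕ))) := by
    set h : ℕ → ℚ := fun j => if hj : j < n then 1 - (p : ℚ) ^ ((j : ℤ) -
      (#{i | q.2 ⟨j, hj⟩ ≤ sortDesc (q.1 ∘ blockOf f hn) i} : ℕ)) else 1 with hh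
    have h1 : leadFactor f b M (p : ℚ) s = ∏ j ∈ range (M s), h j := by
      rw [← prod_Ico_blocks hM.monotone hM0, leadFactor]
      refine prod_congr rfl fun i hi => prod_congr rfl fun j hj => ?_
      obtain ⟨h1, h2⟩ := mem_Ico.1 hj
      have hi := mem_range.1 hi
      have hjn : j < n := h2.trans_le (hMs ▸ hM.monotone hi)
      have e : ∑ a ∈ blocksBelow b (i + 1), f a =
          #{i | q.2 ⟨j, hjn⟩ ≤ sortDesc (q.1 ∘ blockOf f hn) i} := by
        rw [card_le_sortDesc]
        exact (le_sum_of_mem_validConfigs hM hq (j := ⟨j, hjn⟩) h1).antisymm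
          (sum_le_of_mem_validConfigs hM hb hq (j := ⟨j, hjn⟩) h2)
      simp only [hh, dif_pos hjn, e]
    rw [h1, hMs, prod_range]
    refine prod_congr rfl fun j _ => ?_
    simp only [hh, dif_pos j.2]
  have hmin : ∀ j, ∑ i, (min (sortDesc (q.1 ∘ blockOf f hn) i) (q.2 j) : ℤ) =
      ∑ a, (f a : ℤ) * min (q.1 a : ℤ) (q.2 j) := by
    intro j
    rw [sum_sortDesc (q.1 ∘ blockOf f hn) fun v => (min v (q.2 j) : ℤ)]
    refine (sum_blockOf f hn fun a => (min (q.1 a) (q.2 j) : ℤ)).trans ?_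
    simp only [nsmul_eq_mul]
  rw [alpha_eq hp _ hq.2.1, ← hlead, configWeight, configExp]
  push_cast
  simp only [hmin]
  rw [zpow_add₀ hp0, ← pow_mul, ← zpow_natCast (p : ℚ) (2 * n * _)]
  push_cast
  ring

end Valid

/-! ### The weak ordering of a tuple -/

theorem val_mem_dropSet {x : Fin g → ℕ} {a a' : Fin g} (h : (a : ℕ) + 1 = a') :
    (a' : ℕ) ∈ dropSet x ↔ x a' < x a := by
  rw [dropSet, mem_filter, mem_Icc]
  constructor
  · rintro ⟨-, c, c', h1, h2, h3⟩
    obtain rfl : c = a := Fin.ext (by omega)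
    obtain rfl : c' = a' := Fin.ext h2
    exact h3
  · exact fun h3 => ⟨by omega, a, a', h, rfl, h3⟩

theorem exists_of_mem_dropSet {x : Fin g → ℕ} {k : ℕ} (h : k ∈ dropSet x) :
    ∃ a a' : Fin g, (a : ℕ) + 1 = k ∧ (a' : ℕ) = k ∧ x a' < x a :=
  (mem_filter.1 h).2

/-- The weak ordering of a tuple: ties are broken by the order of the indices. -/
def orderingOf (x : Fin g → ℕ) : Equiv.Perm (Fin g) × Finset ℕ :=
  (Tuple.sort (OrderDual.toDual ∘ x), dropSet (x ∘ Tuple.sort (OrderDual.toDual ∘ x)))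

/-- A weak ordering of `x` is unique: entries that are equal are adjacent and do not form a descent,
so they occur in ascending order of their indices. -/
theorem isOrderOf_iff {x : Fin g → ℕ} {v : Equiv.Perm (Fin g) × Finset ℕ} :
    IsOrderOf x v ↔ v = orderingOf x := by
  constructor
  · rintro ⟨hv, hanti, hJ⟩
    have hdes := (mem_filter.1 hv).2
    have htie : ∀ k : ℕ, ∀ i j : Fin g, (j : ℕ) = i + k + 1 → x (v.1 i) = x (v.1 j) →
        v.1 i < v.1 j := by
      intro k
      induction k with
      | zero =>
        intro i j hij h
        rcases lt_trichotomy (v.1 i) (v.1 j) with h1 | h1 | h1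
        · exact h1
        · have := v.1.injective h1
          subst this
          omega
        -- A descent of `σ` is a place where the entries drop.
        · have h2 := hdes ((val_mem_dropSet (x := fun i => (v.1 i : ℕ)) hij.symm).2 h1)
          rw [hJ, val_mem_dropSet hij.symm] at h2
          exact absurd h.symm h2.ne
      | succ k ih =>
        intro i j hij h
        have hj := j.2
        set c : Fin g := ⟨i + k + 1, by omega⟩ with hc
        have h1 : x (v.1 c) ≤ x (v.1 i) := hanti (Fin.le_def.2 (by simp only [hc]; omega))
        have h2 : x (v.1 j) ≤ x (v.1 c) := hanti (Fin.le_def.2 (by simp only [hc]; omega))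
        have h3 := ih i c rfl (by omega)
        refine h3.trans ?_
        have h4 : (j : ℕ) = c + 1 := by simp [hc]; omega
        rcases lt_trichotomy (v.1 c) (v.1 j) with h5 | h5 | h5
        · exact h5
        · have := v.1.injective h5
          rw [this] at h4
          omega
        · have h6 := hdes ((val_mem_dropSet (x := fun i => (v.1 i : ℕ)) h4.symm).2 h5)
          rw [hJ, val_mem_dropSet h4.symm] at h6
          simp only [Function.comp] at h6
          omega
    have hσ : v.1 = Tuple.sort (OrderDual.toDual ∘ x) := by
      rw [Tuple.eq_sort_iff]
      refine ⟨fun i j h => hanti h, fun i j hij h => ?_⟩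
      have := Fin.lt_def.1 hij
      exact htie (j - i - 1) i j (by omega) h
    refine Prod.ext hσ ?_
    rw [hJ, hσ, orderingOf]
  · rintro rfl
    obtain ⟨h1, h2⟩ := Tuple.eq_sort_iff (f := OrderDual.toDual ∘ x).1 rfl
    have hanti : Antitone (x ∘ (orderingOf x).1) := fun i j h => h1 h
    refine ⟨?_, hanti, rfl⟩
    rw [weakOrderings, mem_filter, mem_product, mem_powerset]
    refine ⟨⟨mem_univ _, filter_subset _ _⟩, fun k hk => ?_⟩
    obtain ⟨a, a', rfl, h3, h4⟩ := exists_of_mem_dropSet hk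
    rw [← h3, orderingOf, val_mem_dropSet h3.symm]
    have haa' : a < a' := Fin.lt_def.2 (by omega)
    refine lt_of_le_of_ne (hanti haa'.le) fun h5 => ?_
    have := h2 a a' haa' (congrArg OrderDual.toDual h5.symm)
    exact absurd (Fin.lt_def.1 this) h4.le.not_gt

/-- A weak ordering of `x` induces the partition into the fibres of `b` if and only if the values
of `x` on each fibre are larger than those on the following ones. -/
theorem exists_cuts_iff {x : Fin g → ℕ} {v : Equiv.Perm (Fin g) × Finset ℕ} (hx : IsOrderOf x v)
    {s : ℕ} {A : Fin s → Finset (Fin g)} (hne : ∀ i, (A i).Nonempty) {b : Fin g → ℕ}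
    (hb : ∀ a, b a < s) (hA : ∀ i a, a ∈ A i ↔ b a = i) :
    (∃ t : Fin (s + 1) → ℕ, t 0 = 0 ∧ t (Fin.last s) = g ∧ StrictMono t ∧
      (∀ i : Fin (s + 1), 0 < i → i < Fin.last s → t i ∈ v.2) ∧
      ∀ k : Fin s, A k =
        (univ.filter fun j : Fin g => t k.castSucc ≤ j ∧ (j : ℕ) < t k.succ).image v.1) ↔
    ∀ a a', b a < b a' → x a' < x a := by
  obtain ⟨-, hanti, hJ⟩ := hx
  constructor
  · rintro ⟨t, -, -, ht, htJ, htA⟩ a a' haa'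
    have h1 : a ∈ A ⟨b a, hb a⟩ := (hA _ _).2 rfl
    have h2 : a' ∈ A ⟨b a', hb a'⟩ := (hA _ _).2 rfl
    rw [htA, mem_image] at h1 h2
    obtain ⟨j, hj, rfl⟩ := h1
    obtain ⟨j', hj', rfl⟩ := h2
    rw [mem_filter] at hj hj'
    set k : Fin (s + 1) := (⟨b (v.1 j), hb _⟩ : Fin s).succ with hk
    have h3 : t k ≤ j' := (ht.monotone (Fin.le_def.2 (by simpa [hk] using haa'))).trans hj'.2.1
    have h4 : t k ∈ v.2 := htJ k (Fin.succ_pos _) (Fin.lt_def.2 (by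
      have := hb (v.1 j')
      simp [hk]
      omega))
    rw [hJ] at h4
    obtain ⟨c, c', h5, h6, h7⟩ := exists_of_mem_dropSet h4
    have h8 : x (v.1 j') ≤ x (v.1 c') := hanti (Fin.le_def.2 (by omega))
    have h9 : x (v.1 c) ≤ x (v.1 j) := hanti (Fin.le_def.2 (by omega))
    simp only [Function.comp] at h7
    omega
  · intro hsep
    have hinit : ∀ (k : ℕ) (j : Fin g), b (v.1 j) < k ↔ (j : ℕ) < #(blocksBelow b k) := by
      intro k j
      have h1 := iff_lt_card_of_isInitial (fun j => b (v.1 j) < k) (fun i j hij hj => by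
        by_contra h
        exact absurd (hsep (v.1 j) (v.1 i) (by omega)) (not_lt.2 (hanti hij))) j
      rw [h1, card_equiv v.1 (t := blocksBelow b k) fun i => by simp [blocksBelow]]
    have hmono : StrictMono fun k : Fin (s + 1) => #(blocksBelow b k) := by
      refine Fin.strictMono_iff_lt_succ.2 fun i => card_lt_card ?_
      obtain ⟨a, ha⟩ := hne i
      rw [hA] at ha
      refine (ssubset_iff_of_subset fun a' ha' => ?_).2 ⟨a, ?_, ?_⟩
      · simp only [blocksBelow, mem_filter, mem_univ, true_and, Fin.val_castSucc,
          Fin.val_succ] at ha' ⊢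
        omega
      · simp [blocksBelow, ha]
      · simp [blocksBelow, ha]
    refine ⟨fun k => #(blocksBelow b k), by simp [blocksBelow], by simp [blocksBelow, hb], hmono,
      fun i hi0 hi => ?_, fun k => ?_⟩
    · have h1 := hmono hi0
      have h2 := hmono hi
      simp only [Fin.val_last] at h1 h2
      have h3 : #(blocksBelow b s) ≤ g := (card_le_univ _).trans_eq (Fintype.card_fin g)
      set c : Fin g := ⟨#(blocksBelow b i) - 1, by omega⟩ with hc
      set c' : Fin g := ⟨#(blocksBelow b i), by omega⟩ with hc'
      have h4 : (c : ℕ) + 1 = c' := by simp only [hc, hc']; omega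
      change (c' : ℕ) ∈ v.2
      rw [hJ, val_mem_dropSet h4]
      have h5 : b (v.1 c) < i := (hinit i c).2 (by simp only [hc]; omega)
      have h6 : ¬ b (v.1 c') < i := fun h => lt_irrefl _ ((hinit i c').1 h)
      exact hsep _ _ (by omega)
    · ext a
      obtain ⟨j, rfl⟩ := v.1.surjective a
      rw [hA, mem_image]
      simp only [mem_filter, mem_univ, true_and, EmbeddingLike.apply_eq_iff_eq, exists_eq_right,
        Fin.val_castSucc, Fin.val_succ]
      rw [← hinit, ← not_lt, ← hinit]
      omega

/-! ### Configurations that belong to a Dyck word and a set partition -/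

theorem hasOverlap_iff {w : DyckWord} {s : ℕ} {L M : Fin (s + 1) → ℕ} (h : IsBlockForm w L M)
    {mu lam : Fin n → ℕ} : HasOverlap mu lam w ↔ Antitone mu ∧ Antitone lam ∧
      (∀ i < s, ∀ α β : Fin n, (α : ℕ) + 1 = natExtend L (i + 1) → (β : ℕ) = natExtend M i →
        mu β ≤ lam α) ∧
      ∀ i, 0 < i → i < s → ∀ α β : Fin n, (α : ℕ) = natExtend L i → (β : ℕ) + 1 = natExtend M i →
        lam α < mu β := by
  constructor
  · rintro ⟨r, L', M', h', h1, h2, h3, h4⟩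
    obtain ⟨e, eL, eM⟩ := h.unique h'
    subst e
    obtain rfl : L = L' := funext eL
    obtain rfl : M = M' := funext eM
    refine ⟨h1, h2, fun i hi α β hα hβ => h3 ⟨i, hi⟩ α β ?_ ?_, fun i hi0 hi α β hα hβ =>
      h4 ⟨i, by omega⟩ (Fin.lt_def.2 hi0) (Fin.lt_def.2 hi) α β ?_ ?_⟩
    · exact hα.trans (natExtend_val L (⟨i, hi⟩ : Fin r).succ)
    · exact hβ.trans (natExtend_val M (⟨i, hi⟩ : Fin r).castSucc)
    · exact hα.trans (natExtend_val L ⟨i, by omega⟩)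
    · exact hβ.trans (natExtend_val M ⟨i, by omega⟩)
  · rintro ⟨h1, h2, h3, h4⟩
    refine ⟨s, L, M, h, h1, h2, fun i α β hα hβ => h3 i i.2 α β ?_ ?_, fun i hi0 hi α β hα hβ =>
      h4 i (Fin.lt_def.1 hi0) (Fin.lt_def.1 hi) α β ?_ ?_⟩
    · exact hα.trans (natExtend_val L i.succ).symm
    · exact hβ.trans (natExtend_val M i.castSucc).symm
    · exact hα.trans (natExtend_val L i).symm
    · exact hβ.trans (natExtend_val M i).symm

theorem exists_blockIndex {s : ℕ} {A : Fin s → Finset (Fin g)}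
    (hdisj : ∀ i j, i ≠ j → Disjoint (A i) (A j)) (huniv : univ.biUnion A = univ) :
    ∃ b : Fin g → ℕ, (∀ a, b a < s) ∧ ∀ i a, a ∈ A i ↔ b a = i := by
  have h1 : ∀ a, ∃ i, a ∈ A i := fun a => by
    have := mem_univ a
    rw [← huniv, mem_biUnion] at this
    obtain ⟨i, -, h⟩ := this
    exact ⟨i, h⟩
  choose c hc using h1
  refine ⟨fun a => c a, fun a => (c a).2, fun i a => ⟨fun h => ?_, fun h => ?_⟩⟩
  · by_contra hne
    exact disjoint_left.1 (hdisj (c a) i fun h => hne (congrArg Fin.val h)) (hc a) h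
  · rw [← Fin.ext h]
    exact hc a

theorem sum_blocksBelow_eq {f b : Fin g → ℕ} {s : ℕ} {A : Fin s → Finset (Fin g)}
    (hA : ∀ i a, a ∈ A i ↔ b a = i) {L : Fin (s + 1) → ℕ} (hL : StrictMono L) (hL0 : L 0 = 0)
    (hsum : ∀ i : Fin s, ∑ j ∈ A i, f j = L i.succ - L i.castSucc) {k : ℕ} (hk : k ≤ s) :
    ∑ a ∈ blocksBelow b k, f a = natExtend L k := by
  induction k with
  | zero =>
    refine Eq.trans ?_ (hL0.symm.trans (natExtend_val L 0).symm)
    simp [blocksBelow]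
  | succ k ih =>
    have h1 : blockAt b k = A ⟨k, hk⟩ := by
      ext a
      rw [hA]
      simp [blockAt]
    have h2 : natExtend L k = L (⟨k, hk⟩ : Fin s).castSucc :=
      natExtend_val L (⟨k, hk⟩ : Fin s).castSucc
    have h3 : natExtend L (k + 1) = L (⟨k, hk⟩ : Fin s).succ :=
      natExtend_val L (⟨k, hk⟩ : Fin s).succ
    have h4 := hL (⟨k, hk⟩ : Fin s).castSucc_lt_succ
    rw [← blocksBelow_union_blockAt, sum_blocksBelow_union f subset_rfl, ih (by omega), h1, hsum,
      h2, h3]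
    omega

/-- The summands of the generating function of a Dyck word and a set partition correspond to the
configurations that satisfy the interleaving inequalities. -/
theorem genFun_eq {f : Fin g → ℕ} (hf : ∀ a, 0 < f a) (hn : ∑ a, f a = n) {w : DyckWord}
    (hw : w.semilength = n) {s : ℕ} {A : Fin s → Finset (Fin g)} (hA : IsCompatible f w A)
    {b : Fin g → ℕ} (hb : ∀ a, b a < s) (hAb : ∀ i a, a ∈ A i ↔ b a = i) {L M : Fin (s + 1) → ℕ}
    (hLM : IsBlockForm w L M) (hsum : ∀ i : Fin s, ∑ j ∈ A i, f j = L i.succ - L i.castSucc)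
    {p : ℕ} (hp : p.Prime) :
    genFun f n w A p = C (leadFactor f b (natExtend M) (p : ℚ) s) *
      configSeries f (configWeight f p n) (validConfigs n b (natExtend M) s univ n) := by
  classical
  obtain ⟨hLs, hMs, hML⟩ := hLM.natExtend_spec
  rw [hw] at hLs hMs
  have hL := strictMono_natExtend hLM.2.2.1
  have hM := strictMono_natExtend hLM.2.2.2.1
  have hL0 : natExtend L 0 = 0 := (natExtend_val L 0).trans hLM.1
  have hM0 : natExtend M 0 = 0 := (natExtend_val M 0).trans hLM.2.1
  have hK : ∀ k ≤ s, ∑ a ∈ blocksBelow b k, f a = natExtend L k := fun k hk =>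
    sum_blocksBelow_eq hAb hLM.2.2.1 hLM.1 hsum hk
  set V := validConfigs n b (natExtend M) s univ n with hVdef
  have hV : ∀ q : Config g n, q ∈ V ↔ (∀ a a', b a < b a' → q.1 a' < q.1 a) ∧
      HasOverlap q.2 (sortDesc (q.1 ∘ blockOf f hn)) w := by
    intro q
    rw [hVdef, mem_validConfigs_iff hf hn hM hM0 hL hL0 hMs hLs hb hK, hasOverlap_iff hLM]
    have := antitone_sortDesc (q.1 ∘ blockOf f hn)
    tauto
  have hdeg : ∀ q : Config g n,
      ∑ i, q.2 i + 2 * ∑ i, (q.1 ∘ blockOf f hn) i = configDeg f q := by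
    intro q
    rw [configDeg]
    congr 2
    exact sum_blockOf f hn q.1
  ext d
  rw [genFun, map_sum, coeff_C_mul, configSeries, coeff_mk, mul_sum]
  simp only [genFunWV, coeff_mk]
  rw [sum_sigma']
  refine sum_bij' (fun q _ => (blockValues f q.2.1, q.2.2))
    (fun q _ => ⟨orderingOf q.1, q.1 ∘ blockOf f hn, q.2⟩) ?_ ?_ ?_ ?_ ?_
  · rintro ⟨v, l, μ⟩ hq
    simp only [mem_sigma, mem_filter] at hq ⊢
    obtain ⟨⟨-, -, hcut⟩, -, hl, hv, -, ho, hd⟩ := hq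
    have hl' := hl.eq_comp_blockOf hf hn
    refine ⟨(mem_configsOfDeg hf).2 ?_, (hV _).2 ⟨(exists_cuts_iff hv hA.1 hb hAb).1 hcut, ?_⟩⟩
    · rw [← hdeg]
      simp only [← hl']
      exact hd
    · simp only [← hl']
      exact ho
  · rintro q hq
    simp only [mem_sigma, mem_filter] at hq ⊢
    obtain ⟨hqd, hqV⟩ := hq
    have hv : IsOrderOf q.1 (orderingOf q.1) := isOrderOf_iff.2 rfl
    obtain ⟨h1, h2⟩ := (hV q).1 hqV
    have h3 := (mem_configsOfDeg hf).1 hqd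
    rw [configsOfDeg, mem_filter, mem_product, Fintype.mem_piFinset, Fintype.mem_piFinset] at hqd
    refine ⟨⟨hv.1, hA, (exists_cuts_iff hv hA.1 hb hAb).2 h1⟩, ?_, isAdmissible_comp_blockOf f hn _,
      ?_, le_sortDesc_of_mem_validConfigs hn hM hM0 hMs hK hML hqV, h2, (hdeg q).trans h3⟩
    · rw [mem_product, Fintype.mem_piFinset, Fintype.mem_piFinset]
      exact ⟨fun k => hqd.1.1 _, hqd.1.2⟩
    · rw [blockValues_comp_blockOf hf hn]
      exact hv
  · rintro ⟨v, l, μ⟩ hq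
    simp only [mem_sigma, mem_filter] at hq
    obtain ⟨-, -, hl, hv, -⟩ := hq
    simp only [← hl.eq_comp_blockOf hf hn, ← isOrderOf_iff.1 hv]
  · rintro q hq
    simp only [blockValues_comp_blockOf hf hn]
  · rintro ⟨v, l, μ⟩ hq
    simp only [mem_sigma, mem_filter] at hq
    obtain ⟨⟨-, -, hcut⟩, -, hl, hv, -, ho, hd⟩ := hq
    have hl' := hl.eq_comp_blockOf hf hn
    have hqV : ((blockValues f l, μ) : Config g n) ∈ V :=
      (hV _).2 ⟨(exists_cuts_iff hv hA.1 hb hAb).1 hcut, by simp only [← hl']; exact ho⟩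
    have := alpha_mul_pow_eq hp hn hM hM0 hMs hb hqV
    simp only [← hl'] at this
    exact this

end HeisenbergDyck

theorem mainTheorem3 (g n : ℕ) (hg : 0 < g) (f : Fin g → ℕ) (hf : ∀ i, 0 < f i)
    (hn : ∑ i, f i = n) (w : DyckWord) (hw : w.semilength = n)
    (s : ℕ) (A : Fin s → Finset (Fin g)) (hA : HeisenbergDyck.IsCompatible f w A) :
    ∃ W : HeisenbergDyck.RatXY,
      HeisenbergDyck.Represents W (HeisenbergDyck.genFun f n w A) ∧
      HeisenbergDyck.invVars W =
        (-1) ^ (g + n) * HeisenbergDyck.varX ^ ((5 * n ^ 2 - n) / 2) *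
          HeisenbergDyck.varY ^ (5 * n) * W := by
  open HeisenbergDyck in
  obtain ⟨hne, hdisj, huniv, L, M, hLM, hsum⟩ := id hA
  obtain ⟨b, hb, hAb⟩ := exists_blockIndex hdisj huniv
  obtain ⟨-, hMs, -⟩ := hLM.natExtend_spec
  rw [hw] at hMs
  have hM := strictMono_natExtend hLM.2.2.2.1
  have hM0 : natExtend M 0 = 0 := (natExtend_val M 0).trans hLM.2.1
  have hbs : ∀ i < s, ∃ a, b a = i := fun i hi => by
    obtain ⟨a, ha⟩ := hne ⟨i, hi⟩
    exact ⟨a, (hAb _ a).1 ha⟩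
  have hall : blocksBelow b s = univ := by
    ext a
    simp [blocksBelow, hb a]
  refine ⟨_, FracRep.represents (((FracRep.leadFactor f b (natExtend M) s).mul
    (FracRep.blockProduct (n := n) hf (natExtend M) s)).congr fun p hp => ?_),
    invVars_leadFactor_mul_blockProduct hf hn hM hM0 hbs hb hMs⟩
  rw [genFun_eq hf hn hw hA hb hAb hLM hsum hp, map_mul,
    ← toFrac_configSeries_eq_blockProduct hf hp hM hM0 hbs hMs.le, hall, hMs]
  congr 1
  refine Eq.trans ?_ (map_leadFactor (toFrac.comp (C (R := ℚ))) _ _).symm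
  rw [map_natCast]
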